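/- Let $M(c)=(M^{2n+1},\phi,\xi,\eta,g)$ be a Sasakian space form, i.e. a normal contact metric manifold ($d\eta(X,Y)=g(X,\phi Y)$, $N_\phi=-2\,d\eta\otimes\xi$, with $2\,d\eta(X,Y)=X\eta(Y)-Y\eta(X)-\eta([X,Y])$) of constant $\phi$-sectional curvature $c$, and suppose $c\neq 1$. Let $I\subset\mathbb R$ be a non-empty open interval and let $\gamma:I\to M(c)$ be a smooth unit speed Legendre curve ($\eta(T)=0$, where $T=\gamma'$) that is a Frenet curve of osculating order $r\ge 2$: there are smooth orthonormal vector fields $E_1=T,E_2,\dots,E_r$ along $\gamma$ and positive smooth functions $k_1,\dots,k_{r-1}$ on $I$ with $$\nabla_TE_1=k_1E_2,\qquad \nabla_TE_i=-k_{i-1}E_{i-1}+k_iE_{i+1}\ \ (2\le i\le r-1),\qquad \nabla_TE_r=-k_{r-1}E_{r-1},$$ and put $k_i=0$ for $i\ge r$. (For $r=2$ only the first and the last equation occur.) Suppose that $\phi T\perp E_2$ along $\gamma$, and let $\delta_1,\delta_2\in\mathbb R$ with $\delta_2\neq0$ and $\delta_1/\delta_2\neq 0$. Call $\gamma$ interpolating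 sesqui-harmonic if, for every compact interval $\Omega\subset I$, it is a critical point of $$E_{\delta_1,\delta_2}(\gamma)=\delta_1\int_\Omega|\gamma'|^2\,dt+\delta_2\int_\Omega|\nabla_{\gamma'}\gamma'|^2\,dt$$ with respect to smooth variations that fix $\gamma$ outside the interior of $\Omega$. Then $\gamma$ is interpolating sesqui-harmonic if and only if $$k_1=\text{constant}>0,\qquad k_2=\text{constant},\qquad k_1^2+k_2^2=\frac{c+3}{4}-\frac{\delta_1}{\delta_2},\qquad k_2k_3=0 .$$ -/

import Mathlib

open Bundle FiberBundle VectorField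
open scoped Manifold ContDiff

noncomputable section
section LeviCivita
variable {E : Type*} [NormedAddCommGroup E] [NormedSpace ℝ E]
  {H : Type*} [TopologicalSpace H] {I : ModelWithCorners ℝ E H}
  {M : Type*} [TopologicalSpace M] [ChartedSpace H M] [IsManifold I ∞ M]
  [RiemannianBundle (fun x : M ↦ TangentSpace I x)]
  [IsContMDiffRiemannianBundle I ∞ E (fun x : M ↦ TangentSpace I x)]

lemma mdiffAt_inner {X Y : Π x : M, TangentSpace I x} {x : M} (hX : MDiffAt (T% X) x)
    (hY : MDiffAt (T% Y) x) : MDiffAt (fun y ↦ inner ℝ (X y) (Y y)) x :=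
  MDifferentiableAt.inner_bundle (IB := I) (F := E) (E := fun x : M ↦ TangentSpace I x) hX hY

variable [FiniteDimensional ℝ E]

/-- The right-hand side of Koszul's formula for `g(∇_X Y, Z)` at `x`. -/
def koszulForm (Y X Z : Π x : M, TangentSpace I x) (x : M) : ℝ :=
  (1 / 2) * (mvfderiv I (fun y ↦ inner ℝ (Y y) (Z y)) x (X x)
    + mvfderiv I (fun y ↦ inner ℝ (X y) (Z y)) x (Y x)
    - mvfderiv I (fun y ↦ inner ℝ (X y) (Y y)) x (Z x)
    + inner ℝ (mlieBracket I X Y x) (Z x)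
    - inner ℝ (mlieBracket I X Z x) (Y x)
    - inner ℝ (mlieBracket I Y Z x) (X x))

lemma koszulForm_tensorial_left {Y Z : Π x : M, TangentSpace I x} {x : M}
    (hY : MDiffAt (T% Y) x) (hZ : MDiffAt (T% Z) x) :
    TensorialAt I E (fun X : Π x : M, TangentSpace I x ↦ koszulForm Y X Z x) x where
  smul {f X} hf hX := by
    simp only [koszulForm, mlieBracket_smul_left hf hX, Pi.smul_apply', inner_smul_left,
      inner_add_left, inner_smul_right, mvfderiv_fun_mul hf (mdiffAt_inner hX hZ),
      mvfderiv_fun_mul hf (mdiffAt_inner hX hY), map_smul, smul_eq_mul,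
      conj_trivial, _root_.add_apply, _root_.smul_apply,
      neg_smul, inner_neg_left]
    rw [real_inner_comm (Z x) (X x), real_inner_comm (Y x) (X x)]
    ring
  add {X X'} hX hX' := by
    simp only [koszulForm, mlieBracket_add_left hX hX', Pi.add_apply,
      inner_add_left, inner_add_right, mvfderiv_fun_add (mdiffAt_inner hX hZ) (mdiffAt_inner hX' hZ),
      mvfderiv_fun_add (mdiffAt_inner hX hY) (mdiffAt_inner hX' hY), map_add,
      _root_.add_apply]
    ring

lemma koszulForm_tensorial_right {Y X : Π x : M, TangentSpace I x} {x : M}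
    (hY : MDiffAt (T% Y) x) (hX : MDiffAt (T% X) x) :
    TensorialAt I E (fun Z : Π x : M, TangentSpace I x ↦ koszulForm Y X Z x) x where
  smul {f Z} hf hZ := by
    simp only [koszulForm, mlieBracket_smul_right hf hZ, Pi.smul_apply', inner_smul_left,
      inner_add_left, inner_smul_right, mvfderiv_fun_mul hf (mdiffAt_inner hX hZ),
      mvfderiv_fun_mul hf (mdiffAt_inner hY hZ), map_smul, smul_eq_mul,
      conj_trivial, _root_.add_apply, _root_.smul_apply]
    rw [real_inner_comm (X x) (Z x), real_inner_comm (Y x) (Z x)]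
    ring
  add {Z Z'} hZ hZ' := by
    simp only [koszulForm, mlieBracket_add_right hZ hZ', Pi.add_apply,
      inner_add_left, inner_add_right, mvfderiv_fun_add (mdiffAt_inner hX hZ) (mdiffAt_inner hX hZ'),
      mvfderiv_fun_add (mdiffAt_inner hY hZ) (mdiffAt_inner hY hZ'), map_add,
      _root_.add_apply]
    ring


instance instFiniteDimensionalTangentSpaceModel (x : M) : FiniteDimensional ℝ (TangentSpace I x) :=
  inferInstanceAs (FiniteDimensional ℝ E)

open Classical in
/-- The vector `∇_v Y ∈ T_x M` given by Koszul's formula, for a vector field `Y` that is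
differentiable at `x` (and `0` otherwise): `∇_v Y` is the Riesz representative of the linear form
`w ↦ koszulForm Y V W x`, where `V`, `W` extend `v`, `w`. -/
def leviCivitaFun (Y : Π x : M, TangentSpace I x) (x : M) :
    TangentSpace I x →L[ℝ] TangentSpace I x :=
  haveI : CompleteSpace (TangentSpace I x) := FiniteDimensional.complete ℝ _
  if hY : MDiffAt (T% Y) x then
    LinearMap.toContinuousLinearMap
      { toFun := fun v ↦ (InnerProductSpace.toDual ℝ (TangentSpace I x)).symm
          (TensorialAt.mkHom₂ (I := I) (F := E) (F' := E) (fun X Z ↦ koszulForm Y X Z x) x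
            (fun _ hZ ↦ koszulForm_tensorial_left hY hZ)
            (fun _ hX ↦ koszulForm_tensorial_right hY hX) v)
        map_add' := fun v w ↦ by simp only [map_add]
        map_smul' := fun a v ↦ by simp only [map_smul, RingHom.id_apply] }
  else 0

lemma inner_leviCivitaFun {X Y Z : Π x : M, TangentSpace I x} {x : M}
    (hX : MDiffAt (T% X) x) (hY : MDiffAt (T% Y) x) (hZ : MDiffAt (T% Z) x) :
    inner ℝ (leviCivitaFun Y x (X x)) (Z x) = koszulForm Y X Z x := by
  have : CompleteSpace (TangentSpace I x) := FiniteDimensional.complete ℝ _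
  rw [leviCivitaFun, dif_pos hY]
  simp only [LinearMap.coe_toContinuousLinearMap', LinearMap.coe_mk, AddHom.coe_mk]
  rw [InnerProductSpace.toDual_symm_apply]
  exact TensorialAt.mkHom₂_apply (I := I) (F := E) (F' := E) _ _ hX hZ

lemma inner_leviCivitaFun_extend {Y : Π x : M, TangentSpace I x} {x : M}
    (hY : MDiffAt (T% Y) x) (v w : TangentSpace I x) :
    inner ℝ (leviCivitaFun Y x v) w = koszulForm Y (extend E v) (extend E w) x := by
  rw [← inner_leviCivitaFun (mdifferentiableAt_extend ..) hY (mdifferentiableAt_extend ..)]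
  simp

/-- The Levi-Civita connection of the Riemannian metric.  As everywhere for covariant derivatives,
`leviCivita Y x v` stands for `∇_v Y` at `x`. -/
def leviCivita : CovariantDerivative I E (TangentSpace I : M → Type _) where
  toFun := leviCivitaFun
  isCovariantDerivativeOnUniv :=
    { add := by
        intro Y Y' x hY hY' _
        ext1 v
        refine ext_inner_right ℝ fun w ↦ ?_
        have hv : MDiffAt (T% (extend E v)) x := mdifferentiableAt_extend ..
        have hw : MDiffAt (T% (extend E w)) x := mdifferentiableAt_extend ..
        rw [inner_leviCivitaFun_extend (mdifferentiableAt_add_section hY hY'), _root_.add_apply, inner_add_left,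
          inner_leviCivitaFun_extend hY, inner_leviCivitaFun_extend hY']
        simp only [koszulForm, mlieBracket_add_left hY hY', mlieBracket_add_right hY hY', Pi.add_apply,
          inner_add_left, inner_add_right, map_add, _root_.add_apply,
          mvfderiv_fun_add (mdiffAt_inner hY hw) (mdiffAt_inner hY' hw),
          mvfderiv_fun_add (mdiffAt_inner hv hY) (mdiffAt_inner hv hY')]
        ring
      leibniz := by
        intro Y f x hY hf _
        ext1 v
        refine ext_inner_right ℝ fun w ↦ ?_
        have hv : MDiffAt (T% (extend E v)) x := mdifferentiableAt_extend ..
        have hw : MDiffAt (T% (extend E w)) x := mdifferentiableAt_extend ..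
        rw [inner_leviCivitaFun_extend (hf.smul_section hY), _root_.add_apply, inner_add_left,
          _root_.smul_apply, inner_smul_left, inner_leviCivitaFun_extend hY]
        simp only [koszulForm, mlieBracket_smul_left hf hY, mlieBracket_smul_right hf hY, Pi.smul_apply',
          inner_add_left, inner_smul_left, inner_smul_right, map_smul, _root_.add_apply, _root_.smul_apply,
          mvfderiv_fun_mul hf (mdiffAt_inner hY hw), neg_smul, inner_neg_left,
          mvfderiv_fun_mul hf (mdiffAt_inner hv hY), conj_trivial, smul_eq_mul,
          ContinuousLinearMap.smulRight_apply, extend_apply_self]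
        rw [real_inner_comm v (Y x)]
        ring }

/-- The Levi-Civita connection is torsion free. -/
theorem leviCivita_torsion : (leviCivita (I := I) (M := M)).torsion = 0 := by
  rw [CovariantDerivative.torsion_eq_zero_iff]
  intro X Y x hX hY
  refine ext_inner_right ℝ fun w ↦ ?_
  have hw : MDiffAt (T% (extend E w)) x := mdifferentiableAt_extend ..
  have h1 := inner_leviCivitaFun hX hY hw
  have h2 := inner_leviCivitaFun hY hX hw
  simp only [extend_apply_self] at h1 h2
  change inner ℝ (leviCivitaFun Y x (X x) - leviCivitaFun X x (Y x)) w = _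
  rw [inner_sub_left, h1, h2]
  simp only [koszulForm, extend_apply_self, mlieBracket_swap_apply (V := Y) (W := X), inner_neg_left,
    real_inner_comm (Y _) (X _)]
  ring

/-- The Levi-Civita connection is compatible with the metric. -/
theorem leviCivita_isMetricCompatible {X Y Z : Π x : M, TangentSpace I x} {x : M}
    (hX : MDiffAt (T% X) x) (hY : MDiffAt (T% Y) x) (hZ : MDiffAt (T% Z) x) :
    mvfderiv I (fun y ↦ inner ℝ (Y y) (Z y)) x (X x) =
      inner ℝ (leviCivita Y x (X x)) (Z x) + inner ℝ (Y x) (leviCivita Z x (X x)) := by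
  change _ = inner ℝ (leviCivitaFun Y x (X x)) (Z x) + inner ℝ (Y x) (leviCivitaFun Z x (X x))
  rw [real_inner_comm (leviCivitaFun Z x (X x)) (Y x), inner_leviCivitaFun hX hY hZ,
    inner_leviCivitaFun hX hZ hY]
  simp only [koszulForm, mlieBracket_swap_apply (V := Z) (W := Y), inner_neg_left,
    real_inner_comm (Y _) (Z _)]
  ring
end LeviCivita

section Curvature
variable {E : Type*} [NormedAddCommGroup E] [NormedSpace ℝ E] [FiniteDimensional ℝ E]
  {H : Type*} [TopologicalSpace H] {I : ModelWithCorners ℝ E H}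
  {M : Type*} [TopologicalSpace M] [ChartedSpace H M] [IsManifold I ∞ M]
  [RiemannianBundle (fun x : M ↦ TangentSpace I x)]
  [IsContMDiffRiemannianBundle I ∞ E (fun x : M ↦ TangentSpace I x)]

/-- `R(X, Y)Z = ∇_X ∇_Y Z - ∇_Y ∇_X Z - ∇_[X, Y] Z` for vector fields. -/
def curvatureField (X Y Z : Π x : M, TangentSpace I x) (x : M) : TangentSpace I x :=
  leviCivita (fun y ↦ leviCivita Z y (Y y)) x (X x)
    - leviCivita (fun y ↦ leviCivita Z y (X y)) x (Y x)
    - leviCivita Z x (mlieBracket I X Y x)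

/-- The Riemannian curvature tensor `R(u, v)w` at a point, computed with extensions of the three
tangent vectors to vector fields that are smooth near `x`. -/
def riemannCurvature (x : M) (u v w : TangentSpace I x) : TangentSpace I x :=
  curvatureField (extend E u) (extend E v) (extend E w) x

end Curvature

section Contact
variable {E : Type*} [NormedAddCommGroup E] [NormedSpace ℝ E] [FiniteDimensional ℝ E]
  {H : Type*} [TopologicalSpace H] (I : ModelWithCorners ℝ E H)
  {M : Type*} [TopologicalSpace M] [ChartedSpace H M] [IsManifold I ∞ M]

/-- The exterior derivative of a one-form, in the normalisation
`2 dη(X, Y) = X (η Y) - Y (η X) - η [X, Y]`. -/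
def extDerivOneForm (η : Π x : M, TangentSpace I x →L[ℝ] ℝ) (X Y : Π x : M, TangentSpace I x)
    (x : M) : ℝ :=
  (1 / 2) * (mvfderiv I (fun y ↦ η y (Y y)) x (X x) - mvfderiv I (fun y ↦ η y (X y)) x (Y x)
    - η x (mlieBracket I X Y x))

/-- The Nijenhuis tensor
`N_φ(X, Y) = φ²[X, Y] + [φX, φY] - φ[φX, Y] - φ[X, φY]` of a field of endomorphisms. -/
def nijenhuis (φ : Π x : M, TangentSpace I x →L[ℝ] TangentSpace I x)
    (X Y : Π x : M, TangentSpace I x) (x : M) : TangentSpace I x :=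
  φ x (φ x (mlieBracket I X Y x)) + mlieBracket I (fun y ↦ φ y (X y)) (fun y ↦ φ y (Y y)) x
    - φ x (mlieBracket I (fun y ↦ φ y (X y)) Y x) - φ x (mlieBracket I X (fun y ↦ φ y (Y y)) x)

variable [RiemannianBundle (fun x : M ↦ TangentSpace I x)]

/-- `(φ, ξ, η, g)` is an almost contact metric structure, `g` being the Riemannian metric of `M`. -/
structure IsAlmostContactMetric (φ : Π x : M, TangentSpace I x →L[ℝ] TangentSpace I x)
    (ξ : Π x : M, TangentSpace I x) (η : Π x : M, TangentSpace I x →L[ℝ] ℝ) : Prop where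
  contMDiff_phi : ContMDiff I (I.prod 𝓘(ℝ, E →L[ℝ] E)) ∞
    (fun x ↦ TotalSpace.mk' (E →L[ℝ] E) (E := fun y : M ↦ TangentSpace I y →L[ℝ] TangentSpace I y)
      x (φ x))
  contMDiff_xi : ContMDiff I (I.prod 𝓘(ℝ, E)) ∞
    (fun x ↦ TotalSpace.mk' E (E := fun y : M ↦ TangentSpace I y) x (ξ x))
  contMDiff_eta : ContMDiff I (I.prod 𝓘(ℝ, E →L[ℝ] ℝ)) ∞
    (fun x ↦ TotalSpace.mk' (E →L[ℝ] ℝ) (E := fun y : M ↦ TangentSpace I y →L[ℝ] Trivial M ℝ y)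
      x (η x))
  phi_phi : ∀ (x : M) (v : TangentSpace I x), φ x (φ x v) = -v + η x v • ξ x
  eta_xi : ∀ x : M, η x (ξ x) = 1
  inner_phi_phi : ∀ (x : M) (v w : TangentSpace I x),
    inner ℝ (φ x v) (φ x w) = inner ℝ v w - η x v * η x w

/-- A contact metric structure: an almost contact metric structure with `dη(X, Y) = g(X, φY)`. -/
structure IsContactMetric (φ : Π x : M, TangentSpace I x →L[ℝ] TangentSpace I x)
    (ξ : Π x : M, TangentSpace I x) (η : Π x : M, TangentSpace I x →L[ℝ] ℝ) : Prop
    extends IsAlmostContactMetric I φ ξ η where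
  extDeriv_eta : ∀ (x : M) (X Y : Π y : M, TangentSpace I y),
    ContMDiffAt I (I.prod 𝓘(ℝ, E)) ∞
      (fun y ↦ TotalSpace.mk' E (E := fun z : M ↦ TangentSpace I z) y (X y)) x →
    ContMDiffAt I (I.prod 𝓘(ℝ, E)) ∞
      (fun y ↦ TotalSpace.mk' E (E := fun z : M ↦ TangentSpace I z) y (Y y)) x →
    extDerivOneForm I η X Y x = inner ℝ (X x) (φ x (Y x))

/-- A Sasakian structure: a normal contact metric structure, `N_φ = -2 dη ⊗ ξ`. -/
structure IsSasakian (φ : Π x : M, TangentSpace I x →L[ℝ] TangentSpace I x)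
    (ξ : Π x : M, TangentSpace I x) (η : Π x : M, TangentSpace I x →L[ℝ] ℝ) : Prop
    extends IsContactMetric I φ ξ η where
  normal : ∀ (x : M) (X Y : Π y : M, TangentSpace I y),
    ContMDiffAt I (I.prod 𝓘(ℝ, E)) ∞
      (fun y ↦ TotalSpace.mk' E (E := fun z : M ↦ TangentSpace I z) y (X y)) x →
    ContMDiffAt I (I.prod 𝓘(ℝ, E)) ∞
      (fun y ↦ TotalSpace.mk' E (E := fun z : M ↦ TangentSpace I z) y (Y y)) x →
    nijenhuis I φ X Y x = -(2 * extDerivOneForm I η X Y x) • ξ x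

/-- A Sasakian space form `M(c)`: a Sasakian manifold all of whose `φ`-sectional curvatures
`K(u, φu) = g(R(u, φu)φu, u)`, with `u` a unit vector orthogonal to `ξ`, are equal to `c`. -/
structure IsSasakianSpaceForm [IsContMDiffRiemannianBundle I ∞ E (fun x : M ↦ TangentSpace I x)]
    (φ : Π x : M, TangentSpace I x →L[ℝ] TangentSpace I x)
    (ξ : Π x : M, TangentSpace I x) (η : Π x : M, TangentSpace I x →L[ℝ] ℝ) (c : ℝ) : Prop
    extends IsSasakian I φ ξ η where
  phi_sectional : ∀ (x : M) (u : TangentSpace I x), ‖u‖ = 1 → inner ℝ u (ξ x) = 0 →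
    inner ℝ (riemannCurvature x u (φ x u) (φ x u)) u = c

end Contact

section Curves
variable {E : Type*} [NormedAddCommGroup E] [NormedSpace ℝ E] [FiniteDimensional ℝ E]
  {H : Type*} [TopologicalSpace H] (I : ModelWithCorners ℝ E H)
  {M : Type*} [TopologicalSpace M] [ChartedSpace H M]

/-- The velocity `γ'` of a curve. -/
def velocity (γ : ℝ → M) (t : ℝ) : TangentSpace I (γ t) :=
  mfderiv 𝓘(ℝ, ℝ) I γ t (1 : ℝ)

variable [IsManifold I ∞ M] [RiemannianBundle (fun x : M ↦ TangentSpace I x)]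
  [IsContMDiffRiemannianBundle I ∞ E (fun x : M ↦ TangentSpace I x)]

/-- The covariant derivative `∇_T V` of a vector field `V` along the curve `γ`, with `T = γ'`.
If `X₁, …, X_m` is the coordinate frame around `γ t` and `V = ∑ vⁱ Xᵢ`, this is
`∑ (vⁱ)'(t) Xᵢ + ∇_{γ'(t)} (∑ vⁱ(t) Xᵢ)`. -/
def covDerivAlong (γ : ℝ → M) (V : Π t : ℝ, TangentSpace I (γ t)) (t : ℝ) :
    TangentSpace I (γ t) :=
  (trivializationAt E (TangentSpace I : M → Type _) (γ t)).symm (γ t)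
      (deriv (fun s ↦ ((trivializationAt E (TangentSpace I : M → Type _) (γ t))
        (TotalSpace.mk' E (γ s) (V s))).2) t)
    + leviCivita (extend E (V t)) (γ t) (velocity I γ t)

/-- The tension field `τ(γ) = ∇_T T` of a curve `γ`, `T = γ'`. -/
def tensionField (γ : ℝ → M) (t : ℝ) : TangentSpace I (γ t) :=
  covDerivAlong I γ (velocity I γ) t

/-- The functional `δ₁ ∫ |γ'|² + δ₂ ∫ |τ(γ)|²` over the compact interval `[a, b]`. -/
def sesquiEnergy (δ₁ δ₂ a b : ℝ) (γ : ℝ → M) : ℝ :=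
  δ₁ * (∫ t in a..b, ‖velocity I γ t‖ ^ 2) + δ₂ * (∫ t in a..b, ‖tensionField I γ t‖ ^ 2)

/-- `γ : J → M` is interpolating sesqui-harmonic: it is a critical point of the functional
`sesquiEnergy` over every compact interval `[a, b] ⊆ J`, with respect to all smooth variations of
`γ` that fix `γ` outside `(a, b)`. -/
def IsInterpolatingSesquiHarmonic (δ₁ δ₂ : ℝ) (J : Set ℝ) (γ : ℝ → M) : Prop :=
  ∀ a b : ℝ, a < b → Set.Icc a b ⊆ J → ∀ ε : ℝ, 0 < ε → ∀ Γ : ℝ → ℝ → M,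
    ContMDiffOn 𝓘(ℝ, ℝ × ℝ) I ∞ (fun p : ℝ × ℝ ↦ Γ p.1 p.2) (Set.Ioo (-ε) ε ×ˢ J) →
    (∀ t ∈ J, Γ 0 t = γ t) →
    (∀ s ∈ Set.Ioo (-ε) ε, ∀ t ∈ J, t ∉ Set.Ioo a b → Γ s t = γ t) →
    HasDerivAt (fun s ↦ sesquiEnergy I δ₁ δ₂ a b (Γ s)) 0 0

/-- `γ : J → M` is a Frenet curve of osculating order `r`, with Frenet frame `F 1, …, F r` and
curvatures `k 1, …, k (r - 1)`.  The indices are those of the usual notation (`F 1 = T`); the values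
`F i` for `i = 0` and `i > r` and `k 0` play no role, and `k i = 0` for `i ≥ r` by convention, so
that the last Frenet equation is `∇_T (F r) = -k (r - 1) F (r - 1)`. -/
structure IsFrenetCurve (J : Set ℝ) (γ : ℝ → M) (r : ℕ)
    (F : ℕ → Π t : ℝ, TangentSpace I (γ t)) (k : ℕ → ℝ → ℝ) : Prop where
  one_le_order : 1 ≤ r
  contMDiffOn_curve : ContMDiffOn 𝓘(ℝ, ℝ) I ∞ γ J
  contMDiffOn_frame : ∀ i, 1 ≤ i → i ≤ r → ContMDiffOn 𝓘(ℝ, ℝ) (I.prod 𝓘(ℝ, E)) ∞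
    (fun t ↦ TotalSpace.mk' E (E := fun x : M ↦ TangentSpace I x) (γ t) (F i t)) J
  contDiffOn_curvature : ∀ i, 1 ≤ i → i < r → ContDiffOn ℝ ∞ (k i) J
  orthonormal : ∀ t ∈ J, ∀ i j, 1 ≤ i → i ≤ r → 1 ≤ j → j ≤ r →
    inner ℝ (F i t) (F j t) = if i = j then (1 : ℝ) else 0
  curvature_pos : ∀ i, 1 ≤ i → i < r → ∀ t ∈ J, 0 < k i t
  curvature_eq_zero : ∀ i, r ≤ i → ∀ t ∈ J, k i t = 0
  frame_one : ∀ t ∈ J, F 1 t = velocity I γ t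
  deriv_frame_one : ∀ t ∈ J, covDerivAlong I γ (F 1) t = k 1 t • F 2 t
  deriv_frame : ∀ i, 1 ≤ i → i < r → ∀ t ∈ J,
    covDerivAlong I γ (F (i + 1)) t = -(k i t) • F i t + k (i + 1) t • F (i + 2) t

end Curves

end

set_option synthInstance.maxHeartbeats 400000

section FlatConnection

lemma two_le_infty : (2 : WithTop ℕ∞) ≤ ∞ := WithTop.coe_le_coe.2 (le_top : (2 : ℕ∞) ≤ ⊤)

variable {E : Type*} [NormedAddCommGroup E] [NormedSpace ℝ E]
  {F : Type*} [NormedAddCommGroup F] [NormedSpace ℝ F]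

/-- `C` is the Christoffel tensor, on the open set `U`, of the Levi-Civita connection of the
metric `G`. -/
structure IsLeviCivitaOn (U : Set E) (G : E → E →L[ℝ] E →L[ℝ] ℝ) (C : E → E →L[ℝ] E →L[ℝ] E) :
    Prop where
  isOpen : IsOpen U
  contDiffOn_metric : ContDiffOn ℝ ∞ G U
  contDiffOn_conn : ContDiffOn ℝ ∞ C U
  metric_symm : ∀ y ∈ U, ∀ a b, G y a b = G y b a
  metric_pos : ∀ y ∈ U, ∀ a, a ≠ 0 → 0 < G y a a
  conn_symm : ∀ y ∈ U, ∀ a b, C y a b = C y b a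
  compat : ∀ y ∈ U, ∀ v a b, fderiv ℝ G y v a b = G y (C y v a) b + G y a (C y v b)

/-- The covariant derivative, in the direction `v`, of a vector field `X` along the map `u`. -/
noncomputable def flatCovDeriv (C : E → E →L[ℝ] E →L[ℝ] E) (u : F → E) (X : F → E) (p v : F) : E :=
  fderiv ℝ X p v + C (u p) (fderiv ℝ u p v) (X p)

/-- The curvature tensor `R(a, b)c` of a connection with Christoffel tensor `C`. -/
noncomputable def flatCurvature (C : E → E →L[ℝ] E →L[ℝ] E) (y a b c : E) : E :=
  fderiv ℝ C y a b c - fderiv ℝ C y b a c + C y a (C y b c) - C y b (C y a c)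

variable {U : Set E} {G : E → E →L[ℝ] E →L[ℝ] ℝ} {C : E → E →L[ℝ] E →L[ℝ] E}
  {u X Y : F → E} {p : F}

namespace IsLeviCivitaOn

lemma contDiffAt_metric (h : IsLeviCivitaOn U G C) {y : E} (hy : y ∈ U) : ContDiffAt ℝ ∞ G y :=
  h.contDiffOn_metric.contDiffAt (h.isOpen.mem_nhds hy)

lemma contDiffAt_conn (h : IsLeviCivitaOn U G C) {y : E} (hy : y ∈ U) : ContDiffAt ℝ ∞ C y :=
  h.contDiffOn_conn.contDiffAt (h.isOpen.mem_nhds hy)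

lemma differentiableAt_metric (h : IsLeviCivitaOn U G C) {y : E} (hy : y ∈ U) :
    DifferentiableAt ℝ G y :=
  (h.contDiffAt_metric hy).differentiableAt (by simp)

lemma differentiableAt_conn (h : IsLeviCivitaOn U G C) {y : E} (hy : y ∈ U) :
    DifferentiableAt ℝ C y :=
  (h.contDiffAt_conn hy).differentiableAt (by simp)

end IsLeviCivitaOn

lemma fderiv_bilin_comp {G : E → E →L[ℝ] E →L[ℝ] F} {F' : Type*} [NormedAddCommGroup F']
    [NormedSpace ℝ F'] {u X Y : F' → E} {p : F'} (hG : DifferentiableAt ℝ G (u p))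
    (hu : DifferentiableAt ℝ u p) (hX : DifferentiableAt ℝ X p) (hY : DifferentiableAt ℝ Y p)
    (v : F') :
    fderiv ℝ (fun q ↦ G (u q) (X q) (Y q)) p v =
      fderiv ℝ G (u p) (fderiv ℝ u p v) (X p) (Y p) + G (u p) (fderiv ℝ X p v) (Y p)
        + G (u p) (X p) (fderiv ℝ Y p v) := by
  have h1 : HasFDerivAt (fun q ↦ G (u q)) ((fderiv ℝ G (u p)).comp (fderiv ℝ u p)) p :=
    HasFDerivAt.comp (g := G) (f := u) p hG.hasFDerivAt hu.hasFDerivAt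
  have h2 := (h1.clm_apply hX.hasFDerivAt).clm_apply hY.hasFDerivAt
  rw [h2.fderiv]
  simp
  abel

/-- The Leibniz rule for the metric along a map. -/
lemma fderiv_metric (h : IsLeviCivitaOn U G C) (hp : u p ∈ U) (hu : DifferentiableAt ℝ u p)
    (hX : DifferentiableAt ℝ X p) (hY : DifferentiableAt ℝ Y p) (v : F) :
    fderiv ℝ (fun q ↦ G (u q) (X q) (Y q)) p v =
      G (u p) (flatCovDeriv C u X p v) (Y p) + G (u p) (X p) (flatCovDeriv C u Y p v) := by
  rw [fderiv_bilin_comp (h.differentiableAt_metric hp) hu hX hY, h.compat _ hp]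
  simp only [flatCovDeriv, map_add, _root_.add_apply]
  abel

lemma fderiv_fderiv_apply (hu : ContDiffAt ℝ 2 u p) (v w : F) :
    fderiv ℝ (fun q ↦ fderiv ℝ u q w) p v = fderiv ℝ (fderiv ℝ u) p v w := by
  have h1 : DifferentiableAt ℝ (fderiv ℝ u) p :=
    (hu.fderiv_right (m := 1) (by norm_num)).differentiableAt (by simp)
  have := h1.hasFDerivAt.clm_apply (hasFDerivAt_const w p)
  rw [this.fderiv]; simp

lemma fderiv_fderiv_comm (hu : ContDiffAt ℝ 2 u p) (v w : F) :
    fderiv ℝ (fun q ↦ fderiv ℝ u q w) p v = fderiv ℝ (fun q ↦ fderiv ℝ u q v) p w := by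
  rw [fderiv_fderiv_apply hu, fderiv_fderiv_apply hu]
  exact (hu.isSymmSndFDerivAt (by simp)).eq v w

lemma differentiableAt_fderiv_apply (hu : ContDiffAt ℝ 2 u p) (w : F) :
    DifferentiableAt ℝ (fun q ↦ fderiv ℝ u q w) p :=
  ((hu.fderiv_right (m := 1) (by norm_num)).differentiableAt (by simp)).clm_apply
    (differentiableAt_const w)

lemma flatCovDeriv_congr {X' u' : F → E} (hX : X =ᶠ[nhds p] X') (hu : u =ᶠ[nhds p] u') (v : F) :
    flatCovDeriv C u X p v = flatCovDeriv C u' X' p v := by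
  simp only [flatCovDeriv, hX.fderiv_eq, hu.fderiv_eq, hX.eq_of_nhds, hu.eq_of_nhds]

lemma flatCovDeriv_add (hX : DifferentiableAt ℝ X p) (hY : DifferentiableAt ℝ Y p) (v : F) :
    flatCovDeriv C u (fun q ↦ X q + Y q) p v
      = flatCovDeriv C u X p v + flatCovDeriv C u Y p v := by
  simp only [flatCovDeriv, fderiv_fun_add hX hY, map_add, _root_.add_apply]
  abel

lemma flatCovDeriv_sub (hX : DifferentiableAt ℝ X p) (hY : DifferentiableAt ℝ Y p) (v : F) :
    flatCovDeriv C u (fun q ↦ X q - Y q) p v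
      = flatCovDeriv C u X p v - flatCovDeriv C u Y p v := by
  simp only [flatCovDeriv, fderiv_fun_sub hX hY, map_sub, _root_.sub_apply]
  abel

lemma flatCovDeriv_smul {f : F → ℝ} (hf : DifferentiableAt ℝ f p) (hX : DifferentiableAt ℝ X p)
    (v : F) :
    flatCovDeriv C u (fun q ↦ f q • X q) p v
      = f p • flatCovDeriv C u X p v + fderiv ℝ f p v • X p := by
  simp only [flatCovDeriv, fderiv_fun_smul hf hX, map_smul, _root_.add_apply,
    _root_.smul_apply, ContinuousLinearMap.smulRight_apply, smul_add]
  abel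

/-- Torsion-freeness along a map. -/
lemma flatCovDeriv_fderiv_comm (h : IsLeviCivitaOn U G C) (hp : u p ∈ U) (hu : ContDiffAt ℝ 2 u p)
    (v w : F) :
    flatCovDeriv C u (fun q ↦ fderiv ℝ u q w) p v
      = flatCovDeriv C u (fun q ↦ fderiv ℝ u q v) p w := by
  simp only [flatCovDeriv]
  rw [fderiv_fderiv_comm hu, h.conn_symm _ hp]

lemma differentiableAt_flatCovDeriv (h : IsLeviCivitaOn U G C) (hp : u p ∈ U)
    (hu : ContDiffAt ℝ 2 u p) (hX : ContDiffAt ℝ 2 X p) (w : F) :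
    DifferentiableAt ℝ (fun q ↦ flatCovDeriv C u X q w) p :=
  (differentiableAt_fderiv_apply hX w).add
    ((((h.differentiableAt_conn hp).comp p (hu.differentiableAt (by simp))).clm_apply
      (differentiableAt_fderiv_apply hu w)).clm_apply (hX.differentiableAt (by simp)))

lemma contDiffAt_flatCovDeriv (h : IsLeviCivitaOn U G C) (hp : u p ∈ U)
    (hu : ContDiffAt ℝ ∞ u p) (hX : ContDiffAt ℝ ∞ X p) (w : F) :
    ContDiffAt ℝ ∞ (fun q ↦ flatCovDeriv C u X q w) p :=
  ((hX.fderiv_right (m := ∞) (by simp)).clm_apply contDiffAt_const).add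
    ((((h.contDiffAt_conn hp).comp p hu).clm_apply
      ((hu.fderiv_right (m := ∞) (by simp)).clm_apply contDiffAt_const)).clm_apply hX)

lemma contDiffAt_metric_apply (h : IsLeviCivitaOn U G C) (hp : u p ∈ U)
    (hu : ContDiffAt ℝ ∞ u p) (hX : ContDiffAt ℝ ∞ X p) (hY : ContDiffAt ℝ ∞ Y p) :
    ContDiffAt ℝ ∞ (fun q ↦ G (u q) (X q) (Y q)) p :=
  (((h.contDiffAt_metric hp).comp p hu).clm_apply hX).clm_apply hY

/-- The Ricci identity along a map. -/
lemma flatCovDeriv_comm (h : IsLeviCivitaOn U G C) (hp : u p ∈ U)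
    (hu : ContDiffAt ℝ 2 u p) (hX : ContDiffAt ℝ 2 X p) (v w : F) :
    flatCovDeriv C u (fun q ↦ flatCovDeriv C u X q w) p v
      = flatCovDeriv C u (fun q ↦ flatCovDeriv C u X q v) p w
        + flatCurvature C (u p) (fderiv ℝ u p v) (fderiv ℝ u p w) (X p) := by
  have key : ∀ a b : F, fderiv ℝ (fun q ↦ flatCovDeriv C u X q b) p a =
      fderiv ℝ (fun q ↦ fderiv ℝ X q b) p a
        + (fderiv ℝ C (u p) (fderiv ℝ u p a) (fderiv ℝ u p b) (X p)
          + C (u p) (fderiv ℝ (fun q ↦ fderiv ℝ u q b) p a) (X p)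
          + C (u p) (fderiv ℝ u p b) (fderiv ℝ X p a)) := by
    intro a b
    have hu1 := hu.differentiableAt (by simp)
    have hX1 := hX.differentiableAt (by simp)
    have hd := differentiableAt_fderiv_apply hu b
    rw [← fderiv_bilin_comp (h.differentiableAt_conn hp) hu1 hd hX1]
    have d2 : DifferentiableAt ℝ (fun q ↦ C (u q) (fderiv ℝ u q b) (X q)) p :=
      (((h.differentiableAt_conn hp).comp p hu1).clm_apply hd).clm_apply hX1
    simp only [flatCovDeriv]
    rw [fderiv_fun_add (differentiableAt_fderiv_apply hX b) d2]
    rfl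
  have h1 : ∀ a b, flatCovDeriv C u (fun q ↦ flatCovDeriv C u X q b) p a =
      fderiv ℝ (fun q ↦ flatCovDeriv C u X q b) p a
        + C (u p) (fderiv ℝ u p a) (flatCovDeriv C u X p b) := fun a b ↦ rfl
  rw [h1, h1, key, key, fderiv_fderiv_comm hu v w, fderiv_fderiv_comm hX v w]
  simp only [flatCovDeriv, flatCurvature, map_add]
  abel

section Symmetries

lemma flatCurvature_swap (y a b c : E) : flatCurvature C y a b c = -flatCurvature C y b a c := by
  simp only [flatCurvature]; abel

lemma flatCurvature_bianchi (h : IsLeviCivitaOn U G C) {y : E} (hy : y ∈ U) (a b c : E) :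
    flatCurvature C y a b c + flatCurvature C y b c a + flatCurvature C y c a b = 0 := by
  have key : ∀ v a b, fderiv ℝ C y v a b = fderiv ℝ C y v b a := by
    intro v a b
    have hd := h.differentiableAt_conn hy
    have e : ∀ a b, fderiv ℝ (fun z ↦ C z a b) y v = fderiv ℝ C y v a b := by
      intro a b
      have := (hd.hasFDerivAt.clm_apply (hasFDerivAt_const a y)).clm_apply (hasFDerivAt_const b y)
      rw [this.fderiv]; simp
    rw [← e, ← e]
    have : (fun z ↦ C z a b) =ᶠ[nhds y] (fun z ↦ C z b a) := by
      filter_upwards [h.isOpen.mem_nhds hy] with z hz using h.conn_symm z hz a b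
    rw [this.fderiv_eq]
  simp only [flatCurvature]
  rw [key a c b, key b a c, key c b a, h.conn_symm y hy b c, h.conn_symm y hy c a,
    h.conn_symm y hy a b]
  abel

lemma flatCovDeriv_id_const (y v a : E) : flatCovDeriv C id (fun _ ↦ a) y v = C y v a := by
  simp [flatCovDeriv]

lemma metric_flatCurvature_skew (h : IsLeviCivitaOn U G C) {y : E} (hy : y ∈ U) (a b c d : E) :
    G y (flatCurvature C y a b c) d = -G y c (flatCurvature C y a b d) := by
  have hid : ∀ {z : E}, ContDiffAt ℝ 2 (id : E → E) z := contDiffAt_id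
  have hc : ∀ {z w : E}, ContDiffAt ℝ 2 (fun _ : E ↦ w) z := contDiffAt_const
  have hsm : ContDiffAt ℝ 2 (fun z ↦ G z c d) y :=
    ((h.contDiffAt_metric hy).of_le two_le_infty).clm_apply contDiffAt_const |>.clm_apply
      contDiffAt_const
  have first : ∀ v, (fun z ↦ fderiv ℝ (fun z ↦ G z c d) z v) =ᶠ[nhds y]
      fun z ↦ G z (flatCovDeriv C id (fun _ ↦ c) z v) d
        + G z c (flatCovDeriv C id (fun _ ↦ d) z v) := by
    intro v
    filter_upwards [h.isOpen.mem_nhds hy] with z hz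
    exact fderiv_metric (u := id) h hz differentiableAt_id (differentiableAt_const c)
      (differentiableAt_const d) v
  have second : ∀ v w, fderiv ℝ (fun z ↦ fderiv ℝ (fun z ↦ G z c d) z v) y w =
      G y (flatCovDeriv C id (fun z ↦ flatCovDeriv C id (fun _ ↦ c) z v) y w) d
        + G y (flatCovDeriv C id (fun _ ↦ c) y v) (flatCovDeriv C id (fun _ ↦ d) y w)
        + (G y (flatCovDeriv C id (fun _ ↦ c) y w) (flatCovDeriv C id (fun _ ↦ d) y v)
        + G y c (flatCovDeriv C id (fun z ↦ flatCovDeriv C id (fun _ ↦ d) z v) y w)) := by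
    intro v w
    have d1 := differentiableAt_flatCovDeriv (u := id) (X := fun _ ↦ c) h hy hid hc v
    have d2 := differentiableAt_flatCovDeriv (u := id) (X := fun _ ↦ d) h hy hid hc v
    have dG := h.differentiableAt_metric hy
    rw [(first v).fderiv_eq, fderiv_fun_add ((dG.clm_apply d1).clm_apply (differentiableAt_const d))
      ((dG.clm_apply (differentiableAt_const c)).clm_apply d2), _root_.add_apply]
    have e1 := fderiv_metric (u := id) h hy differentiableAt_id d1 (differentiableAt_const d) w
    have e2 := fderiv_metric (u := id) h hy differentiableAt_id (differentiableAt_const c) d2 w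
    simp only [id] at e1 e2 ⊢
    rw [e1, e2]
  have hcomm := fderiv_fderiv_comm hsm a b
  rw [second, second, flatCovDeriv_comm h hy hid hc a b, flatCovDeriv_comm h hy hid hc a b] at hcomm
  simp only [map_add, _root_.add_apply, fderiv_id, ContinuousLinearMap.id_apply,
    id_eq] at hcomm
  linarith

lemma metric_flatCurvature_pair (h : IsLeviCivitaOn U G C) {y : E} (hy : y ∈ U) (a b c d : E) :
    G y (flatCurvature C y a b c) d = G y (flatCurvature C y c d a) b := by
  have sk : ∀ a b c d, G y (flatCurvature C y a b c) d = -G y (flatCurvature C y a b d) c := by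
    intro a b c d
    rw [metric_flatCurvature_skew h hy, h.metric_symm y hy]
  have sw : ∀ a b c d, G y (flatCurvature C y a b c) d = -G y (flatCurvature C y b a c) d := by
    intro a b c d
    rw [flatCurvature_swap]; simp
  have bi : ∀ a b c d, G y (flatCurvature C y a b c) d + G y (flatCurvature C y b c a) d
      + G y (flatCurvature C y c a b) d = 0 := by
    intro a b c d
    have := congrArg (fun z ↦ G y z d) (flatCurvature_bianchi h hy a b c)
    simpa using this
  linarith [bi a b c d, bi b c d a, bi c d a b, bi d a b c, sk a b c d, sk b c a d, sk c a b d,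
    sk b c d a, sk c d b a, sk d b c a, sk c d a b, sk d a c b, sk a c d b, sk d a b c,
    sk a b d c, sk b d a c, sw a b c d, sw b c a d, sw c a b d,
    sw b c d a, sw c d b a, sw d b c a, sw c d a b, sw d a c b, sw a c d b, sw d a b c,
    sw a b d c, sw b d a c]

end Symmetries

end FlatConnection

section FlatVariation

variable {E : Type*} [NormedAddCommGroup E] [NormedSpace ℝ E]
  {F : Type*} [NormedAddCommGroup F] [NormedSpace ℝ F]
  {U : Set E} {G : E → E →L[ℝ] E →L[ℝ] ℝ} {C : E → E →L[ℝ] E →L[ℝ] E} {u : F → E} {p : F}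

/-- The tension `∇_w ∂_w u` of the map `u` in the direction `w`. -/
noncomputable def flatTension (C : E → E →L[ℝ] E →L[ℝ] E) (u : F → E) (p w : F) : E :=
  flatCovDeriv C u (fun q ↦ fderiv ℝ u q w) p w

lemma contDiffAt_fderiv_apply (hu : ContDiffAt ℝ ∞ u p) (w : F) :
    ContDiffAt ℝ ∞ (fun q ↦ fderiv ℝ u q w) p :=
  (hu.fderiv_right (m := ∞) (by simp)).clm_apply contDiffAt_const

lemma contDiffAt_flatTension (h : IsLeviCivitaOn U G C) (hp : u p ∈ U)
    (hu : ContDiffAt ℝ ∞ u p) (w : F) : ContDiffAt ℝ ∞ (fun q ↦ flatTension C u q w) p :=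
  contDiffAt_flatCovDeriv h hp hu (contDiffAt_fderiv_apply hu w) w

/-- First variation of `|∂_w u|²`. -/
lemma flat_first_variation_energy (h : IsLeviCivitaOn U G C) (hp : u p ∈ U)
    (hu : ContDiffAt ℝ ∞ u p) (v w : F) :
    fderiv ℝ (fun q ↦ G (u q) (fderiv ℝ u q w) (fderiv ℝ u q w)) p v =
      2 * fderiv ℝ (fun q ↦ G (u q) (fderiv ℝ u q v) (fderiv ℝ u q w)) p w
        - 2 * G (u p) (fderiv ℝ u p v) (flatTension C u p w) := by
  have hu2 : ContDiffAt ℝ 2 u p := hu.of_le two_le_infty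
  have hu1 : DifferentiableAt ℝ u p := hu2.differentiableAt (by simp)
  rw [fderiv_metric h hp hu1 (differentiableAt_fderiv_apply hu2 w)
      (differentiableAt_fderiv_apply hu2 w),
    fderiv_metric h hp hu1 (differentiableAt_fderiv_apply hu2 v)
      (differentiableAt_fderiv_apply hu2 w),
    flatCovDeriv_fderiv_comm h hp hu2 v w, h.metric_symm _ hp (fderiv ℝ u p w)]
  simp only [flatTension]
  ring

/-- First variation of `|τ|²`. -/
lemma flat_first_variation_bienergy (h : IsLeviCivitaOn U G C) (hp : u p ∈ U)
    (hu : ContDiffAt ℝ ∞ u p) (v w : F) :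
    fderiv ℝ (fun q ↦ G (u q) (flatTension C u q w) (flatTension C u q w)) p v =
      2 * fderiv ℝ (fun q ↦
          G (u q) (flatCovDeriv C u (fun q ↦ fderiv ℝ u q v) q w) (flatTension C u q w)
          - G (u q) (fderiv ℝ u q v) (flatCovDeriv C u (fun q ↦ flatTension C u q w) q w)) p w
        + 2 * G (u p) (fderiv ℝ u p v)
          (flatCovDeriv C u (fun q ↦ flatCovDeriv C u (fun q ↦ flatTension C u q w) q w) p w
            + flatCurvature C (u p) (flatTension C u p w) (fderiv ℝ u p w) (fderiv ℝ u p w)) := by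
  have hu2 : ContDiffAt ℝ 2 u p := hu.of_le two_le_infty
  have hu1 : DifferentiableAt ℝ u p := hu2.differentiableAt (by simp)
  have hS := contDiffAt_fderiv_apply hu v
  have hT := contDiffAt_fderiv_apply hu w
  have hτ := contDiffAt_flatTension h hp hu w
  have hdS := contDiffAt_flatCovDeriv h hp hu hS w
  have hdτ := contDiffAt_flatCovDeriv h hp hu hτ w
  have hn : (∞ : WithTop ℕ∞) ≠ 0 := by simp
  have hτ1 := hτ.differentiableAt hn
  have hS1 := hS.differentiableAt hn
  have hdS1 := hdS.differentiableAt hn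
  have hdτ1 := hdτ.differentiableAt hn
  have e1 := (contDiffAt_metric_apply h hp hu hdS hτ).differentiableAt hn
  have e2 := (contDiffAt_metric_apply h hp hu hS hdτ).differentiableAt hn
  rw [fderiv_fun_sub e1 e2, _root_.sub_apply, fderiv_metric h hp hu1 hτ1 hτ1,
    fderiv_metric h hp hu1 hdS1 hτ1, fderiv_metric h hp hu1 hS1 hdτ1]
  have comm : flatCovDeriv C u (fun q ↦ flatTension C u q w) p v =
      flatCovDeriv C u (fun q ↦ flatCovDeriv C u (fun q ↦ fderiv ℝ u q v) q w) p w
        + flatCurvature C (u p) (fderiv ℝ u p v) (fderiv ℝ u p w) (fderiv ℝ u p w) := by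
    simp only [flatTension]
    rw [flatCovDeriv_comm h hp hu2 (hT.of_le two_le_infty) v w]
    congr 1
    refine flatCovDeriv_congr ?_ (Filter.EventuallyEq.refl _ _) w
    have hU : ∀ᶠ q in nhds p, u q ∈ U :=
      hu1.continuousAt.eventually_mem (h.isOpen.mem_nhds hp)
    filter_upwards [hU, hu2.eventually (by simp)] with q hq huq
    exact flatCovDeriv_fderiv_comm h hq huq v w
  have hR : G (u p) (flatCurvature C (u p) (fderiv ℝ u p v) (fderiv ℝ u p w) (fderiv ℝ u p w))
      (flatTension C u p w) = G (u p) (fderiv ℝ u p v)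
        (flatCurvature C (u p) (flatTension C u p w) (fderiv ℝ u p w) (fderiv ℝ u p w)) := by
    rw [metric_flatCurvature_pair h hp, metric_flatCurvature_skew h hp, flatCurvature_swap]
    simp
  rw [comm, h.metric_symm _ hp (flatTension C u p w), map_add, map_add, _root_.add_apply, hR]
  ring

end FlatVariation

section SasakianAlgebra

variable {E : Type*} [NormedAddCommGroup E] [NormedSpace ℝ E]

/-- The algebraic identities of an almost contact metric structure on a vector space. -/
structure IsAlmostContactForm (g : E →L[ℝ] E →L[ℝ] ℝ) (φ : E →L[ℝ] E) (ξ : E) (η : E →L[ℝ] ℝ) :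
    Prop where
  symm : ∀ a b, g a b = g b a
  pos : ∀ a, a ≠ 0 → 0 < g a a
  phi_phi : ∀ a, φ (φ a) = -a + η a • ξ
  eta_xi : η ξ = 1
  metric_phi_phi : ∀ a b, g (φ a) (φ b) = g a b - η a * η b

namespace IsAlmostContactForm

variable {g : E →L[ℝ] E →L[ℝ] ℝ} {φ : E →L[ℝ] E} {ξ : E} {η : E →L[ℝ] ℝ}

lemma ext_left (h : IsAlmostContactForm g φ ξ η) {a b : E} (hab : ∀ c, g a c = g b c) : a = b := by
  by_contra hne
  have := h.pos (a - b) (sub_ne_zero.2 hne)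
  simp only [map_sub, _root_.sub_apply, hab, sub_self, lt_irrefl] at this

lemma xi_ne_zero (h : IsAlmostContactForm g φ ξ η) : ξ ≠ 0 := by
  intro h0
  have := h.eta_xi
  simp [h0] at this

lemma eta_smul_phi_xi (h : IsAlmostContactForm g φ ξ η) (a : E) : η a • φ ξ = η (φ a) • ξ := by
  have h1 := h.phi_phi (φ a)
  rw [h.phi_phi a, map_add, map_neg, map_smul] at h1
  exact add_left_cancel h1

lemma phi_xi (h : IsAlmostContactForm g φ ξ η) : φ ξ = 0 := by
  have h1 : φ ξ = η (φ ξ) • ξ := by simpa [h.eta_xi] using h.eta_smul_phi_xi ξ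
  have h2 : φ (φ ξ) = 0 := by simp [h.phi_phi, h.eta_xi]
  have h3 : φ (φ ξ) = (η (φ ξ) * η (φ ξ)) • ξ := by
    conv_lhs => rw [h1, map_smul, h1, smul_smul]
    simp [h.eta_xi]
  rw [h2] at h3
  rw [h1, mul_self_eq_zero.1 ((smul_eq_zero.1 h3.symm).resolve_right h.xi_ne_zero), zero_smul]

lemma eta_phi (h : IsAlmostContactForm g φ ξ η) (a : E) : η (φ a) = 0 := by
  have h1 := h.eta_smul_phi_xi a
  rw [h.phi_xi, smul_zero] at h1
  exact (smul_eq_zero.1 h1.symm).resolve_right h.xi_ne_zero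

lemma metric_xi (h : IsAlmostContactForm g φ ξ η) (a : E) : g ξ a = η a := by
  have h1 := h.metric_phi_phi ξ a
  rw [h.phi_xi, h.eta_xi] at h1
  simp at h1
  linarith

lemma metric_xi' (h : IsAlmostContactForm g φ ξ η) (a : E) : g a ξ = η a := by
  rw [h.symm, h.metric_xi]

lemma metric_phi (h : IsAlmostContactForm g φ ξ η) (a b : E) : g (φ a) b = -g a (φ b) := by
  have h1 := h.metric_phi_phi (φ a) b
  rw [h.phi_phi, map_add, map_neg, map_smul, _root_.add_apply, _root_.neg_apply,
    _root_.smul_apply, h.metric_xi, h.eta_phi, h.eta_phi] at h1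
  simp at h1
  linarith

variable {B : E →L[ℝ] E} {P : E → E → E}

/-- In a normal contact metric structure, `∇_a ξ = -φ a`; here `B` stands for `∇ξ` and `P` for
`∇φ`. -/
lemma nabla_xi_eq (h : IsAlmostContactForm g φ ξ η)
    (hBξ : ∀ a, g (B a) ξ = 0) (hB : ∀ a b, g (B a) b - g (B b) a = 2 * g a (φ b))
    (hPskew : ∀ a b c, g (P a b) c = -g (P a c) b)
    (hPcyc : ∀ a b c, g (P a b) c + g (P b c) a + g (P c a) b = 0)
    (hN : ∀ a b, P (φ a) b - P (φ b) a + φ (P b a) - φ (P a b) = -(2 * g a (φ b)) • ξ)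
    (hP0 : ∀ b, P 0 b = 0) (hPξ : ∀ a, P a ξ = -φ (B a)) (a : E) : B a = -φ a := by
  have hξB : ∀ a, g (B ξ) a = 0 := by
    intro a
    have h1 := hB ξ a
    rw [hBξ, h.metric_xi, h.eta_phi] at h1
    linarith
  have k1 : ∀ a c, g (P a ξ) c = g (B a) (φ c) := by
    intro a c
    rw [hPξ, map_neg, _root_.neg_apply, h.metric_phi]; ring
  have k2 : ∀ a c, g (P ξ a) c = g (B a) (φ c) - g (B c) (φ a) := by
    intro a c
    have h1 := hPcyc ξ a c
    have h2 := hPskew a c ξ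
    rw [k1] at h1 h2
    linarith
  have hsk : ∀ a c, g (B (φ a)) (φ c) + g (B (φ c)) (φ a) = 0 := by
    intro a c
    have h1 := congrArg (fun z ↦ g z c) (hN a ξ)
    simp only [h.phi_xi, hP0, map_add, map_sub, map_neg, map_smul, map_zero, _root_.add_apply,
      _root_.sub_apply, _root_.zero_apply, mul_zero, neg_zero,
      zero_smul, h.metric_phi, k1, k2, h.phi_phi, hBξ, smul_eq_mul] at h1
    linarith
  have hskew : ∀ a c, g (B a) c + g (B c) a = 0 := by
    intro a c
    have h1 := hsk (φ a) (φ c)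
    simp only [h.phi_phi, map_add, map_neg, map_smul, _root_.add_apply, _root_.neg_apply,
      _root_.smul_apply, hBξ, hξB, smul_eq_mul] at h1
    linarith
  refine h.ext_left fun c ↦ ?_
  have h1 := hB a c
  have h2 := hskew a c
  rw [map_neg, _root_.neg_apply, h.metric_phi]
  linarith

/-- In a normal contact metric structure, `(∇_a φ) b = g(a, b) ξ - η(b) a`. -/
lemma nabla_phi_eq (h : IsAlmostContactForm g φ ξ η)
    (hBξ : ∀ a, g (B a) ξ = 0) (hB : ∀ a b, g (B a) b - g (B b) a = 2 * g a (φ b))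
    (hPskew : ∀ a b c, g (P a b) c = -g (P a c) b)
    (hPcyc : ∀ a b c, g (P a b) c + g (P b c) a + g (P c a) b = 0)
    (hN : ∀ a b, P (φ a) b - P (φ b) a + φ (P b a) - φ (P a b) = -(2 * g a (φ b)) • ξ)
    (hPφ : ∀ a b, P a (φ b) + φ (P a b) = g (B a) b • ξ + η b • B a)
    (hP0 : ∀ b, P 0 b = 0) (hPξ : ∀ a, P a ξ = -φ (B a)) (a b : E) :
    P a b = g a b • ξ - η b • a := by
  have hBφ := h.nabla_xi_eq hBξ hB hPskew hPcyc hN hP0 hPξ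
  -- `A` is the defect in the claimed identity
  set A : E → E → E → ℝ := fun a b c ↦ g (P a b) c - (g a b * η c - η b * g a c) with hA
  have A1 : ∀ a b c, A a b c = -A a c b := by
    intro a b c
    simp only [hA]; rw [hPskew a b c]; ring
  have A2 : ∀ a b c, A a b c + A b c a + A c a b = 0 := by
    intro a b c
    simp only [hA]
    linear_combination hPcyc a b c - η a * h.symm b c  + η b * h.symm a c + η c * (h.symm b a)
  have A3 : ∀ a b c, A a (φ b) c = A a b (φ c) := by
    intro a b c
    have h1 := congrArg (fun z ↦ g z c) (hPφ a b)
    simp only [hBφ, map_add, map_neg, map_smul, _root_.add_apply, _root_.neg_apply,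
      _root_.smul_apply, smul_eq_mul, h.metric_phi, h.metric_xi] at h1
    simp only [hA, h.eta_phi]
    linarith
  have A4 : ∀ a b c, A (φ a) b c - A (φ b) a c - A b a (φ c) + A a b (φ c) = 0 := by
    intro a b c
    have h1 := congrArg (fun z ↦ g z c) (hN a b)
    simp only [map_add, map_sub, map_smul, _root_.add_apply, _root_.sub_apply,
      _root_.smul_apply, smul_eq_mul, h.metric_phi, h.metric_xi] at h1
    simp only [hA, h.eta_phi, h.metric_phi, h.symm b a] at h1 ⊢
    have h2 := h.metric_phi b a
    rw [h.symm] at h2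
    linear_combination h1 - η c * h2
  have A5 : ∀ a b c, A (φ a) b c = -A a b (φ c) := by
    intro a b c
    linarith [A4 a b c, A4 b c a, A4 c a b, A1 (φ a) b c, A1 (φ b) c a, A1 (φ c) a b,
      A3 a b c, A3 b c a, A3 c a b, A1 a b (φ c), A1 b c (φ a), A1 c a (φ b), A1 a c (φ b),
      A1 b a (φ c), A1 c b (φ a), A3 a c b, A3 b a c, A3 c b a]
  have A6 : ∀ a b c, A a b (φ c) = 0 := by
    intro a b c
    linarith [A2 a b (φ c), A2 b c (φ a), A2 c a (φ b), A5 c a b, A5 a b c, A5 b c a, A3 b c a,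
      A3 c a b, A3 a b c]
  have A7 : ∀ a b, A a b ξ = 0 := by
    intro a b
    have h1 := hPskew a b ξ
    rw [hPξ, hBφ] at h1
    simp only [hA, h1, map_neg, h.phi_phi, map_add, map_smul, _root_.add_apply,
      _root_.neg_apply, _root_.smul_apply, smul_eq_mul, h.metric_xi, h.metric_xi', h.eta_xi]
    ring
  refine h.ext_left fun c ↦ ?_
  have h1 := A6 a b (φ c)
  have h2 : A a b (φ (φ c)) = -A a b c + η c * A a b ξ := by
    simp only [hA, h.phi_phi, map_add, map_neg, map_smul, smul_eq_mul]
    ring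
  rw [h2, A7] at h1
  simp only [hA] at h1
  simp only [map_sub, map_smul, _root_.sub_apply, _root_.smul_apply, smul_eq_mul, h.metric_xi]
  linarith

end IsAlmostContactForm

section KaehlerLike

/-- Sectional curvatures of a Kähler-like curvature form with constant holomorphic sectional
curvature `κ`, on a subspace `D` with complex structure `φ`. -/
lemma sectional_eq_of_holomorphic {g : E →L[ℝ] E →L[ℝ] ℝ} {φ : E →L[ℝ] E} {D : Submodule ℝ E}
    {Q : E → E → E → E → ℝ} {κ : ℝ} (hg : ∀ a b, g a b = g b a)
    (hφD : ∀ a ∈ D, φ a ∈ D) (hφφ : ∀ a ∈ D, φ (φ a) = -a)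
    (hgφ : ∀ a ∈ D, ∀ b ∈ D, g (φ a) (φ b) = g a b)
    (add₁ : ∀ a a' b c d, Q (a + a') b c d = Q a b c d + Q a' b c d)
    (add₂ : ∀ a b b' c d, Q a (b + b') c d = Q a b c d + Q a b' c d)
    (add₃ : ∀ a b c c' d, Q a b (c + c') d = Q a b c d + Q a b c' d)
    (swap : ∀ a b c d, Q a b c d = -Q b a c d)
    (skew : ∀ a b c d, Q a b c d = -Q a b d c)
    (pair : ∀ a b c d, Q a b c d = Q c d a b)
    (bianchi : ∀ a b c d, Q a b c d + Q b c a d + Q c a b d = 0)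
    (hQφ : ∀ a b c d, Q a b (φ c) d = -Q a b c (φ d))
    (hol : ∀ a ∈ D, Q a (φ a) (φ a) a = κ * g a a ^ 2) {x y : E} (hx : x ∈ D) (hy : y ∈ D) :
    Q x y y x = κ / 4 * (g x x * g y y - g x y ^ 2 + 3 * g x (φ y) ^ 2) := by
  have neg₁ : ∀ a b c d, Q (-a) b c d = -Q a b c d := by
    intro a b c d
    have h0 := add₁ 0 0 b c d
    have h1 := add₁ a (-a) b c d
    simp only [add_neg_cancel, add_zero] at h0 h1
    linarith
  have neg₂ : ∀ a b c d, Q a (-b) c d = -Q a b c d := fun a b c d ↦ by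
    rw [swap, neg₁, swap b]; ring
  have neg₃ : ∀ a b c d, Q a b (-c) d = -Q a b c d := fun a b c d ↦ by
    rw [pair, neg₁, pair c]
  have neg₄ : ∀ a b c d, Q a b c (-d) = -Q a b c d := fun a b c d ↦ by
    rw [skew, neg₃, skew a b d]; ring
  have add₄ : ∀ a b c d d', Q a b c (d + d') = Q a b c d + Q a b c d' := by
    intro a b c d d'
    rw [skew, add₃, skew a b d, skew a b d']; ring
  have inv : ∀ a b c, ∀ d ∈ D, Q a b (φ c) (φ d) = Q a b c d := by
    intro a b c d hd
    rw [hQφ, hφφ d hd, neg₄, neg_neg]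
  have inv' : ∀ a, ∀ b ∈ D, ∀ c d, Q (φ a) (φ b) c d = Q a b c d := by
    intro a b hb c d
    rw [pair, inv _ _ _ b hb, pair]
  have two : ∀ z ∈ D, ∀ w ∈ D, Q (z + w) (φ (z + w)) (φ (z + w)) (z + w)
      + Q (z + -w) (φ (z + -w)) (φ (z + -w)) (z + -w) =
      2 * (Q z (φ z) (φ z) z + Q w (φ w) (φ w) w + 2 * Q z w w z + 6 * Q z (φ w) (φ w) z) := by
    intro z hz w hw
    have hφz := hφD z hz
    have hφw := hφD w hw
    have m1 : Q z (φ w) (φ z) w = Q z (φ w) (φ w) z := by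
      have h1 := hQφ z (φ w) z w
      rw [skew z (φ w) z] at h1; linarith
    have m2 : Q w (φ z) (φ w) z = Q z (φ w) (φ w) z := by
      have h1 := inv' w (φ z) hφz (φ w) z
      rw [hφφ z hz, neg₂, swap] at h1; linarith
    have m3 : Q w (φ z) (φ z) w = Q z (φ w) (φ w) z := by
      have h1 := inv' w (φ z) hφz (φ z) w
      rw [hφφ z hz, neg₂, swap] at h1; linarith
    have m4 : Q z (φ z) (φ w) w = Q z w w z + Q z (φ w) (φ w) z := by
      have h1 := bianchi z (φ z) (φ w) w
      have h2 := inv' z w hw z w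
      have h3 := skew z w z w
      have h4 := swap (φ w) z (φ z) w
      linarith
    have m5 : Q w (φ w) (φ z) z = Q z w w z + Q z (φ w) (φ w) z := by
      rw [← m4, pair, swap, skew]; ring
    simp only [map_add, map_neg, add₁, add₂, add₃, add₄, neg₁, neg₂, neg₃, neg₄]
    linarith
  have hsub : ∀ z ∈ D, ∀ w ∈ D, z + -w ∈ D := fun z hz w hw ↦ D.add_mem hz (D.neg_mem hw)
  have hφy := hφD y hy
  have t1 := two x hx y hy
  have t2 := two x hx (φ y) hφy
  rw [hol _ (D.add_mem hx hy), hol _ (hsub x hx y hy), hol _ hx, hol _ hy] at t1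
  rw [hol _ (D.add_mem hx hφy), hol _ (hsub x hx _ hφy), hol _ hx, hol _ hφy, hφφ y hy,
    neg₂, neg₃, hgφ y hy y hy] at t2
  simp only [map_add, map_neg, _root_.add_apply, _root_.neg_apply, hg y x, hg (φ y) x,
    hgφ y hy y hy] at t1 t2
  linear_combination (3 / 32) * (-t2) + (1 / 32) * t1

end KaehlerLike

end SasakianAlgebra

section FlatSasakian

variable {E : Type*} [NormedAddCommGroup E] [NormedSpace ℝ E]

/-- A Sasakian structure, in coordinates, on an open set `U` with metric `G`. -/
structure IsSasakianOn (U : Set E) (G : E → E →L[ℝ] E →L[ℝ] ℝ) (φ : E → E →L[ℝ] E) (ξ : E → E)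
    (η : E → E →L[ℝ] ℝ) : Prop where
  contDiffOn_phi : ContDiffOn ℝ ∞ φ U
  contDiffOn_xi : ContDiffOn ℝ ∞ ξ U
  contDiffOn_eta : ContDiffOn ℝ ∞ η U
  almostContact : ∀ y ∈ U, IsAlmostContactForm (G y) (φ y) (ξ y) (η y)
  contact : ∀ y ∈ U, ∀ a b, fderiv ℝ (fun z ↦ η z b) y a - fderiv ℝ (fun z ↦ η z a) y b
    = 2 * G y a (φ y b)
  normal : ∀ y ∈ U, ∀ a b, fderiv ℝ φ y (φ y a) b - fderiv ℝ φ y (φ y b) a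
    + φ y (fderiv ℝ φ y b a) - φ y (fderiv ℝ φ y a b) = -(2 * G y a (φ y b)) • ξ y

/-- The covariant derivative `(∇_a φ) b`. -/
noncomputable def flatNablaEnd (C : E → E →L[ℝ] E →L[ℝ] E) (φ : E → E →L[ℝ] E) (y a b : E) : E :=
  fderiv ℝ φ y a b + C y a (φ y b) - φ y (C y a b)

variable {U : Set E} {G : E → E →L[ℝ] E →L[ℝ] ℝ} {C : E → E →L[ℝ] E →L[ℝ] E}
  {φ : E → E →L[ℝ] E} {ξ : E → E} {η : E → E →L[ℝ] ℝ} {y : E}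

lemma flatCovDeriv_end_apply {Y : E → E} (hφ : DifferentiableAt ℝ φ y)
    (hY : DifferentiableAt ℝ Y y) (a : E) :
    flatCovDeriv C id (fun z ↦ φ z (Y z)) y a
      = flatNablaEnd C φ y a (Y y) + φ y (flatCovDeriv C id Y y a) := by
  have h1 := (hφ.hasFDerivAt.clm_apply hY.hasFDerivAt).fderiv
  simp only [flatCovDeriv, flatNablaEnd, h1, fderiv_id, id]
  simp
  abel

namespace IsSasakianOn

variable (hS : IsSasakianOn U G φ ξ η) (h : IsLeviCivitaOn U G C) (hy : y ∈ U)
include hS h hy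

lemma differentiableAt_phi : DifferentiableAt ℝ φ y :=
  (hS.contDiffOn_phi.contDiffAt (h.isOpen.mem_nhds hy)).differentiableAt (by simp)

lemma contDiffAt_xi : ContDiffAt ℝ ∞ ξ y := hS.contDiffOn_xi.contDiffAt (h.isOpen.mem_nhds hy)

lemma differentiableAt_xi : DifferentiableAt ℝ ξ y :=
  (hS.contDiffAt_xi h hy).differentiableAt (by simp)

lemma contDiffAt_eta_apply (b : E) : ContDiffAt ℝ ∞ (fun z ↦ η z b) y :=
  (hS.contDiffOn_eta.contDiffAt (h.isOpen.mem_nhds hy)).clm_apply contDiffAt_const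

lemma contDiffAt_phi_apply (b : E) : ContDiffAt ℝ ∞ (fun z ↦ φ z b) y :=
  (hS.contDiffOn_phi.contDiffAt (h.isOpen.mem_nhds hy)).clm_apply contDiffAt_const

lemma fderiv_eta_apply (a b : E) : fderiv ℝ (fun z ↦ η z b) y a
    = G y (flatCovDeriv C id ξ y a) b + η y (C y a b) := by
  have h1 : (fun z ↦ η z b) =ᶠ[nhds y] fun z ↦ G z (ξ z) b := by
    filter_upwards [h.isOpen.mem_nhds hy] with z hz
    rw [(hS.almostContact z hz).metric_xi]
  rw [h1.fderiv_eq]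
  have h2 := fderiv_metric (u := id) h hy differentiableAt_id (hS.differentiableAt_xi h hy)
    (differentiableAt_const b) a
  simp only [id] at h2
  rw [h2, flatCovDeriv_id_const, (hS.almostContact y hy).metric_xi]

lemma metric_nabla_xi_xi (a : E) : G y (flatCovDeriv C id ξ y a) (ξ y) = 0 := by
  have h1 : (fun z ↦ G z (ξ z) (ξ z)) =ᶠ[nhds y] fun _ ↦ 1 := by
    filter_upwards [h.isOpen.mem_nhds hy] with z hz
    rw [(hS.almostContact z hz).metric_xi, (hS.almostContact z hz).eta_xi]
  have h2 := fderiv_metric (u := id) h hy differentiableAt_id (hS.differentiableAt_xi h hy)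
    (hS.differentiableAt_xi h hy) a
  simp only [id] at h2
  rw [h1.fderiv_eq, h.metric_symm y hy (ξ y)] at h2
  simp at h2
  linarith

lemma metric_nablaEnd_skew (a b c : E) :
    G y (flatNablaEnd C φ y a b) c = -G y (flatNablaEnd C φ y a c) b := by
  have hφ := hS.differentiableAt_phi h hy
  have h1 : (fun z ↦ G z (φ z b) c) =ᶠ[nhds y] fun z ↦ -G z b (φ z c) := by
    filter_upwards [h.isOpen.mem_nhds hy] with z hz
    rw [(hS.almostContact z hz).metric_phi]
  have h2 := fderiv_metric (u := id) h hy differentiableAt_id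
    (hφ.clm_apply (differentiableAt_const b)) (differentiableAt_const c) a
  have h3 := fderiv_metric (u := id) h hy differentiableAt_id (differentiableAt_const b)
    (hφ.clm_apply (differentiableAt_const c)) a
  simp only [id] at h2 h3
  rw [h1.fderiv_eq, fderiv_fun_neg, _root_.neg_apply, h3, flatCovDeriv_id_const,
    flatCovDeriv_id_const, flatCovDeriv_end_apply hφ (differentiableAt_const b),
    flatCovDeriv_end_apply hφ (differentiableAt_const c), flatCovDeriv_id_const,
    flatCovDeriv_id_const] at h2
  simp only [map_add, _root_.add_apply, (hS.almostContact y hy).metric_phi,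
    h.metric_symm y hy b (flatNablaEnd C φ y a c)] at h2
  linarith

lemma metric_nablaEnd_cyclic (a b c : E) :
    G y (flatNablaEnd C φ y a b) c + G y (flatNablaEnd C φ y b c) a
      + G y (flatNablaEnd C φ y c a) b = 0 := by
  have hφ := hS.differentiableAt_phi h hy
  have hη : ∀ b, ContDiffAt ℝ 2 (fun z ↦ η z b) y := fun b ↦
    (hS.contDiffAt_eta_apply h hy b).of_le two_le_infty
  have key : ∀ a b c, fderiv ℝ (fun z ↦ fderiv ℝ (fun z ↦ η z c) z b) y a
      - fderiv ℝ (fun z ↦ fderiv ℝ (fun z ↦ η z b) z c) y a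
      = 2 * (G y (C y a b) (φ y c) + G y (flatNablaEnd C φ y a c) b - G y (φ y b) (C y a c)) := by
    intro a b c
    have h1 : (fun z ↦ fderiv ℝ (fun z ↦ η z c) z b - fderiv ℝ (fun z ↦ η z b) z c)
        =ᶠ[nhds y] fun z ↦ 2 * G z b (φ z c) := by
      filter_upwards [h.isOpen.mem_nhds hy] with z hz using hS.contact z hz b c
    have h2 := h1.fderiv_eq (𝕜 := ℝ)
    have h3 := fderiv_metric (u := id) h hy differentiableAt_id (differentiableAt_const b)
      (hφ.clm_apply (differentiableAt_const c)) a
    have h4 : DifferentiableAt ℝ (fun z ↦ G z b (φ z c)) y :=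
      ((h.differentiableAt_metric hy).clm_apply (differentiableAt_const b)).clm_apply
        (hφ.clm_apply (differentiableAt_const c))
    simp only [id] at h3
    rw [fderiv_fun_sub (differentiableAt_fderiv_apply (hη c) b)
      (differentiableAt_fderiv_apply (hη b) c), fderiv_const_mul h4] at h2
    have h5 := DFunLike.congr_fun h2 a
    simp only [_root_.sub_apply, _root_.smul_apply, smul_eq_mul] at h5
    rw [h5, h3, flatCovDeriv_end_apply hφ (differentiableAt_const c), flatCovDeriv_id_const,
      flatCovDeriv_id_const, map_add, h.metric_symm y hy b (flatNablaEnd C φ y a c),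
      (hS.almostContact y hy).metric_phi]
    ring
  have s : ∀ a b c, fderiv ℝ (fun z ↦ fderiv ℝ (fun z ↦ η z c) z b) y a
      = fderiv ℝ (fun z ↦ fderiv ℝ (fun z ↦ η z c) z a) y b := fun a b c ↦
    fderiv_fderiv_comm (hη c) a b
  have t : ∀ a b c, G y (C y a b) (φ y c) = G y (φ y c) (C y b a) := fun a b c ↦ by
    rw [h.metric_symm y hy, h.conn_symm y hy]
  linarith [key a b c, key b c a, key c a b, s a b c, s b c a, s c a b, t a b c, t b c a, t c a b,
    hS.metric_nablaEnd_skew h hy a b c, hS.metric_nablaEnd_skew h hy b c a,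
    hS.metric_nablaEnd_skew h hy c a b]

lemma nablaEnd_normal (a b : E) : flatNablaEnd C φ y (φ y a) b - flatNablaEnd C φ y (φ y b) a
    + φ y (flatNablaEnd C φ y b a) - φ y (flatNablaEnd C φ y a b)
    = -(2 * G y a (φ y b)) • ξ y := by
  rw [← hS.normal y hy a b]
  simp only [flatNablaEnd, map_add, map_sub, h.conn_symm y hy (φ y b) (φ y a),
    h.conn_symm y hy (φ y a) b, h.conn_symm y hy (φ y b) a, h.conn_symm y hy b a]
  abel

lemma nablaEnd_phi (a b : E) : flatNablaEnd C φ y a (φ y b) + φ y (flatNablaEnd C φ y a b)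
    = G y (flatCovDeriv C id ξ y a) b • ξ y + η y b • flatCovDeriv C id ξ y a := by
  have hφ := hS.differentiableAt_phi h hy
  have hc := hS.almostContact y hy
  have h1 : (fun z ↦ φ z (φ z b)) =ᶠ[nhds y] fun z ↦ η z b • ξ z - b := by
    filter_upwards [h.isOpen.mem_nhds hy] with z hz
    rw [(hS.almostContact z hz).phi_phi]; abel
  have h2 := flatCovDeriv_congr (C := C) h1 (Filter.EventuallyEq.refl _ id) a
  have hη := (hS.contDiffAt_eta_apply h hy b).differentiableAt (by simp)
  have hξ := hS.differentiableAt_xi h hy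
  rw [flatCovDeriv_end_apply hφ (hφ.clm_apply (differentiableAt_const b)),
    flatCovDeriv_end_apply hφ (differentiableAt_const b), flatCovDeriv_id_const,
    flatCovDeriv_sub (hη.fun_smul hξ) (differentiableAt_const b), flatCovDeriv_smul hη hξ,
    flatCovDeriv_id_const, hS.fderiv_eta_apply h hy, map_add, hc.phi_phi, add_smul] at h2
  rw [← sub_eq_zero] at h2 ⊢
  rw [← h2]
  abel

lemma nablaEnd_xi (a : E) : flatNablaEnd C φ y a (ξ y) = -φ y (flatCovDeriv C id ξ y a) := by
  have h1 : (fun z ↦ φ z (ξ z)) =ᶠ[nhds y] fun _ ↦ 0 := by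
    filter_upwards [h.isOpen.mem_nhds hy] with z hz using (hS.almostContact z hz).phi_xi
  have h2 := flatCovDeriv_congr (C := C) h1 (Filter.EventuallyEq.refl _ id) a
  rw [flatCovDeriv_end_apply (hS.differentiableAt_phi h hy) (hS.differentiableAt_xi h hy),
    flatCovDeriv_id_const, map_zero] at h2
  exact eq_neg_of_add_eq_zero_left h2

/-- `∇_a ξ = -φ a`. -/
lemma flatCovDeriv_xi (a : E) : flatCovDeriv C id ξ y a = -φ y a := by
  have hB : ∀ a, (fderiv ℝ ξ y + (C y).flip (ξ y)) a = flatCovDeriv C id ξ y a := fun a ↦ by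
    simp [flatCovDeriv]
  rw [← hB]
  refine (hS.almostContact y hy).nabla_xi_eq (P := flatNablaEnd C φ y) ?_ ?_
    (hS.metric_nablaEnd_skew h hy) (hS.metric_nablaEnd_cyclic h hy) (hS.nablaEnd_normal h hy)
    ?_ ?_ a
  · intro a; rw [hB, hS.metric_nabla_xi_xi h hy]
  · intro a b
    rw [hB, hB, ← hS.contact y hy, hS.fderiv_eta_apply h hy, hS.fderiv_eta_apply h hy,
      h.conn_symm y hy b a]
    ring
  · intro b; simp [flatNablaEnd]
  · intro a; rw [hB, hS.nablaEnd_xi h hy]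

/-- `(∇_a φ) b = g(a, b) ξ - η(b) a`. -/
lemma nablaEnd_eq (a b : E) : flatNablaEnd C φ y a b = G y a b • ξ y - η y b • a := by
  have hB : ∀ a, (fderiv ℝ ξ y + (C y).flip (ξ y)) a = flatCovDeriv C id ξ y a := fun a ↦ by
    simp [flatCovDeriv]
  refine (hS.almostContact y hy).nabla_phi_eq (P := flatNablaEnd C φ y)
    (B := fderiv ℝ ξ y + (C y).flip (ξ y)) ?_ ?_
    (hS.metric_nablaEnd_skew h hy) (hS.metric_nablaEnd_cyclic h hy) (hS.nablaEnd_normal h hy)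
    ?_ ?_ ?_ a b
  · intro a; rw [hB, hS.metric_nabla_xi_xi h hy]
  · intro a b
    rw [hB, hB, ← hS.contact y hy, hS.fderiv_eta_apply h hy, hS.fderiv_eta_apply h hy,
      h.conn_symm y hy b a]
    ring
  · intro a b; rw [hB, hS.nablaEnd_phi h hy]
  · intro b; simp [flatNablaEnd]
  · intro a; rw [hB, hS.nablaEnd_xi h hy]

lemma fderiv_eta_apply' (a b : E) : fderiv ℝ (fun z ↦ η z b) y a
    = G y a (φ y b) + η y (C y a b) := by
  rw [hS.fderiv_eta_apply h hy, hS.flatCovDeriv_xi h hy, map_neg, _root_.neg_apply,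
    (hS.almostContact y hy).metric_phi, neg_neg]

/-- `R(a, b)ξ = η(b) a - η(a) b`. -/
lemma flatCurvature_xi (a b : E) : flatCurvature C y a b (ξ y) = η y b • a - η y a • b := by
  have hid : ContDiffAt ℝ 2 (id : E → E) y := contDiffAt_id
  have hφ := hS.differentiableAt_phi h hy
  have hR := flatCovDeriv_comm (u := id) h hy hid
    ((hS.contDiffAt_xi h hy).of_le two_le_infty) a b
  have h1 : ∀ a b, flatCovDeriv C id (fun z ↦ flatCovDeriv C id ξ z b) y a
      = -(G y a b • ξ y - η y b • a) - φ y (C y a b) := by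
    intro a b
    have h2 : (fun z ↦ flatCovDeriv C id ξ z b) =ᶠ[nhds y] fun z ↦ 0 - φ z b := by
      filter_upwards [h.isOpen.mem_nhds hy] with z hz
      rw [hS.flatCovDeriv_xi h hz, zero_sub]
    rw [flatCovDeriv_congr h2 (Filter.EventuallyEq.refl _ id),
      flatCovDeriv_sub (differentiableAt_const 0) (hφ.clm_apply (differentiableAt_const b)),
      flatCovDeriv_end_apply hφ (differentiableAt_const b), flatCovDeriv_id_const,
      flatCovDeriv_id_const, hS.nablaEnd_eq h hy, map_zero]
    abel
  rw [h1, h1] at hR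
  simp only [fderiv_id, ContinuousLinearMap.id_apply, id, h.metric_symm y hy b a,
    h.conn_symm y hy b a] at hR
  rw [← sub_eq_zero] at hR ⊢
  rw [← neg_eq_zero, ← hR]
  abel

/-- The commutator of the curvature with `φ`. -/
lemma flatCurvature_phi (a b c : E) : flatCurvature C y a b (φ y c)
    = φ y (flatCurvature C y a b c) - G y b c • φ y a + G y a c • φ y b
      - G y a (φ y c) • b + G y b (φ y c) • a := by
  have hid : ContDiffAt ℝ 2 (id : E → E) y := contDiffAt_id
  have hconst : ContDiffAt ℝ 2 (fun _ : E ↦ c) y := contDiffAt_const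
  have hφ := hS.differentiableAt_phi h hy
  have hξ := hS.differentiableAt_xi h hy
  have hη := (hS.contDiffAt_eta_apply h hy c).differentiableAt (by simp)
  have hG := h.differentiableAt_metric hy
  have hR := flatCovDeriv_comm (u := id) h hy hid
    ((hS.contDiffAt_phi_apply h hy c).of_le two_le_infty) a b
  have hRc := flatCovDeriv_comm (u := id) h hy hid hconst a b
  have h1 : ∀ a b, flatCovDeriv C id (fun z ↦ flatCovDeriv C id (fun z ↦ φ z c) z b) y a
      = (G y b c • -φ y a + (G y (C y a b) c + G y b (C y a c)) • ξ y)
        - (η y c • C y a b + (G y a (φ y c) + η y (C y a c)) • b)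
        + (G y a (C y b c) • ξ y - η y (C y b c) • a
        + φ y (flatCovDeriv C id (fun z ↦ flatCovDeriv C id (fun _ ↦ c) z b) y a)) := by
    intro a b
    have h2 : (fun z ↦ flatCovDeriv C id (fun z ↦ φ z c) z b) =ᶠ[nhds y]
        fun z ↦ (G z b c • ξ z - η z c • b) + φ z (flatCovDeriv C id (fun _ ↦ c) z b) := by
      filter_upwards [h.isOpen.mem_nhds hy] with z hz
      rw [flatCovDeriv_end_apply (hS.differentiableAt_phi h hz) (differentiableAt_const c),
        hS.nablaEnd_eq h hz]
    have d1 : DifferentiableAt ℝ (fun z ↦ G z b c) y :=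
      (hG.clm_apply (differentiableAt_const b)).clm_apply (differentiableAt_const c)
    have d2 := differentiableAt_flatCovDeriv (u := id) h hy hid hconst b
    have e1 := fderiv_metric (u := id) h hy differentiableAt_id (differentiableAt_const b)
      (differentiableAt_const c) a
    simp only [id, flatCovDeriv_id_const] at e1
    rw [flatCovDeriv_congr h2 (Filter.EventuallyEq.refl _ id),
      flatCovDeriv_add ((d1.fun_smul hξ).fun_sub (hη.fun_smul (differentiableAt_const b)))
        (hφ.clm_apply d2),
      flatCovDeriv_sub (d1.fun_smul hξ) (hη.fun_smul (differentiableAt_const b)),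
      flatCovDeriv_smul d1 hξ, flatCovDeriv_smul hη (differentiableAt_const b),
      flatCovDeriv_end_apply hφ d2, hS.nablaEnd_eq h hy, hS.flatCovDeriv_xi h hy,
      flatCovDeriv_id_const, e1, hS.fderiv_eta_apply' h hy, flatCovDeriv_id_const]
  rw [h1, h1, hRc] at hR
  simp only [fderiv_id, ContinuousLinearMap.id_apply, id, map_add, h.conn_symm y hy b a] at hR
  rw [← sub_eq_zero] at hR ⊢
  rw [← neg_eq_zero, ← hR]
  module

end IsSasakianOn

end FlatSasakian

section FlatSpaceForm

variable {E : Type*} [NormedAddCommGroup E] [NormedSpace ℝ E]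
  {U : Set E} {G : E → E →L[ℝ] E →L[ℝ] ℝ} {C : E → E →L[ℝ] E →L[ℝ] E}
  {φ : E → E →L[ℝ] E} {ξ : E → E} {η : E → E →L[ℝ] ℝ} {y : E}

lemma flatCurvature_add₁ (a a' b c : E) : flatCurvature C y (a + a') b c
    = flatCurvature C y a b c + flatCurvature C y a' b c := by
  simp only [flatCurvature, map_add, _root_.add_apply]; abel

lemma flatCurvature_add₂ (a b b' c : E) : flatCurvature C y a (b + b') c
    = flatCurvature C y a b c + flatCurvature C y a b' c := by
  simp only [flatCurvature, map_add, _root_.add_apply]; abel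

lemma flatCurvature_add₃ (a b c c' : E) : flatCurvature C y a b (c + c')
    = flatCurvature C y a b c + flatCurvature C y a b c' := by
  simp only [flatCurvature, map_add]; abel

lemma flatCurvature_smul₁ (r : ℝ) (a b c : E) : flatCurvature C y (r • a) b c
    = r • flatCurvature C y a b c := by
  simp only [flatCurvature, map_smul, _root_.smul_apply, smul_sub, smul_add]

lemma flatCurvature_smul₂ (r : ℝ) (a b c : E) : flatCurvature C y a (r • b) c
    = r • flatCurvature C y a b c := by
  simp only [flatCurvature, map_smul, _root_.smul_apply, smul_sub, smul_add]

lemma flatCurvature_smul₃ (r : ℝ) (a b c : E) : flatCurvature C y a b (r • c)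
    = r • flatCurvature C y a b c := by
  simp only [flatCurvature, map_smul, smul_sub, smul_add]

/-- In a Sasakian space form, `R(Y, T)T = (c + 3)/4 Y` for a Legendre unit vector `T` and `Y`
orthogonal to `ξ`, `T` and `φT`. -/
theorem IsSasakianOn.flatCurvature_legendre (hS : IsSasakianOn U G φ ξ η)
    (h : IsLeviCivitaOn U G C) (hy : y ∈ U) {c : ℝ}
    (hol : ∀ u, G y u u = 1 → η y u = 0 → G y (flatCurvature C y u (φ y u) (φ y u)) u = c)
    {T Y : E} (hT : G y T T = 1) (hηT : η y T = 0) (hηY : η y Y = 0) (hYT : G y T Y = 0)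
    (hYφT : G y (φ y T) Y = 0) :
    flatCurvature C y Y T T = ((c + 3) / 4) • Y := by
  have hc := hS.almostContact y hy
  have hsymm := h.metric_symm y hy
  -- the difference of the curvature with that of a unit sphere is Kähler-like on `ker η`
  set Q : E → E → E → E → ℝ := fun a b z d ↦ G y (flatCurvature C y a b z) d
    - (G y b z * G y a d - G y a z * G y b d) with hQ
  set D : Submodule ℝ E := LinearMap.ker (η y).toLinearMap with hD
  have memD : ∀ a, a ∈ D ↔ η y a = 0 := fun a ↦ by simp [hD]
  have hol' : ∀ a ∈ D, Q a (φ y a) (φ y a) a = (c - 1) * G y a a ^ 2 := by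
    intro a ha
    rw [memD] at ha
    by_cases h0 : a = 0
    · simp [hQ, h0, flatCurvature]
    have hpos := hc.pos a h0
    set r : ℝ := Real.sqrt (G y a a) with hr
    have hr2 : r ^ 2 = G y a a := Real.sq_sqrt hpos.le
    have hr0 : r ≠ 0 := (Real.sqrt_pos.2 hpos).ne'
    have e1 : G y (r⁻¹ • a) (r⁻¹ • a) = 1 := by
      simp only [map_smul, _root_.smul_apply, smul_eq_mul, ← hr2]; field_simp
    have e2 := hol (r⁻¹ • a) e1 (by simp [ha])
    simp only [map_smul, flatCurvature_smul₁, flatCurvature_smul₂, flatCurvature_smul₃,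
      _root_.smul_apply, smul_eq_mul] at e2
    have e3 : G y (flatCurvature C y a (φ y a) (φ y a)) a = c * r ^ 4 := by
      rw [← e2]; field_simp
    have e4 : G y a (φ y a) = 0 := by
      have := hc.metric_phi a a
      rw [hsymm] at this; linarith
    simp only [hQ, e3, hc.metric_phi_phi, e4, ha, ← hr2]
    ring
  have pairR := metric_flatCurvature_pair h hy
  have skewR : ∀ a b z d, G y (flatCurvature C y a b z) d = -G y (flatCurvature C y a b d) z :=
    fun a b z d ↦ by rw [metric_flatCurvature_skew h hy, hsymm]
  have sect : ∀ x ∈ D, ∀ z ∈ D, Q x z z x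
      = (c - 1) / 4 * (G y x x * G y z z - G y x z ^ 2 + 3 * G y x (φ y z) ^ 2) := by
    intro x hx z hz
    refine sectional_eq_of_holomorphic (D := D) (Q := Q) hsymm ?_ ?_ ?_ ?_ ?_ ?_ ?_ ?_ ?_ ?_ ?_
      hol' hx hz
    · intro a _; rw [memD, hc.eta_phi]
    · intro a ha; rw [hc.phi_phi, (memD a).1 ha, zero_smul, add_zero]
    · intro a ha b _; rw [hc.metric_phi_phi, (memD a).1 ha, zero_mul, sub_zero]
    · intro a a' b z d
      simp only [hQ, flatCurvature_add₁, map_add, _root_.add_apply]; ring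
    · intro a b b' z d
      simp only [hQ, flatCurvature_add₂, map_add, _root_.add_apply]; ring
    · intro a b z z' d
      simp only [hQ, flatCurvature_add₃, map_add, _root_.add_apply]; ring
    · intro a b z d
      simp only [hQ]; rw [flatCurvature_swap, map_neg, _root_.neg_apply]; ring
    · intro a b z d
      simp only [hQ]; rw [skewR]; ring
    · intro a b z d
      simp only [hQ]; rw [pairR, hsymm d a, hsymm z b, hsymm z a, hsymm d b]; ring
    · intro a b z d
      have := congrArg (fun w ↦ G y w d) (flatCurvature_bianchi h hy a b z)
      simp only [map_add, _root_.add_apply, map_zero, _root_.zero_apply] at this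
      simp only [hQ]; rw [hsymm z a, hsymm b a, hsymm z b]; linarith
    · intro a b z d
      simp only [hQ]
      rw [hS.flatCurvature_phi h hy]
      simp only [map_add, map_sub, map_smul, _root_.add_apply, _root_.sub_apply, _root_.smul_apply,
        smul_eq_mul, hc.metric_phi]
      ring
  have hTD := (memD T).2 hηT
  have hYD := (memD Y).2 hηY
  have hTφT : G y T (φ y T) = 0 := by
    have := hc.metric_phi T T
    rw [hsymm] at this; linarith
  have hTφY : G y T (φ y Y) = 0 := by
    have := hc.metric_phi T Y
    rw [hYφT] at this; linarith
  have onD : ∀ V ∈ D, G y (flatCurvature C y Y T T) V = (c + 3) / 4 * G y Y V := by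
    intro V hV
    have s1 := sect T hTD (Y + V) (D.add_mem hYD hV)
    have s2 := sect T hTD Y hYD
    have s3 := sect T hTD V hV
    have p1 : G y (flatCurvature C y T Y V) T = G y (flatCurvature C y Y T T) V := by
      rw [skewR, flatCurvature_swap, map_neg, _root_.neg_apply, neg_neg]
    have p2 : G y (flatCurvature C y T V Y) T = G y (flatCurvature C y Y T T) V :=
      pairR _ _ _ _
    simp only [hQ, flatCurvature_add₂, flatCurvature_add₃, map_add, _root_.add_apply, hTφY, hYT,
      hT, p1, p2, hsymm V Y, hsymm Y T, hsymm V T] at s1 s2 s3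
    linarith
  refine hc.ext_left fun V ↦ ?_
  have hV : V - η y V • ξ y ∈ D := by
    rw [memD, map_sub, map_smul, hc.eta_xi]; simp
  have e1 := onD _ hV
  have e2 : G y (flatCurvature C y Y T T) (ξ y) = 0 := by
    rw [skewR, hS.flatCurvature_xi h hy, hηT, hηY]; simp
  simp only [map_sub, map_smul, smul_eq_mul, e2, hc.metric_xi', hηY, mul_zero, sub_zero] at e1
  rw [e1, map_smul, _root_.smul_apply, smul_eq_mul]

end FlatSpaceForm

section ChartFrame

variable {E : Type*} [NormedAddCommGroup E] [NormedSpace ℝ E]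
  {M : Type*} [TopologicalSpace M] [ChartedSpace E M] [IsManifold 𝓘(ℝ, E) ∞ M]

/-- The coordinates of a tangent vector at `x` in the chart centred at `x₀`. -/
noncomputable def chartCoord (x₀ x : M) : TangentSpace 𝓘(ℝ, E) x →L[ℝ] E :=
  (trivializationAt E (TangentSpace 𝓘(ℝ, E) : M → Type _) x₀).continuousLinearMapAt ℝ x

/-- The vector field with constant coordinates `w` in the chart centred at `x₀`. -/
noncomputable def coordField (x₀ : M) (w : E) (x : M) : TangentSpace 𝓘(ℝ, E) x :=
  (trivializationAt E (TangentSpace 𝓘(ℝ, E) : M → Type _) x₀).symmL ℝ x w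

variable {x₀ x : M}

lemma mem_baseSet_trivializationAt_of_mem_source (hx : x ∈ (extChartAt 𝓘(ℝ, E) x₀).source) :
    x ∈ (trivializationAt E (TangentSpace 𝓘(ℝ, E) : M → Type _) x₀).baseSet := by
  simpa using hx

lemma chartCoord_coordField (hx : x ∈ (extChartAt 𝓘(ℝ, E) x₀).source) (w : E) :
    chartCoord x₀ x (coordField x₀ w x) = w :=
  (trivializationAt E (TangentSpace 𝓘(ℝ, E) : M → Type _) x₀).continuousLinearMapAt_symmL
    (mem_baseSet_trivializationAt_of_mem_source hx) w

lemma coordField_chartCoord (hx : x ∈ (extChartAt 𝓘(ℝ, E) x₀).source)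
    (v : TangentSpace 𝓘(ℝ, E) x) : coordField x₀ (chartCoord x₀ x v) x = v :=
  (trivializationAt E (TangentSpace 𝓘(ℝ, E) : M → Type _) x₀).symmL_continuousLinearMapAt
    (mem_baseSet_trivializationAt_of_mem_source hx) v

lemma chartCoord_injective (hx : x ∈ (extChartAt 𝓘(ℝ, E) x₀).source) :
    Function.Injective (chartCoord (E := E) x₀ x) := fun v w h ↦ by
  rw [← coordField_chartCoord hx v, h, coordField_chartCoord hx w]

lemma trivializationAt_snd_eq_chartCoord (hx : x ∈ (extChartAt 𝓘(ℝ, E) x₀).source)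
    (v : TangentSpace 𝓘(ℝ, E) x) :
    ((trivializationAt E (TangentSpace 𝓘(ℝ, E) : M → Type _) x₀) (TotalSpace.mk' E x v)).2
      = chartCoord x₀ x v := by
  have h := (trivializationAt E (TangentSpace 𝓘(ℝ, E) : M → Type _) x₀).coe_linearMapAt_of_mem
    (R := ℝ) (mem_baseSet_trivializationAt_of_mem_source hx)
  exact (congrFun h v).symm

lemma trivializationAt_symm_eq_coordField (hx : x ∈ (extChartAt 𝓘(ℝ, E) x₀).source) (w : E) :
    (trivializationAt E (TangentSpace 𝓘(ℝ, E) : M → Type _) x₀).symm x w = coordField x₀ w x :=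
  ((trivializationAt E (TangentSpace 𝓘(ℝ, E) : M → Type _) x₀).symmL_apply
    (mem_baseSet_trivializationAt_of_mem_source hx) w).symm

lemma extend_eq_coordField (v : TangentSpace 𝓘(ℝ, E) x₀)
    (hx : x ∈ (extChartAt 𝓘(ℝ, E) x₀).source) :
    extend E v x = coordField x₀ (chartCoord x₀ x₀ v) x := by
  rw [← trivializationAt_snd_eq_chartCoord (mem_extChartAt_source x₀),
    ← trivializationAt_symm_eq_coordField hx]
  rfl

lemma coordField_add (v w : E) : (coordField x₀ (v + w) : Π x : M, TangentSpace 𝓘(ℝ, E) x)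
    = coordField x₀ v + coordField x₀ w := by
  funext x; simp [coordField]

lemma coordField_smul (r : ℝ) (w : E) : (coordField x₀ (r • w) : Π x : M, TangentSpace 𝓘(ℝ, E) x)
    = r • coordField x₀ w := by
  funext x; simp [coordField]

omit [IsManifold 𝓘(ℝ, E) ∞ M] in
lemma source_mem_nhds (hx : x ∈ (extChartAt 𝓘(ℝ, E) x₀).source) :
    (extChartAt 𝓘(ℝ, E) x₀).source ∈ nhds x := (isOpen_extChartAt_source x₀).mem_nhds hx

lemma contMDiffAt_section_iff_chartCoord {n : WithTop ℕ∞} (hn : n ≤ ∞)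
    {V : Π x : M, TangentSpace 𝓘(ℝ, E) x} (hx : x ∈ (extChartAt 𝓘(ℝ, E) x₀).source) :
    ContMDiffAt 𝓘(ℝ, E) (𝓘(ℝ, E).prod 𝓘(ℝ, E)) n (fun y ↦ TotalSpace.mk' E y (V y)) x ↔
      ContMDiffAt 𝓘(ℝ, E) 𝓘(ℝ, E) n (fun y ↦ chartCoord x₀ y (V y)) x := by
  have : ContMDiffVectorBundle n E (TangentSpace 𝓘(ℝ, E) : M → Type _) 𝓘(ℝ, E) := by
    have : ContMDiffVectorBundle ∞ E (TangentSpace 𝓘(ℝ, E) : M → Type _) 𝓘(ℝ, E) := inferInstance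
    exact .of_le hn
  rw [(trivializationAt E (TangentSpace 𝓘(ℝ, E) : M → Type _) x₀).contMDiffAt_section_iff
    (mem_baseSet_trivializationAt_of_mem_source hx)]
  refine Filter.EventuallyEq.contMDiffAt_iff ?_
  filter_upwards [source_mem_nhds hx] with y hy
  exact trivializationAt_snd_eq_chartCoord hy (V y)

lemma mdifferentiableAt_section_iff_chartCoord
    {V : Π x : M, TangentSpace 𝓘(ℝ, E) x} (hx : x ∈ (extChartAt 𝓘(ℝ, E) x₀).source) :
    MDiffAt (T% V) x ↔ MDiffAt (fun y ↦ chartCoord x₀ y (V y)) x := by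
  rw [(trivializationAt E (TangentSpace 𝓘(ℝ, E) : M → Type _) x₀).mdifferentiableAt_section_iff _ _
    (mem_baseSet_trivializationAt_of_mem_source hx)]
  refine Filter.EventuallyEq.mdifferentiableAt_iff ?_
  filter_upwards [source_mem_nhds hx] with y hy
  exact trivializationAt_snd_eq_chartCoord hy (V y)

lemma contMDiffAt_coordField (hx : x ∈ (extChartAt 𝓘(ℝ, E) x₀).source) (w : E) :
    ContMDiffAt 𝓘(ℝ, E) (𝓘(ℝ, E).prod 𝓘(ℝ, E)) ∞
      (fun y ↦ TotalSpace.mk' E y (coordField x₀ w y)) x := by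
  rw [contMDiffAt_section_iff_chartCoord le_rfl hx]
  refine contMDiffAt_const (c := w) |>.congr_of_eventuallyEq ?_
  filter_upwards [source_mem_nhds hx] with y hy using chartCoord_coordField hy w

lemma mdifferentiableAt_coordField (hx : x ∈ (extChartAt 𝓘(ℝ, E) x₀).source) (w : E) :
    MDiffAt (T% (coordField x₀ w : Π x : M, TangentSpace 𝓘(ℝ, E) x)) x :=
  (contMDiffAt_coordField hx w).mdifferentiableAt (by simp)

lemma chartCoord_eq_mfderiv (hx : x ∈ (extChartAt 𝓘(ℝ, E) x₀).source)
    (v : TangentSpace 𝓘(ℝ, E) x) :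
    chartCoord x₀ x v = mfderiv 𝓘(ℝ, E) 𝓘(ℝ, E) (extChartAt 𝓘(ℝ, E) x₀) x v := by
  rw [chartCoord, TangentBundle.continuousLinearMapAt_trivializationAt (by simpa using hx)]
  rfl

lemma mvfderiv_eq_fderiv {F : Type*} [NormedAddCommGroup F] [NormedSpace ℝ F] {f : M → F}
    (hx : x ∈ (extChartAt 𝓘(ℝ, E) x₀).source) (hf : MDiffAt f x) (v : TangentSpace 𝓘(ℝ, E) x) :
    mvfderiv 𝓘(ℝ, E) f x v = fderiv ℝ (f ∘ (extChartAt 𝓘(ℝ, E) x₀).symm)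
      (extChartAt 𝓘(ℝ, E) x₀ x) (chartCoord x₀ x v) := by
  have hy := (extChartAt 𝓘(ℝ, E) x₀).map_source hx
  have h1 : MDifferentiableAt 𝓘(ℝ, E) 𝓘(ℝ, E) (extChartAt 𝓘(ℝ, E) x₀) x :=
    mdifferentiableAt_extChartAt (by simpa using hx)
  have h2 : MDifferentiableAt 𝓘(ℝ, E) 𝓘(ℝ, E) (extChartAt 𝓘(ℝ, E) x₀).symm
      (extChartAt 𝓘(ℝ, E) x₀ x) := by
    have := mdifferentiableWithinAt_extChartAt_symm (I := 𝓘(ℝ, E)) hy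
    rwa [modelWithCornersSelf_coe, Set.range_id, mdifferentiableWithinAt_univ] at this
  have h3 : MDifferentiableAt 𝓘(ℝ, E) 𝓘(ℝ, F) (f ∘ (extChartAt 𝓘(ℝ, E) x₀).symm)
      (extChartAt 𝓘(ℝ, E) x₀ x) :=
    MDifferentiableAt.comp_of_eq (hg := hf) (hf := h2)
      (hy := (extChartAt 𝓘(ℝ, E) x₀).left_inv hx)
  have h4 : f =ᶠ[nhds x] (f ∘ (extChartAt 𝓘(ℝ, E) x₀).symm) ∘ extChartAt 𝓘(ℝ, E) x₀ := by
    filter_upwards [source_mem_nhds hx] with y hy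
    simp only [Function.comp_apply]
    rw [(extChartAt 𝓘(ℝ, E) x₀).left_inv hy]
  rw [chartCoord_eq_mfderiv hx, ← mfderiv_eq_fderiv]
  have h5 := mfderiv_comp_apply x h3 h1 v
  exact (DFunLike.congr_fun h4.mfderiv_eq v).trans h5

/-- Coordinate vector fields commute. -/
lemma mlieBracket_coordField [CompleteSpace E] (hx : x ∈ (extChartAt 𝓘(ℝ, E) x₀).source)
    (v w : E) : mlieBracket 𝓘(ℝ, E) (coordField x₀ v) (coordField x₀ w) x = 0 := by
  have key : ∀ w, (coordField x₀ w : Π x : M, TangentSpace 𝓘(ℝ, E) x) =ᶠ[nhds x]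
      mpullback 𝓘(ℝ, E) 𝓘(ℝ, E) (extChartAt 𝓘(ℝ, E) x₀) (fun _ ↦ w) := by
    intro w
    filter_upwards [source_mem_nhds hx] with y hy
    refine chartCoord_injective hy ?_
    rw [chartCoord_coordField hy, chartCoord_eq_mfderiv hy]
    exact ((isInvertible_mfderiv_extChartAt hy).self_apply_inverse w).symm
  rw [(key v).mlieBracket_vectorField_eq (key w)]
  have h1 : ∀ w : E, MDifferentiableAt 𝓘(ℝ, E) (𝓘(ℝ, E).prod 𝓘(ℝ, E))
      (fun y : E ↦ TotalSpace.mk' E (E := TangentSpace 𝓘(ℝ, E)) y w)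
      (extChartAt 𝓘(ℝ, E) x₀ x) := fun w ↦
    ((contMDiffAt_vectorSpace_iff_contDiffAt (n := 1) (V := fun _ ↦ w)
      (x := extChartAt 𝓘(ℝ, E) x₀ x)).2 contDiffAt_const).mdifferentiableAt (by simp)
  have h2 : ContMDiffAt 𝓘(ℝ, E) 𝓘(ℝ, E) ∞ (extChartAt 𝓘(ℝ, E) x₀) x :=
    contMDiffAt_extChartAt' (by simpa using hx)
  have : IsManifold 𝓘(ℝ, E) (minSmoothness ℝ 2) M := by
    simp only [minSmoothness_of_isRCLikeNormedField]
    exact IsManifold.of_le two_le_infty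
  have : IsManifold 𝓘(ℝ, E) (minSmoothness ℝ 2) E := by infer_instance
  rw [← mpullback_mlieBracket (h1 v) (h1 w) h2
    (by simp only [minSmoothness_of_isRCLikeNormedField]; exact two_le_infty), mpullback_apply]
  have h3 : mlieBracket 𝓘(ℝ, E) (fun _ ↦ v : Π y : E, TangentSpace 𝓘(ℝ, E) y) (fun _ ↦ w)
      (extChartAt 𝓘(ℝ, E) x₀ x) = 0 := by
    have e := congrFun (mlieBracketWithin_eq_lieBracketWithin (𝕜 := ℝ) (V := fun _ : E ↦ v)
      (W := fun _ : E ↦ w) (s := Set.univ)) (extChartAt 𝓘(ℝ, E) x₀ x)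
    refine e.trans ?_
    rw [lieBracketWithin_univ]
    simp [lieBracket]
    rfl
  rw [h3, map_zero]

end ChartFrame

section ChartGeometry

variable {E : Type*} [NormedAddCommGroup E] [NormedSpace ℝ E] [FiniteDimensional ℝ E]
  {M : Type*} [TopologicalSpace M] [ChartedSpace E M] [IsManifold 𝓘(ℝ, E) ∞ M]
  [RiemannianBundle (fun x : M ↦ TangentSpace 𝓘(ℝ, E) x)]

omit [FiniteDimensional ℝ E] [RiemannianBundle (fun x : M ↦ TangentSpace 𝓘(ℝ, E) x)] in
lemma coordField_add_apply (x₀ x : M) (v w : E) :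
    coordField x₀ (v + w) x = coordField x₀ v x + coordField x₀ w x :=
  map_add ((trivializationAt E (TangentSpace 𝓘(ℝ, E) : M → Type _) x₀).symmL ℝ x) v w

omit [FiniteDimensional ℝ E] [RiemannianBundle (fun x : M ↦ TangentSpace 𝓘(ℝ, E) x)] in
lemma coordField_smul_apply (x₀ x : M) (r : ℝ) (w : E) :
    coordField x₀ (r • w) x = r • coordField x₀ w x :=
  map_smul ((trivializationAt E (TangentSpace 𝓘(ℝ, E) : M → Type _) x₀).symmL ℝ x) r w

/-- The metric in the chart centred at `x₀`. -/
noncomputable def chartMetric (x₀ : M) (y : E) : E →L[ℝ] E →L[ℝ] ℝ :=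
  LinearMap.toContinuousLinearMap
    { toFun := fun v ↦ LinearMap.toContinuousLinearMap
        { toFun := fun w ↦ inner ℝ (coordField x₀ v ((extChartAt 𝓘(ℝ, E) x₀).symm y))
            (coordField x₀ w ((extChartAt 𝓘(ℝ, E) x₀).symm y))
          map_add' := fun w w' ↦ by rw [coordField_add_apply]; exact inner_add_right _ _ _
          map_smul' := fun r w ↦ by rw [coordField_smul_apply]; exact inner_smul_right _ _ _ }
      map_add' := fun v v' ↦ by
        refine ContinuousLinearMap.ext fun w ↦ ?_
        change inner ℝ (coordField x₀ (v + v') _) _ = _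
        rw [coordField_add_apply]; exact inner_add_left _ _ _
      map_smul' := fun r v ↦ by
        refine ContinuousLinearMap.ext fun w ↦ ?_
        change inner ℝ (coordField x₀ (r • v) _) _ = _
        rw [coordField_smul_apply]; exact real_inner_smul_left _ _ _ }

lemma chartMetric_apply (x₀ : M) (y v w : E) : chartMetric x₀ y v w =
    inner ℝ (coordField x₀ v ((extChartAt 𝓘(ℝ, E) x₀).symm y))
      (coordField x₀ w ((extChartAt 𝓘(ℝ, E) x₀).symm y)) := rfl

variable {x₀ x : M}

lemma inner_eq_chartMetric (hx : x ∈ (extChartAt 𝓘(ℝ, E) x₀).source)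
    (v w : TangentSpace 𝓘(ℝ, E) x) : inner ℝ v w =
      chartMetric x₀ (extChartAt 𝓘(ℝ, E) x₀ x) (chartCoord x₀ x v) (chartCoord x₀ x w) := by
  rw [chartMetric_apply, (extChartAt 𝓘(ℝ, E) x₀).left_inv hx, coordField_chartCoord hx,
    coordField_chartCoord hx]

variable [IsContMDiffRiemannianBundle 𝓘(ℝ, E) ∞ E (fun x : M ↦ TangentSpace 𝓘(ℝ, E) x)]

open Classical in
/-- The Christoffel tensor of the Levi-Civita connection in the chart centred at `x₀`. -/
noncomputable def chartConn (x₀ : M) (y : E) : E →L[ℝ] E →L[ℝ] E :=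
  if hy : y ∈ (extChartAt 𝓘(ℝ, E) x₀).target then
    LinearMap.toContinuousLinearMap
      { toFun := fun v ↦ LinearMap.toContinuousLinearMap
          { toFun := fun w ↦ chartCoord x₀ ((extChartAt 𝓘(ℝ, E) x₀).symm y)
              (leviCivita (coordField x₀ w) ((extChartAt 𝓘(ℝ, E) x₀).symm y)
                (coordField x₀ v ((extChartAt 𝓘(ℝ, E) x₀).symm y)))
            map_add' := fun w w' ↦ by
              have hx := (extChartAt 𝓘(ℝ, E) x₀).map_target hy
              rw [coordField_add, leviCivita.isCovariantDerivativeOnUniv.add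
                (mdifferentiableAt_coordField hx w) (mdifferentiableAt_coordField hx w')]
              exact map_add _ _ _
            map_smul' := fun r w ↦ by
              have hx := (extChartAt 𝓘(ℝ, E) x₀).map_target hy
              rw [coordField_smul, leviCivita.isCovariantDerivativeOnUniv.smul_const r
                (mdifferentiableAt_coordField hx w)]
              exact map_smul _ _ _ }
        map_add' := fun v v' ↦ by
          refine ContinuousLinearMap.ext fun w ↦ ?_
          change chartCoord x₀ _ (leviCivita _ _ (coordField x₀ (v + v') _)) = _
          rw [coordField_add_apply, map_add]; exact map_add _ _ _
        map_smul' := fun r v ↦ by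
          refine ContinuousLinearMap.ext fun w ↦ ?_
          change chartCoord x₀ _ (leviCivita _ _ (coordField x₀ (r • v) _)) = _
          rw [coordField_smul_apply, map_smul]; exact map_smul _ _ _ }
  else 0

lemma chartConn_apply {y : E} (hy : y ∈ (extChartAt 𝓘(ℝ, E) x₀).target) (v w : E) :
    chartConn x₀ y v w = chartCoord x₀ ((extChartAt 𝓘(ℝ, E) x₀).symm y)
      (leviCivita (coordField x₀ w) ((extChartAt 𝓘(ℝ, E) x₀).symm y)
        (coordField x₀ v ((extChartAt 𝓘(ℝ, E) x₀).symm y))) := by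
  rw [chartConn, dif_pos hy]; rfl

omit [FiniteDimensional ℝ E] in
lemma contMDiffAt_inner {V W : Π x : M, TangentSpace 𝓘(ℝ, E) x}
    (hV : ContMDiffAt 𝓘(ℝ, E) (𝓘(ℝ, E).prod 𝓘(ℝ, E)) ∞ (fun y ↦ TotalSpace.mk' E y (V y)) x)
    (hW : ContMDiffAt 𝓘(ℝ, E) (𝓘(ℝ, E).prod 𝓘(ℝ, E)) ∞ (fun y ↦ TotalSpace.mk' E y (W y)) x) :
    ContMDiffAt 𝓘(ℝ, E) 𝓘(ℝ, ℝ) ∞ (fun y ↦ inner ℝ (V y) (W y)) x :=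
  ContMDiffAt.inner_bundle (IB := 𝓘(ℝ, E)) (F := E) (E := fun x : M ↦ TangentSpace 𝓘(ℝ, E) x) hV hW

omit [RiemannianBundle (fun x : M ↦ TangentSpace 𝓘(ℝ, E) x)]
  [IsContMDiffRiemannianBundle 𝓘(ℝ, E) ∞ E (fun x : M ↦ TangentSpace 𝓘(ℝ, E) x)]
  [FiniteDimensional ℝ E] in
lemma contDiffAt_comp_extChartAt_symm {F : Type*} [NormedAddCommGroup F] [NormedSpace ℝ F]
    {f : M → F} {y : E} (hy : y ∈ (extChartAt 𝓘(ℝ, E) x₀).target)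
    (hf : ContMDiffAt 𝓘(ℝ, E) 𝓘(ℝ, F) ∞ f ((extChartAt 𝓘(ℝ, E) x₀).symm y)) :
    ContDiffAt ℝ ∞ (fun z ↦ f ((extChartAt 𝓘(ℝ, E) x₀).symm z)) y := by
  have h1 : ContMDiffAt 𝓘(ℝ, E) 𝓘(ℝ, E) ∞ (extChartAt 𝓘(ℝ, E) x₀).symm y :=
    (contMDiffOn_extChartAt_symm x₀).contMDiffAt ((isOpen_extChartAt_target x₀).mem_nhds hy)
  exact (hf.comp y h1).contDiffAt

lemma contDiffOn_chartMetric (x₀ : M) :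
    ContDiffOn ℝ ∞ (chartMetric x₀) (extChartAt 𝓘(ℝ, E) x₀).target := by
  rw [contDiffOn_clm_apply]
  intro v
  rw [contDiffOn_clm_apply]
  intro w y hy
  have hx := (extChartAt 𝓘(ℝ, E) x₀).map_target hy
  exact (contDiffAt_comp_extChartAt_symm hy (contMDiffAt_inner
    (contMDiffAt_coordField hx v) (contMDiffAt_coordField hx w))).contDiffWithinAt

lemma chartConn_symm {y : E} (hy : y ∈ (extChartAt 𝓘(ℝ, E) x₀).target) (v w : E) :
    chartConn x₀ y v w = chartConn x₀ y w v := by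
  have hx := (extChartAt 𝓘(ℝ, E) x₀).map_target hy
  have h := (CovariantDerivative.torsion_eq_zero_iff _).1
    (leviCivita_torsion (I := 𝓘(ℝ, E)) (M := M))
    (mdifferentiableAt_coordField hx v) (mdifferentiableAt_coordField hx w)
  have : CompleteSpace E := FiniteDimensional.complete ℝ E
  rw [mlieBracket_coordField hx, sub_eq_zero] at h
  rw [chartConn_apply hy, chartConn_apply hy, h]

lemma fderiv_chartMetric {y : E} (hy : y ∈ (extChartAt 𝓘(ℝ, E) x₀).target) (v a b : E) :
    fderiv ℝ (chartMetric x₀) y v a b = chartMetric x₀ y (chartConn x₀ y v a) b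
      + chartMetric x₀ y a (chartConn x₀ y v b) := by
  have hx := (extChartAt 𝓘(ℝ, E) x₀).map_target hy
  have hv := mdifferentiableAt_coordField hx v
  have ha := mdifferentiableAt_coordField hx a
  have hb := mdifferentiableAt_coordField hx b
  have h1 := leviCivita_isMetricCompatible hv ha hb
  rw [mvfderiv_eq_fderiv hx (mdiffAt_inner ha hb), chartCoord_coordField hx,
    inner_eq_chartMetric hx, inner_eq_chartMetric hx, (extChartAt 𝓘(ℝ, E) x₀).right_inv hy,
    chartCoord_coordField hx, chartCoord_coordField hx, ← chartConn_apply hy,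
    ← chartConn_apply hy] at h1
  rw [← h1]
  have hd : DifferentiableAt ℝ (chartMetric x₀) y :=
    ((contDiffOn_chartMetric x₀).contDiffAt
      ((isOpen_extChartAt_target x₀).mem_nhds hy)).differentiableAt (by simp)
  have h2 := (hd.hasFDerivAt.clm_apply (hasFDerivAt_const a y)).clm_apply (hasFDerivAt_const b y)
  have h3 := DFunLike.congr_fun h2.fderiv v
  simp at h3
  exact h3.symm

end ChartGeometry

section ChartLeviCivita

lemma isInvertible_of_bilin_pos {E : Type*} [NormedAddCommGroup E] [NormedSpace ℝ E]
    [FiniteDimensional ℝ E] {B : E →L[ℝ] E →L[ℝ] ℝ} (hB : ∀ a, a ≠ 0 → 0 < B a a) :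
    B.IsInvertible := by
  have hinj : Function.Injective B.toLinearMap := by
    rw [← LinearMap.ker_eq_bot, LinearMap.ker_eq_bot']
    intro a ha
    by_contra hne
    have h1 := hB a hne
    have h2 : B a = 0 := ha
    rw [h2] at h1
    simp at h1
  have hdim : Module.finrank ℝ E = Module.finrank ℝ (E →L[ℝ] ℝ) :=
    (Subspace.dual_finrank_eq (K := ℝ) (V := E)).symm.trans
      (LinearMap.toContinuousLinearMap (𝕜 := ℝ) (E := E) (F' := ℝ)).finrank_eq
  refine ⟨(LinearEquiv.ofInjectiveOfFinrankEq B.toLinearMap hinj hdim).toContinuousLinearEquiv, ?_⟩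
  ext a b
  rfl

variable {E : Type*} [NormedAddCommGroup E] [NormedSpace ℝ E] [FiniteDimensional ℝ E]
  {M : Type*} [TopologicalSpace M] [ChartedSpace E M] [IsManifold 𝓘(ℝ, E) ∞ M]
  [RiemannianBundle (fun x : M ↦ TangentSpace 𝓘(ℝ, E) x)]
  {x₀ x : M}

lemma chartMetric_pos {y : E} (hy : y ∈ (extChartAt 𝓘(ℝ, E) x₀).target) (a : E) (ha : a ≠ 0) :
    0 < chartMetric x₀ y a a := by
  rw [chartMetric_apply]
  refine real_inner_self_pos.2 fun h ↦ ha ?_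
  rw [← chartCoord_coordField ((extChartAt 𝓘(ℝ, E) x₀).map_target hy) a, h]
  exact map_zero _

lemma chartMetric_symm (x₀ : M) (y a b : E) : chartMetric x₀ y a b = chartMetric x₀ y b a := by
  rw [chartMetric_apply, chartMetric_apply]
  exact real_inner_comm _ _

variable [IsContMDiffRiemannianBundle 𝓘(ℝ, E) ∞ E (fun x : M ↦ TangentSpace 𝓘(ℝ, E) x)]

lemma contDiffOn_chartConn (x₀ : M) :
    ContDiffOn ℝ ∞ (chartConn x₀) (extChartAt 𝓘(ℝ, E) x₀).target := by
  rw [contDiffOn_clm_apply]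
  intro v
  rw [contDiffOn_clm_apply]
  intro w
  have hd : ∀ a b c : E, ContDiffOn ℝ ∞ (fun y ↦ fderiv ℝ (chartMetric x₀) y a b c)
      (extChartAt 𝓘(ℝ, E) x₀).target := fun a b c ↦
    ((((contDiffOn_chartMetric x₀).fderiv_of_isOpen (m := ∞) (isOpen_extChartAt_target x₀)
      (by simp)).clm_apply contDiffOn_const).clm_apply contDiffOn_const).clm_apply contDiffOn_const
  have hK : ContDiffOn ℝ ∞ (fun y ↦ chartMetric x₀ y (chartConn x₀ y v w))
      (extChartAt 𝓘(ℝ, E) x₀).target := by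
    rw [contDiffOn_clm_apply]
    intro z
    refine ((contDiffOn_const (c := (1 / 2 : ℝ))).mul (((hd v w z).add (hd w v z)).sub
      (hd z v w))).congr fun y hy ↦ ?_
    simp only [fderiv_chartMetric hy]
    rw [chartConn_symm hy w v, chartConn_symm hy z v, chartConn_symm hy z w,
      chartMetric_symm x₀ y (chartConn x₀ y v z) w]
    ring
  intro y hy
  have hcomp : CompleteSpace E := FiniteDimensional.complete ℝ E
  have hinv := ((isInvertible_of_bilin_pos (chartMetric_pos hy)).contDiffAt_map_inverse
    (n := ∞)).comp_contDiffWithinAt y (contDiffOn_chartMetric x₀ y hy)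
  refine (hinv.clm_apply (hK y hy)).congr_of_mem (fun z hz ↦ ?_) hy
  exact ((isInvertible_of_bilin_pos (chartMetric_pos hz)).inverse_apply_self _).symm

theorem isLeviCivitaOn_chartConn (x₀ : M) : IsLeviCivitaOn (extChartAt 𝓘(ℝ, E) x₀).target
    (chartMetric x₀) (chartConn x₀) where
  isOpen := isOpen_extChartAt_target x₀
  contDiffOn_metric := contDiffOn_chartMetric x₀
  contDiffOn_conn := contDiffOn_chartConn x₀
  metric_symm _ _ := chartMetric_symm x₀ _
  metric_pos _ hy := chartMetric_pos hy
  conn_symm _ hy := chartConn_symm hy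
  compat _ hy := fderiv_chartMetric hy

/-- The Levi-Civita connection in a chart. -/
lemma chartCoord_leviCivita (hx : x ∈ (extChartAt 𝓘(ℝ, E) x₀).source)
    {Y : Π x : M, TangentSpace 𝓘(ℝ, E) x} (hY : MDiffAt (T% Y) x) (v : TangentSpace 𝓘(ℝ, E) x) :
    chartCoord x₀ x (leviCivita Y x v) = mvfderiv 𝓘(ℝ, E) (fun z ↦ chartCoord x₀ z (Y z)) x v
      + chartConn x₀ (extChartAt 𝓘(ℝ, E) x₀ x) (chartCoord x₀ x v) (chartCoord x₀ x (Y x)) := by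
  have hc : ∀ {Z : Π x : M, TangentSpace 𝓘(ℝ, E) x}, MDiffAt (T% Z) x →
      MDiffAt (fun y ↦ chartCoord x₀ y (Z y)) x := fun hZ ↦
    (mdifferentiableAt_section_iff_chartCoord hx).1 hZ
  have hten : TensorialAt 𝓘(ℝ, E) E (fun Z : Π x : M, TangentSpace 𝓘(ℝ, E) x ↦
      (chartCoord x₀ x (leviCivita Z x v)
        - mvfderiv 𝓘(ℝ, E) (fun z ↦ chartCoord x₀ z (Z z)) x v : E)) x := by
    constructor
    · intro f Z hf hZ
      have h1 := leviCivita.isCovariantDerivativeOnUniv.leibniz hZ hf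
      have h2 : mvfderiv 𝓘(ℝ, E) (fun z ↦ chartCoord x₀ z ((f • Z) z)) x
          = f x • mvfderiv 𝓘(ℝ, E) (fun z ↦ chartCoord x₀ z (Z z)) x
            + (mvfderiv 𝓘(ℝ, E) f x).smulRight (chartCoord x₀ x (Z x)) := by
        rw [← mvfderiv_smul hf (hc hZ)]
        congr 1
        funext z
        exact map_smul (chartCoord x₀ z) (f z) (Z z)
      have h3 : leviCivita (f • Z) x v = f x • leviCivita Z x v + mvfderiv 𝓘(ℝ, E) f x v • Z x :=
        DFunLike.congr_fun h1 v
      have h4 := DFunLike.congr_fun h2 v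
      rw [h3, h4, map_add, map_smul, map_smul]
      simp only [_root_.add_apply, _root_.smul_apply, ContinuousLinearMap.smulRight_apply, smul_sub]
      abel
    · intro Z Z' hZ hZ'
      have h1 := leviCivita.isCovariantDerivativeOnUniv.add hZ hZ'
      have h2 : mvfderiv 𝓘(ℝ, E) (fun z ↦ chartCoord x₀ z ((Z + Z') z)) x
          = mvfderiv 𝓘(ℝ, E) (fun z ↦ chartCoord x₀ z (Z z)) x
            + mvfderiv 𝓘(ℝ, E) (fun z ↦ chartCoord x₀ z (Z' z)) x := by
        rw [← mvfderiv_add (hc hZ) (hc hZ')]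
        congr 1
        funext z
        exact map_add (chartCoord x₀ z) (Z z) (Z' z)
      have h3 : leviCivita (Z + Z') x v = leviCivita Z x v + leviCivita Z' x v :=
        DFunLike.congr_fun h1 v
      have h4 := DFunLike.congr_fun h2 v
      rw [h3, h4, map_add]
      simp only [_root_.add_apply]
      abel
  have h1 := hten.pointwise hY (mdifferentiableAt_coordField hx (chartCoord x₀ x (Y x)))
    (coordField_chartCoord hx (Y x)).symm
  have h2 : (fun z ↦ chartCoord x₀ z (coordField x₀ (chartCoord x₀ x (Y x)) z))
      =ᶠ[nhds x] fun _ ↦ chartCoord x₀ x (Y x) := by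
    filter_upwards [source_mem_nhds hx] with y hy using chartCoord_coordField hy _
  have h3 : mvfderiv 𝓘(ℝ, E) (fun z ↦ chartCoord x₀ z (coordField x₀ (chartCoord x₀ x (Y x)) z)) x
      v = 0 := by
    have h := DFunLike.congr_fun (h2.mfderiv_eq (I := 𝓘(ℝ, E)) (I' := 𝓘(ℝ, E))) v
    rw [mfderiv_const] at h
    exact h
  rw [h3, sub_zero] at h1
  rw [chartConn_apply ((extChartAt 𝓘(ℝ, E) x₀).map_source hx), (extChartAt 𝓘(ℝ, E) x₀).left_inv hx,
    coordField_chartCoord hx, ← h1]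
  abel

end ChartLeviCivita

section ChartTransition

variable {E : Type*} [NormedAddCommGroup E] [NormedSpace ℝ E]
  {M : Type*} [TopologicalSpace M] [ChartedSpace E M] [IsManifold 𝓘(ℝ, E) ∞ M]

/-- The change of coordinates of tangent vectors from the chart centred at `x₀` to the chart
centred at `x₁`, at the point with coordinates `y` in the former. -/
noncomputable def chartTransition (x₀ x₁ : M) (y : E) : E →L[ℝ] E :=
  (chartCoord x₁ ((extChartAt 𝓘(ℝ, E) x₀).symm y)).comp
    ((trivializationAt E (TangentSpace 𝓘(ℝ, E) : M → Type _) x₀).symmL ℝ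
      ((extChartAt 𝓘(ℝ, E) x₀).symm y))

variable {x₀ x₁ x : M}

lemma chartTransition_apply (y w : E) : chartTransition x₀ x₁ y w =
    chartCoord x₁ ((extChartAt 𝓘(ℝ, E) x₀).symm y)
      (coordField x₀ w ((extChartAt 𝓘(ℝ, E) x₀).symm y)) := rfl

lemma chartTransition_chartCoord (h₀ : x ∈ (extChartAt 𝓘(ℝ, E) x₀).source)
    (v : TangentSpace 𝓘(ℝ, E) x) :
    chartTransition x₀ x₁ (extChartAt 𝓘(ℝ, E) x₀ x) (chartCoord x₀ x v) = chartCoord x₁ x v := by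
  rw [chartTransition_apply, (extChartAt 𝓘(ℝ, E) x₀).left_inv h₀, coordField_chartCoord h₀]

lemma contDiffAt_chartTransition [FiniteDimensional ℝ E]
    (h₀ : x ∈ (extChartAt 𝓘(ℝ, E) x₀).source) (h₁ : x ∈ (extChartAt 𝓘(ℝ, E) x₁).source) :
    ContDiffAt ℝ ∞ (chartTransition x₀ x₁) (extChartAt 𝓘(ℝ, E) x₀ x) := by
  have hopen : IsOpen ((extChartAt 𝓘(ℝ, E) x₀).target ∩
      (extChartAt 𝓘(ℝ, E) x₀).symm ⁻¹' (extChartAt 𝓘(ℝ, E) x₁).source) :=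
    (continuousOn_extChartAt_symm x₀).isOpen_inter_preimage (isOpen_extChartAt_target x₀)
      (isOpen_extChartAt_source x₁)
  have hon : ContDiffOn ℝ ∞ (chartTransition x₀ x₁) ((extChartAt 𝓘(ℝ, E) x₀).target ∩
      (extChartAt 𝓘(ℝ, E) x₀).symm ⁻¹' (extChartAt 𝓘(ℝ, E) x₁).source) := by
    rw [contDiffOn_clm_apply]
    intro w y hy
    exact (contDiffAt_comp_extChartAt_symm hy.1 ((contMDiffAt_section_iff_chartCoord le_rfl
      hy.2).1 (contMDiffAt_coordField ((extChartAt 𝓘(ℝ, E) x₀).map_target hy.1)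
        w))).contDiffWithinAt
  refine hon.contDiffAt (hopen.mem_nhds ⟨(extChartAt 𝓘(ℝ, E) x₀).map_source h₀, ?_⟩)
  simpa only [Set.mem_preimage, (extChartAt 𝓘(ℝ, E) x₀).left_inv h₀] using h₁

lemma contDiffAt_extChartAt_comp {P : Type*} [NormedAddCommGroup P] [NormedSpace ℝ P]
    {γ : P → M} {t : P} (hγ : ContMDiffAt 𝓘(ℝ, P) 𝓘(ℝ, E) ∞ γ t)
    (h₀ : γ t ∈ (extChartAt 𝓘(ℝ, E) x₀).source) :
    ContDiffAt ℝ ∞ (fun s ↦ extChartAt 𝓘(ℝ, E) x₀ (γ s)) t :=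
  ((contMDiffAt_extChartAt' (I := 𝓘(ℝ, E)) (n := ∞) (by simpa using h₀)).comp t hγ).contDiffAt

omit [IsManifold 𝓘(ℝ, E) ∞ M] in
lemma eventually_mem_source {P : Type*} [TopologicalSpace P]
    {γ : P → M} {t : P} (hγ : ContinuousAt γ t) (h₀ : γ t ∈ (extChartAt 𝓘(ℝ, E) x₀).source) :
    ∀ᶠ s in nhds t, γ s ∈ (extChartAt 𝓘(ℝ, E) x₀).source :=
  hγ (source_mem_nhds h₀)

lemma contDiffAt_chartCoord_of_contDiffAt [FiniteDimensional ℝ E] {γ : ℝ → M} {t : ℝ}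
    (hγ : ContMDiffAt 𝓘(ℝ, ℝ) 𝓘(ℝ, E) ∞ γ t) {V : Π s, TangentSpace 𝓘(ℝ, E) (γ s)}
    (h₀ : γ t ∈ (extChartAt 𝓘(ℝ, E) x₀).source) (h₁ : γ t ∈ (extChartAt 𝓘(ℝ, E) x₁).source)
    (hV : ContDiffAt ℝ ∞ (fun s ↦ chartCoord x₀ (γ s) (V s)) t) :
    ContDiffAt ℝ ∞ (fun s ↦ chartCoord x₁ (γ s) (V s)) t := by
  refine (((contDiffAt_chartTransition h₀ h₁).comp t
    (contDiffAt_extChartAt_comp hγ h₀)).clm_apply hV).congr_of_eventuallyEq ?_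
  filter_upwards [eventually_mem_source hγ.continuousAt h₀] with s hs
  exact (chartTransition_chartCoord hs (V s)).symm

lemma contDiffAt_chartCoord_of_contMDiffAt {γ : ℝ → M} {t : ℝ}
    {V : Π s, TangentSpace 𝓘(ℝ, E) (γ s)}
    (hV : ContMDiffAt 𝓘(ℝ, ℝ) (𝓘(ℝ, E).prod 𝓘(ℝ, E)) ∞
      (fun s ↦ TotalSpace.mk' E (E := fun x : M ↦ TangentSpace 𝓘(ℝ, E) x) (γ s) (V s)) t)
    (h₀ : γ t ∈ (extChartAt 𝓘(ℝ, E) x₀).source) :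
    ContDiffAt ℝ ∞ (fun s ↦ chartCoord x₀ (γ s) (V s)) t := by
  have h := ((trivializationAt E (TangentSpace 𝓘(ℝ, E) : M → Type _) x₀).contMDiffAt_iff (n := ∞)
    (IB := 𝓘(ℝ, E)) (IM := 𝓘(ℝ, ℝ))
    (x₀ := t) (f := fun s ↦ TotalSpace.mk' E (E := fun x : M ↦ TangentSpace 𝓘(ℝ, E) x) (γ s) (V s))
    (by rw [Trivialization.mem_source]; exact mem_baseSet_trivializationAt_of_mem_source h₀)).1 hV
  refine h.2.contDiffAt.congr_of_eventuallyEq ?_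
  filter_upwards [eventually_mem_source h.1.continuousAt h₀] with s hs
  exact (trivializationAt_snd_eq_chartCoord hs (V s)).symm

lemma chartCoord_velocity [FiniteDimensional ℝ E] {γ : ℝ → M} {t : ℝ}
    (hγ : ContMDiffAt 𝓘(ℝ, ℝ) 𝓘(ℝ, E) ∞ γ t)
    (h₀ : γ t ∈ (extChartAt 𝓘(ℝ, E) x₀).source) :
    chartCoord x₀ (γ t) (velocity 𝓘(ℝ, E) γ t)
      = fderiv ℝ (fun s ↦ extChartAt 𝓘(ℝ, E) x₀ (γ s)) t 1 := by
  have h1 : MDifferentiableAt 𝓘(ℝ, E) 𝓘(ℝ, E) (extChartAt 𝓘(ℝ, E) x₀) (γ t) :=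
    mdifferentiableAt_extChartAt (by simpa using h₀)
  rw [chartCoord_eq_mfderiv h₀, ← mfderiv_eq_fderiv]
  exact (mfderiv_comp_apply t h1 (hγ.mdifferentiableAt (by simp)) (1 : ℝ)).symm

end ChartTransition

section ChartCovDeriv

variable {E : Type*} [NormedAddCommGroup E] [NormedSpace ℝ E] [FiniteDimensional ℝ E]
  {M : Type*} [TopologicalSpace M] [ChartedSpace E M] [IsManifold 𝓘(ℝ, E) ∞ M]
  [RiemannianBundle (fun x : M ↦ TangentSpace 𝓘(ℝ, E) x)]
  [IsContMDiffRiemannianBundle 𝓘(ℝ, E) ∞ E (fun x : M ↦ TangentSpace 𝓘(ℝ, E) x)]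
  {x₀ x : M}

omit [FiniteDimensional ℝ E] [RiemannianBundle (fun x : M ↦ TangentSpace 𝓘(ℝ, E) x)]
  [IsContMDiffRiemannianBundle 𝓘(ℝ, E) ∞ E (fun x : M ↦ TangentSpace 𝓘(ℝ, E) x)] in
lemma extend_eventuallyEq_coordField (v : TangentSpace 𝓘(ℝ, E) x₀)
    (hx : x ∈ (extChartAt 𝓘(ℝ, E) x₀).source) :
    ∀ᶠ z in nhds x, extend E v z = coordField x₀ (chartCoord x₀ x₀ v) z := by
  filter_upwards [source_mem_nhds hx] with z hz using extend_eq_coordField v hz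

omit [FiniteDimensional ℝ E] [RiemannianBundle (fun x : M ↦ TangentSpace 𝓘(ℝ, E) x)]
  [IsContMDiffRiemannianBundle 𝓘(ℝ, E) ∞ E (fun x : M ↦ TangentSpace 𝓘(ℝ, E) x)] in
lemma mdifferentiableAt_extend_of_mem_source (v : TangentSpace 𝓘(ℝ, E) x₀)
    (hx : x ∈ (extChartAt 𝓘(ℝ, E) x₀).source) :
    MDiffAt (T% (extend E v : Π x : M, TangentSpace 𝓘(ℝ, E) x)) x := by
  refine (mdifferentiableAt_coordField hx (chartCoord x₀ x₀ v)).congr_of_eventuallyEq ?_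
  filter_upwards [extend_eventuallyEq_coordField v hx] with z hz
  exact congrArg (TotalSpace.mk' E z) hz

/-- The covariant derivative along a curve in an arbitrary chart. -/
lemma chartCoord_covDerivAlong {γ : ℝ → M} {t : ℝ} (hγ : ContMDiffAt 𝓘(ℝ, ℝ) 𝓘(ℝ, E) ∞ γ t)
    {V : Π s, TangentSpace 𝓘(ℝ, E) (γ s)} (h₀ : γ t ∈ (extChartAt 𝓘(ℝ, E) x₀).source)
    (hV : ContDiffAt ℝ ∞ (fun s ↦ chartCoord x₀ (γ s) (V s)) t) :
    chartCoord x₀ (γ t) (covDerivAlong 𝓘(ℝ, E) γ V t)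
      = flatCovDeriv (chartConn x₀) (fun s ↦ extChartAt 𝓘(ℝ, E) x₀ (γ s))
          (fun s ↦ chartCoord x₀ (γ s) (V s)) t 1 := by
  have hc := mem_extChartAt_source (I := 𝓘(ℝ, E)) (γ t)
  have hV' := contDiffAt_chartCoord_of_contDiffAt hγ h₀ hc hV
  have hu := contDiffAt_extChartAt_comp hγ hc
  set u : ℝ → E := fun s ↦ extChartAt 𝓘(ℝ, E) (γ t) (γ s)
  set W : ℝ → E := fun s ↦ chartCoord (γ t) (γ s) (V s) with hW
  have hB := contDiffAt_chartTransition hc h₀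
  have hBd : DifferentiableAt ℝ (chartTransition (γ t) x₀) (u t) := hB.differentiableAt (by simp)
  have hsrc := eventually_mem_source hγ.continuousAt hc
  have e1 : (fun s ↦ chartCoord x₀ (γ s) (V s))
      =ᶠ[nhds t] fun s ↦ chartTransition (γ t) x₀ (u s) (W s) := by
    filter_upwards [hsrc] with s hs
    exact (chartTransition_chartCoord hs (V s)).symm
  have hBu : HasFDerivAt (fun s ↦ chartTransition (γ t) x₀ (u s))
      ((fderiv ℝ (chartTransition (γ t) x₀) (u t)).comp (fderiv ℝ u t)) t :=
    HasFDerivAt.comp (g := chartTransition (γ t) x₀) (f := u) t hBd.hasFDerivAt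
      (hu.differentiableAt (by simp)).hasFDerivAt
  have e2 : fderiv ℝ (fun s ↦ chartCoord x₀ (γ s) (V s)) t 1
      = fderiv ℝ (chartTransition (γ t) x₀) (u t) (fderiv ℝ u t 1) (W t)
        + chartTransition (γ t) x₀ (u t) (fderiv ℝ W t 1) := by
    rw [e1.fderiv_eq, (hBu.clm_apply (hV'.differentiableAt (by simp)).hasFDerivAt).fderiv]
    simp
    abel
  have e3 : (trivializationAt E (TangentSpace 𝓘(ℝ, E) : M → Type _) (γ t)).symm (γ t)
      (deriv (fun s ↦ ((trivializationAt E (TangentSpace 𝓘(ℝ, E) : M → Type _) (γ t))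
        (TotalSpace.mk' E (γ s) (V s))).2) t) = coordField (γ t) (fderiv ℝ W t 1) (γ t) := by
    rw [trivializationAt_symm_eq_coordField hc, fderiv_apply_one_eq_deriv]
    congr 1
    refine Filter.EventuallyEq.deriv_eq ?_
    filter_upwards [hsrc] with s hs using trivializationAt_snd_eq_chartCoord hs (V s)
  have e4 : chartCoord x₀ (γ t) (coordField (γ t) (fderiv ℝ W t 1) (γ t))
      = chartTransition (γ t) x₀ (u t) (fderiv ℝ W t 1) := by
    rw [chartTransition_apply, (extChartAt 𝓘(ℝ, E) (γ t)).left_inv hc]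
  have hext := mdifferentiableAt_extend_of_mem_source (V t) hc
  have e5 : mvfderiv 𝓘(ℝ, E) (fun z ↦ chartCoord x₀ z (extend E (V t) z)) (γ t)
      (velocity 𝓘(ℝ, E) γ t)
      = fderiv ℝ (chartTransition (γ t) x₀) (u t) (fderiv ℝ u t 1) (W t) := by
    rw [mvfderiv_eq_fderiv hc ((mdifferentiableAt_section_iff_chartCoord h₀).1 hext),
      chartCoord_velocity hγ hc]
    have e6 : (fun z ↦ chartCoord x₀ z (extend E (V t) z)) ∘ (extChartAt 𝓘(ℝ, E) (γ t)).symm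
        =ᶠ[nhds (u t)] fun y ↦ chartTransition (γ t) x₀ y (W t) := by
      filter_upwards [extChartAt_target_mem_nhds' (I := 𝓘(ℝ, E))
        ((extChartAt 𝓘(ℝ, E) (γ t)).map_source hc)] with y hy
      rw [chartTransition_apply]
      exact congrArg _ (extend_eq_coordField (V t) ((extChartAt 𝓘(ℝ, E) (γ t)).map_target hy))
    rw [e6.fderiv_eq, (hBd.hasFDerivAt.clm_apply (hasFDerivAt_const (W t) (u t))).fderiv]
    simp
    rfl
  rw [covDerivAlong, map_add, e3, e4, chartCoord_leviCivita h₀ hext, e5, flatCovDeriv, e2,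
    chartCoord_velocity hγ h₀, extend_apply_self]
  abel

/-- The curvature tensor in the chart centred at the base point. -/
lemma chartCoord_riemannCurvature (x : M) (u v w : TangentSpace 𝓘(ℝ, E) x) :
    chartCoord x x (riemannCurvature x u v w)
      = flatCurvature (chartConn x) (extChartAt 𝓘(ℝ, E) x x) (chartCoord x x u) (chartCoord x x v)
          (chartCoord x x w) := by
  have hx := mem_extChartAt_source (I := 𝓘(ℝ, E)) x
  have hcomp : CompleteSpace E := FiniteDimensional.complete ℝ E
  have hC : DifferentiableAt ℝ (chartConn x) (extChartAt 𝓘(ℝ, E) x x) :=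
    (isLeviCivitaOn_chartConn x).differentiableAt_conn ((extChartAt 𝓘(ℝ, E) x).map_source hx)
  have key : ∀ a b c : TangentSpace 𝓘(ℝ, E) x,
      chartCoord x x (leviCivita (fun y ↦ leviCivita (extend E c) y (extend E b y)) x a)
        = fderiv ℝ (chartConn x) (extChartAt 𝓘(ℝ, E) x x) (chartCoord x x a) (chartCoord x x b)
            (chartCoord x x c)
          + chartConn x (extChartAt 𝓘(ℝ, E) x x) (chartCoord x x a)
            (chartConn x (extChartAt 𝓘(ℝ, E) x x) (chartCoord x x b) (chartCoord x x c)) := by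
    intro a b c
    have e1 : ∀ z ∈ (extChartAt 𝓘(ℝ, E) x).source,
        chartCoord x z (leviCivita (extend E c) z (extend E b z))
        = chartConn x (extChartAt 𝓘(ℝ, E) x z) (chartCoord x x b) (chartCoord x x c) := by
      intro z hz
      rw [leviCivita.isCovariantDerivativeOnUniv.congr_of_eventuallyEq
        (mdifferentiableAt_extend_of_mem_source c hz) (mdifferentiableAt_coordField hz _)
        Filter.univ_mem (extend_eventuallyEq_coordField c hz), extend_eq_coordField b hz,
        chartConn_apply ((extChartAt 𝓘(ℝ, E) x).map_source hz),
        (extChartAt 𝓘(ℝ, E) x).left_inv hz]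
    have hd : HasFDerivAt (fun y ↦ chartConn x y (chartCoord x x b) (chartCoord x x c)) _
        (extChartAt 𝓘(ℝ, E) x x) :=
      (hC.hasFDerivAt.clm_apply (hasFDerivAt_const (chartCoord x x b) _)).clm_apply
        (hasFDerivAt_const (chartCoord x x c) _)
    have e2 : MDiffAt (fun z ↦ chartCoord x z (leviCivita (extend E c) z (extend E b z))) x := by
      have h1 : MDiffAt (fun z ↦ chartConn x (extChartAt 𝓘(ℝ, E) x z) (chartCoord x x b)
          (chartCoord x x c)) x :=
        MDifferentiableAt.comp (I' := 𝓘(ℝ, E)) x hd.differentiableAt.mdifferentiableAt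
          (mdifferentiableAt_extChartAt (I := 𝓘(ℝ, E)) (by simp))
      refine h1.congr_of_eventuallyEq ?_
      filter_upwards [source_mem_nhds hx] with z hz using e1 z hz
    rw [chartCoord_leviCivita hx ((mdifferentiableAt_section_iff_chartCoord hx).2 e2),
      mvfderiv_eq_fderiv hx e2, e1 x hx]
    congr 1
    have e3 : (fun z ↦ chartCoord x z (leviCivita (extend E c) z (extend E b z)))
        ∘ (extChartAt 𝓘(ℝ, E) x).symm =ᶠ[nhds (extChartAt 𝓘(ℝ, E) x x)]
        fun y ↦ chartConn x y (chartCoord x x b) (chartCoord x x c) := by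
      filter_upwards [extChartAt_target_mem_nhds (I := 𝓘(ℝ, E)) x] with y hy
      refine (e1 _ ((extChartAt 𝓘(ℝ, E) x).map_target hy)).trans ?_
      rw [(extChartAt 𝓘(ℝ, E) x).right_inv hy]
    rw [e3.fderiv_eq, hd.fderiv]
    simp
  have hbr : mlieBracket 𝓘(ℝ, E) (extend E u) (extend E v) x = 0 := by
    rw [Filter.EventuallyEq.mlieBracket_vectorField_eq (extend_eventuallyEq_coordField u hx)
      (extend_eventuallyEq_coordField v hx), mlieBracket_coordField hx]
  rw [riemannCurvature, curvatureField, hbr, map_zero, sub_zero, map_sub, extend_apply_self,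
    extend_apply_self, key, key, flatCurvature]
  abel

end ChartCovDeriv

section ChartSasakian

variable {E : Type*} [NormedAddCommGroup E] [NormedSpace ℝ E] [FiniteDimensional ℝ E]
  {M : Type*} [TopologicalSpace M] [ChartedSpace E M] [IsManifold 𝓘(ℝ, E) ∞ M]

/-- A field of endomorphisms in the chart centred at `x₀`. -/
noncomputable def chartEnd (φ : Π x : M, TangentSpace 𝓘(ℝ, E) x →L[ℝ] TangentSpace 𝓘(ℝ, E) x)
    (x₀ : M) (y : E) : E →L[ℝ] E :=
  (chartCoord x₀ ((extChartAt 𝓘(ℝ, E) x₀).symm y)).comp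
    ((φ ((extChartAt 𝓘(ℝ, E) x₀).symm y)).comp
      ((trivializationAt E (TangentSpace 𝓘(ℝ, E) : M → Type _) x₀).symmL ℝ
        ((extChartAt 𝓘(ℝ, E) x₀).symm y)))

/-- A vector field in the chart centred at `x₀`. -/
noncomputable def chartVec (ξ : Π x : M, TangentSpace 𝓘(ℝ, E) x) (x₀ : M) (y : E) : E :=
  chartCoord x₀ ((extChartAt 𝓘(ℝ, E) x₀).symm y) (ξ ((extChartAt 𝓘(ℝ, E) x₀).symm y))

/-- A one-form in the chart centred at `x₀`. -/
noncomputable def chartForm (η : Π x : M, TangentSpace 𝓘(ℝ, E) x →L[ℝ] ℝ)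
    (x₀ : M) (y : E) : E →L[ℝ] ℝ :=
  (η ((extChartAt 𝓘(ℝ, E) x₀).symm y)).comp
    ((trivializationAt E (TangentSpace 𝓘(ℝ, E) : M → Type _) x₀).symmL ℝ
      ((extChartAt 𝓘(ℝ, E) x₀).symm y))

variable {φ : Π x : M, TangentSpace 𝓘(ℝ, E) x →L[ℝ] TangentSpace 𝓘(ℝ, E) x}
  {ξ : Π x : M, TangentSpace 𝓘(ℝ, E) x} {η : Π x : M, TangentSpace 𝓘(ℝ, E) x →L[ℝ] ℝ}
  {x₀ x : M}

omit [FiniteDimensional ℝ E] in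
lemma chartEnd_apply (y w : E) : chartEnd φ x₀ y w = chartCoord x₀
    ((extChartAt 𝓘(ℝ, E) x₀).symm y) (φ _ (coordField x₀ w ((extChartAt 𝓘(ℝ, E) x₀).symm y))) := rfl

omit [FiniteDimensional ℝ E] in
lemma chartForm_apply (y w : E) : chartForm η x₀ y w =
    η _ (coordField x₀ w ((extChartAt 𝓘(ℝ, E) x₀).symm y)) := rfl

omit [FiniteDimensional ℝ E] in
lemma chartEnd_chartCoord (hx : x ∈ (extChartAt 𝓘(ℝ, E) x₀).source) (v : TangentSpace 𝓘(ℝ, E) x) :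
    chartEnd φ x₀ (extChartAt 𝓘(ℝ, E) x₀ x) (chartCoord x₀ x v) = chartCoord x₀ x (φ x v) := by
  rw [chartEnd_apply, (extChartAt 𝓘(ℝ, E) x₀).left_inv hx, coordField_chartCoord hx]

omit [FiniteDimensional ℝ E] in
lemma chartForm_chartCoord (hx : x ∈ (extChartAt 𝓘(ℝ, E) x₀).source) (v : TangentSpace 𝓘(ℝ, E) x) :
    chartForm η x₀ (extChartAt 𝓘(ℝ, E) x₀ x) (chartCoord x₀ x v) = η x v := by
  rw [chartForm_apply, (extChartAt 𝓘(ℝ, E) x₀).left_inv hx, coordField_chartCoord hx]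

omit [FiniteDimensional ℝ E] in
lemma chartVec_extChartAt (hx : x ∈ (extChartAt 𝓘(ℝ, E) x₀).source) :
    chartVec ξ x₀ (extChartAt 𝓘(ℝ, E) x₀ x) = chartCoord x₀ x (ξ x) := by
  rw [chartVec, (extChartAt 𝓘(ℝ, E) x₀).left_inv hx]

variable [RiemannianBundle (fun x : M ↦ TangentSpace 𝓘(ℝ, E) x)]

omit [FiniteDimensional ℝ E] in
lemma IsAlmostContactMetric.contMDiffAt_phi_apply (hM : IsAlmostContactMetric 𝓘(ℝ, E) φ ξ η)
    {X : Π x : M, TangentSpace 𝓘(ℝ, E) x}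
    (hX : ContMDiffAt 𝓘(ℝ, E) (𝓘(ℝ, E).prod 𝓘(ℝ, E)) ∞ (fun y ↦ TotalSpace.mk' E y (X y)) x) :
    ContMDiffAt 𝓘(ℝ, E) (𝓘(ℝ, E).prod 𝓘(ℝ, E)) ∞ (fun y ↦ TotalSpace.mk' E y (φ y (X y))) x :=
  ContMDiffAt.clm_bundle_apply (F₁ := E) (F₂ := E) (hM.contMDiff_phi x) hX

omit [FiniteDimensional ℝ E] in
lemma IsAlmostContactMetric.contMDiffAt_eta_apply (hM : IsAlmostContactMetric 𝓘(ℝ, E) φ ξ η)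
    {X : Π x : M, TangentSpace 𝓘(ℝ, E) x}
    (hX : ContMDiffAt 𝓘(ℝ, E) (𝓘(ℝ, E).prod 𝓘(ℝ, E)) ∞ (fun y ↦ TotalSpace.mk' E y (X y)) x) :
    ContMDiffAt 𝓘(ℝ, E) 𝓘(ℝ, ℝ) ∞ (fun y ↦ η y (X y)) x := by
  have h : ContMDiffAt 𝓘(ℝ, E) (𝓘(ℝ, E).prod 𝓘(ℝ, ℝ)) ∞
      (fun y ↦ TotalSpace.mk' ℝ (E := Trivial M ℝ) y (η y (X y))) x :=
    ContMDiffAt.clm_bundle_apply (F₁ := E) (F₂ := ℝ) (E₂ := Trivial M ℝ) (hM.contMDiff_eta x) hX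
  rw [contMDiffAt_totalSpace] at h
  exact h.2

variable [IsContMDiffRiemannianBundle 𝓘(ℝ, E) ∞ E (fun x : M ↦ TangentSpace 𝓘(ℝ, E) x)]

/-- The Lie bracket in a chart. -/
lemma chartCoord_mlieBracket (hx : x ∈ (extChartAt 𝓘(ℝ, E) x₀).source)
    {X Y : Π x : M, TangentSpace 𝓘(ℝ, E) x} (hX : MDiffAt (T% X) x) (hY : MDiffAt (T% Y) x) :
    chartCoord x₀ x (mlieBracket 𝓘(ℝ, E) X Y x)
      = mvfderiv 𝓘(ℝ, E) (fun z ↦ chartCoord x₀ z (Y z)) x (X x)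
        - mvfderiv 𝓘(ℝ, E) (fun z ↦ chartCoord x₀ z (X z)) x (Y x) := by
  have h := (CovariantDerivative.torsion_eq_zero_iff _).1
    (leviCivita_torsion (I := 𝓘(ℝ, E)) (M := M)) hX hY
  rw [← h, map_sub, chartCoord_leviCivita hx hX, chartCoord_leviCivita hx hY,
    chartConn_symm ((extChartAt 𝓘(ℝ, E) x₀).map_source hx)]
  abel

theorem IsSasakian.isSasakianOn (hM : IsSasakian 𝓘(ℝ, E) φ ξ η) (x₀ : M) :
    IsSasakianOn (extChartAt 𝓘(ℝ, E) x₀).target (chartMetric x₀) (chartEnd φ x₀) (chartVec ξ x₀)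
      (chartForm η x₀) := by
  have hcomp : CompleteSpace E := FiniteDimensional.complete ℝ E
  have hphi : ContDiffOn ℝ ∞ (chartEnd φ x₀) (extChartAt 𝓘(ℝ, E) x₀).target := by
    rw [contDiffOn_clm_apply]
    intro w y hy
    have hx := (extChartAt 𝓘(ℝ, E) x₀).map_target hy
    exact (contDiffAt_comp_extChartAt_symm hy ((contMDiffAt_section_iff_chartCoord le_rfl hx).1
      (hM.contMDiffAt_phi_apply (contMDiffAt_coordField hx w)))).contDiffWithinAt
  have heta : ContDiffOn ℝ ∞ (chartForm η x₀) (extChartAt 𝓘(ℝ, E) x₀).target := by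
    rw [contDiffOn_clm_apply]
    intro w y hy
    have hx := (extChartAt 𝓘(ℝ, E) x₀).map_target hy
    exact (contDiffAt_comp_extChartAt_symm hy
      (hM.contMDiffAt_eta_apply (contMDiffAt_coordField hx w))).contDiffWithinAt
  have hcontact : ∀ y ∈ (extChartAt 𝓘(ℝ, E) x₀).target, ∀ a b,
      extDerivOneForm 𝓘(ℝ, E) η (coordField x₀ a) (coordField x₀ b)
        ((extChartAt 𝓘(ℝ, E) x₀).symm y) = chartMetric x₀ y a (chartEnd φ x₀ y b) := by
    intro y hy a b
    have hx := (extChartAt 𝓘(ℝ, E) x₀).map_target hy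
    rw [hM.extDeriv_eta _ _ _ (contMDiffAt_coordField hx a) (contMDiffAt_coordField hx b),
      inner_eq_chartMetric hx, (extChartAt 𝓘(ℝ, E) x₀).right_inv hy, chartCoord_coordField hx,
      chartEnd_apply]
  refine ⟨hphi, ?_, heta, ?_, ?_, ?_⟩
  · intro y hy
    have hx := (extChartAt 𝓘(ℝ, E) x₀).map_target hy
    exact (contDiffAt_comp_extChartAt_symm hy ((contMDiffAt_section_iff_chartCoord le_rfl hx).1
      (hM.contMDiff_xi _))).contDiffWithinAt
  · intro y hy
    have hx := (extChartAt 𝓘(ℝ, E) x₀).map_target hy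
    refine ⟨chartMetric_symm x₀ y, chartMetric_pos hy, fun a ↦ ?_, ?_, fun a b ↦ ?_⟩
    · rw [chartEnd_apply, chartEnd_apply, coordField_chartCoord hx, hM.phi_phi, map_add, map_neg,
        map_smul, chartCoord_coordField hx]
      rfl
    · rw [chartForm_apply, chartVec, coordField_chartCoord hx, hM.eta_xi]
    · have h := hM.inner_phi_phi _ (coordField x₀ a ((extChartAt 𝓘(ℝ, E) x₀).symm y))
        (coordField x₀ b ((extChartAt 𝓘(ℝ, E) x₀).symm y))
      rwa [inner_eq_chartMetric hx, inner_eq_chartMetric hx,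
        (extChartAt 𝓘(ℝ, E) x₀).right_inv hy, chartCoord_coordField hx, chartCoord_coordField hx] at h
  · intro y hy a b
    have hx := (extChartAt 𝓘(ℝ, E) x₀).map_target hy
    have h := hcontact y hy a b
    have hd : ∀ c : E, MDiffAt (fun z ↦ η z (coordField x₀ c z))
        ((extChartAt 𝓘(ℝ, E) x₀).symm y) := fun c ↦
      (hM.contMDiffAt_eta_apply (contMDiffAt_coordField hx c)).mdifferentiableAt (by simp)
    rw [extDerivOneForm, mlieBracket_coordField hx, map_zero, sub_zero, mvfderiv_eq_fderiv hx (hd b),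
      mvfderiv_eq_fderiv hx (hd a), chartCoord_coordField hx, chartCoord_coordField hx,
      (extChartAt 𝓘(ℝ, E) x₀).right_inv hy] at h
    have h' : (1 / 2 : ℝ) * (fderiv ℝ (fun z ↦ chartForm η x₀ z b) y a
      - fderiv ℝ (fun z ↦ chartForm η x₀ z a) y b) = chartMetric x₀ y a (chartEnd φ x₀ y b) := h
    linarith
  · intro y hy a b
    have hx := (extChartAt 𝓘(ℝ, E) x₀).map_target hy
    have hφ : DifferentiableAt ℝ (chartEnd φ x₀) y :=
      (hphi.contDiffAt ((isOpen_extChartAt_target x₀).mem_nhds hy)).differentiableAt (by simp)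
    have hA := fun c : E ↦ mdifferentiableAt_coordField hx c
    have hφA := fun c : E ↦ (hM.contMDiffAt_phi_apply
      (contMDiffAt_coordField hx c)).mdifferentiableAt (by simp)
    have d1 : ∀ (c : E) (v : TangentSpace 𝓘(ℝ, E) ((extChartAt 𝓘(ℝ, E) x₀).symm y)),
        mvfderiv 𝓘(ℝ, E) (fun z ↦ chartCoord x₀ z (coordField x₀ c z))
          ((extChartAt 𝓘(ℝ, E) x₀).symm y) v = 0 := by
      intro c v
      have e : (fun z ↦ chartCoord x₀ z (coordField x₀ c z))
          =ᶠ[nhds ((extChartAt 𝓘(ℝ, E) x₀).symm y)] fun _ ↦ c := by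
        filter_upwards [source_mem_nhds hx] with z hz using chartCoord_coordField hz _
      have h := DFunLike.congr_fun (e.mfderiv_eq (I := 𝓘(ℝ, E)) (I' := 𝓘(ℝ, E))) v
      rw [mfderiv_const] at h
      exact h
    have d2 : ∀ (c : E) (v : TangentSpace 𝓘(ℝ, E) ((extChartAt 𝓘(ℝ, E) x₀).symm y)),
        mvfderiv 𝓘(ℝ, E) (fun z ↦ chartCoord x₀ z (φ z (coordField x₀ c z)))
          ((extChartAt 𝓘(ℝ, E) x₀).symm y) v
        = fderiv ℝ (chartEnd φ x₀) y (chartCoord x₀ _ v) c := by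
      intro c v
      rw [mvfderiv_eq_fderiv hx ((mdifferentiableAt_section_iff_chartCoord hx).1 (hφA c)),
        (extChartAt 𝓘(ℝ, E) x₀).right_inv hy]
      have h := DFunLike.congr_fun (hφ.hasFDerivAt.clm_apply (hasFDerivAt_const c y)).fderiv
        (chartCoord x₀ ((extChartAt 𝓘(ℝ, E) x₀).symm y) v)
      refine Eq.trans ?_ (h.trans (by simp))
      rfl
    have h := congrArg (chartCoord x₀ ((extChartAt 𝓘(ℝ, E) x₀).symm y))
      (hM.normal _ _ _ (contMDiffAt_coordField hx a) (contMDiffAt_coordField hx b))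
    have hB : ∀ v, chartCoord x₀ ((extChartAt 𝓘(ℝ, E) x₀).symm y)
        (φ ((extChartAt 𝓘(ℝ, E) x₀).symm y) v)
        = chartEnd φ x₀ y (chartCoord x₀ ((extChartAt 𝓘(ℝ, E) x₀).symm y) v) := by
      intro v
      rw [← chartEnd_chartCoord hx, (extChartAt 𝓘(ℝ, E) x₀).right_inv hy]
    rw [nijenhuis, hcontact y hy, mlieBracket_coordField hx, map_zero, map_zero, zero_add, map_sub,
      map_sub, hB, hB, chartCoord_mlieBracket hx (hφA a) (hφA b),
      chartCoord_mlieBracket hx (hφA a) (hA b), chartCoord_mlieBracket hx (hA a) (hφA b),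
      map_smul, d1, d1, d2, d2, d2, d2, chartCoord_coordField hx, chartCoord_coordField hx, hB, hB,
      chartCoord_coordField hx, chartCoord_coordField hx] at h
    simp only [zero_sub, sub_zero, map_neg, sub_neg_eq_add] at h
    exact h

/-- In a Sasakian space form `M(c)`, `R(Y, T)T = (c + 3)/4 Y` for a Legendre unit vector `T` and `Y`
orthogonal to `ξ`, `T` and `φT`. -/
theorem IsSasakianSpaceForm.riemannCurvature_legendre {c : ℝ}
    (hM : IsSasakianSpaceForm 𝓘(ℝ, E) φ ξ η c) {T Y : TangentSpace 𝓘(ℝ, E) x}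
    (hT : inner ℝ T T = (1 : ℝ)) (hηT : η x T = 0) (hηY : η x Y = 0)
    (hYT : inner ℝ T Y = (0 : ℝ)) (hYφT : inner ℝ (φ x T) Y = (0 : ℝ)) :
    riemannCurvature x Y T T = ((c + 3) / 4) • Y := by
  have hx := mem_extChartAt_source (I := 𝓘(ℝ, E)) x
  have hy := (extChartAt 𝓘(ℝ, E) x).map_source hx
  have hS := hM.toIsSasakian.isSasakianOn x
  have hol : ∀ u, chartMetric x (extChartAt 𝓘(ℝ, E) x x) u u = 1 →
      chartForm η x (extChartAt 𝓘(ℝ, E) x x) u = 0 →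
      chartMetric x (extChartAt 𝓘(ℝ, E) x x) (flatCurvature (chartConn x) (extChartAt 𝓘(ℝ, E) x x) u
        (chartEnd φ x (extChartAt 𝓘(ℝ, E) x x) u) (chartEnd φ x (extChartAt 𝓘(ℝ, E) x x) u)) u
        = c := by
    intro u hu hηu
    obtain ⟨v, rfl⟩ : ∃ v, chartCoord x x v = u :=
      ⟨coordField x u x, chartCoord_coordField hx u⟩
    rw [← inner_eq_chartMetric hx] at hu
    have h1 : ‖v‖ = 1 := by
      rw [real_inner_self_eq_norm_sq] at hu
      nlinarith [norm_nonneg v]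
    have h2 : inner ℝ v (ξ x) = 0 := by
      rw [inner_eq_chartMetric hx, ← chartVec_extChartAt hx, (hS.almostContact _ hy).metric_xi', hηu]
    have h3 := hM.phi_sectional x v h1 h2
    rwa [inner_eq_chartMetric hx, chartCoord_riemannCurvature, ← chartEnd_chartCoord hx] at h3
  refine chartCoord_injective hx ?_
  rw [inner_eq_chartMetric hx] at hT hYT hYφT
  rw [← chartEnd_chartCoord hx] at hYφT
  rw [chartCoord_riemannCurvature, hS.flatCurvature_legendre (isLeviCivitaOn_chartConn x) hy hol hT
    (by rw [chartForm_chartCoord hx, hηT]) (by rw [chartForm_chartCoord hx, hηY]) hYT hYφT]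
  exact (map_smul _ _ _).symm

/-- The velocity field of a Legendre curve satisfies `η(∇_T T) = 0`. -/
theorem IsSasakian.eta_tensionField_eq_zero (hM : IsSasakian 𝓘(ℝ, E) φ ξ η) {γ : ℝ → M} {t : ℝ}
    (hγ : ContMDiffAt 𝓘(ℝ, ℝ) 𝓘(ℝ, E) ∞ γ t)
    (hev : ∀ᶠ s in nhds t, ContMDiffAt 𝓘(ℝ, ℝ) 𝓘(ℝ, E) ∞ γ s)
    (hL : ∀ᶠ s in nhds t, η (γ s) (velocity 𝓘(ℝ, E) γ s) = 0) :
    η (γ t) (tensionField 𝓘(ℝ, E) γ t) = 0 := by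
  have hx := mem_extChartAt_source (I := 𝓘(ℝ, E)) (γ t)
  have hy := (extChartAt 𝓘(ℝ, E) (γ t)).map_source hx
  have hS := hM.isSasakianOn (γ t)
  have h := isLeviCivitaOn_chartConn (E := E) (γ t)
  have hu := contDiffAt_extChartAt_comp hγ hx
  set u : ℝ → E := fun s ↦ extChartAt 𝓘(ℝ, E) (γ t) (γ s)
  have hsrc := eventually_mem_source hγ.continuousAt hx
  have e1 : (fun s ↦ chartCoord (γ t) (γ s) (velocity 𝓘(ℝ, E) γ s))
      =ᶠ[nhds t] fun s ↦ fderiv ℝ u s 1 := by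
    filter_upwards [hsrc, hev] with s hs hs' using chartCoord_velocity hs' hs
  have hT : ContDiffAt ℝ ∞ (fun s ↦ fderiv ℝ u s 1) t := contDiffAt_fderiv_apply hu 1
  have hξ : DifferentiableAt ℝ (chartVec ξ (γ t)) (u t) := hS.differentiableAt_xi h hy
  have hud : DifferentiableAt ℝ u t := hu.differentiableAt (by simp)
  have e2 : (fun s ↦ chartMetric (γ t) (u s) (fderiv ℝ u s 1) (chartVec ξ (γ t) (u s)))
      =ᶠ[nhds t] fun _ ↦ 0 := by
    filter_upwards [hsrc, hL, e1] with s hs hs' hs''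
    rw [(hS.almostContact _ ((extChartAt 𝓘(ℝ, E) (γ t)).map_source hs)).metric_xi', ← hs'',
      chartForm_chartCoord hs, hs']
  have e3 := fderiv_metric (X := fun s ↦ fderiv ℝ u s 1) (Y := fun s ↦ chartVec ξ (γ t) (u s)) h hy
    hud (hT.differentiableAt (by simp)) (hξ.comp t hud) 1
  have e4 : flatCovDeriv (chartConn (γ t)) u (fun s ↦ chartVec ξ (γ t) (u s)) t 1
      = -chartEnd φ (γ t) (u t) (fderiv ℝ u t 1) := by
    rw [← hS.flatCovDeriv_xi h hy, flatCovDeriv, flatCovDeriv]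
    have := HasFDerivAt.comp (g := chartVec ξ (γ t)) (f := u) t hξ.hasFDerivAt hud.hasFDerivAt
    have e := DFunLike.congr_fun this.fderiv 1
    congr 1
    simp
    rfl
  have hac := hS.almostContact _ hy
  have e5 : chartMetric (γ t) (u t) (fderiv ℝ u t 1)
      (chartEnd φ (γ t) (u t) (fderiv ℝ u t 1)) = 0 := by
    have := hac.metric_phi (fderiv ℝ u t 1) (fderiv ℝ u t 1)
    rw [hac.symm] at this
    linarith
  rw [e2.fderiv_eq, e4, map_neg, e5, hac.metric_xi'] at e3
  simp at e3
  rw [← chartForm_chartCoord hx, tensionField, chartCoord_covDerivAlong hγ hx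
    (hT.congr_of_eventuallyEq e1), flatCovDeriv_congr e1 (Filter.EventuallyEq.refl _ _)]
  exact e3.symm

end ChartSasakian

section FlatSesqui

variable {E : Type*} [NormedAddCommGroup E] [NormedSpace ℝ E]
  {F : Type*} [NormedAddCommGroup F] [NormedSpace ℝ F]

/-- The Euler-Lagrange field `∇_w ∇_w τ + R(τ, ∂_w u) ∂_w u - κ τ` in coordinates. -/
noncomputable def flatSesqui (C : E → E →L[ℝ] E →L[ℝ] E) (κ : ℝ) (u : F → E) (p w : F) : E :=
  flatCovDeriv C u (fun q ↦ flatCovDeriv C u (fun q ↦ flatTension C u q w) q w) p w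
    + flatCurvature C (u p) (flatTension C u p w) (fderiv ℝ u p w) (fderiv ℝ u p w)
    - κ • flatTension C u p w

lemma flatSesqui_congr {C : E → E →L[ℝ] E →L[ℝ] E} {κ : ℝ} {u u' : F → E} {p : F}
    (hu : u =ᶠ[nhds p] u') (w : F) : flatSesqui C κ u p w = flatSesqui C κ u' p w := by
  have key : ∀ {X X' : F → E}, X =ᶠ[nhds p] X' →
      (fun q ↦ flatCovDeriv C u X q w) =ᶠ[nhds p] fun q ↦ flatCovDeriv C u' X' q w := by
    intro X X' hX
    filter_upwards [hu.eventuallyEq_nhds, hX.eventuallyEq_nhds] with q hq hq'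
    exact flatCovDeriv_congr hq' hq w
  have h1 : (fun q ↦ fderiv ℝ u q w) =ᶠ[nhds p] fun q ↦ fderiv ℝ u' q w := by
    filter_upwards [hu.eventuallyEq_nhds] with q hq
    rw [hq.fderiv_eq]
  have h2 : (fun q ↦ flatTension C u q w) =ᶠ[nhds p] fun q ↦ flatTension C u' q w := key h1
  have h3 := (key (key h2)).eq_of_nhds
  rw [flatSesqui, flatSesqui, h3, h2.eq_of_nhds, hu.fderiv_eq, hu.eq_of_nhds]

lemma fderiv_slice_right {X : ℝ × ℝ → E} {s t : ℝ} (hX : DifferentiableAt ℝ X (s, t)) :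
    fderiv ℝ (fun τ ↦ X (s, τ)) t 1 = fderiv ℝ X (s, t) (0, 1) := by
  have h := HasFDerivAt.comp (g := X) (f := fun τ : ℝ ↦ (s, τ)) t hX.hasFDerivAt
    (hasFDerivAt_prodMk_right s t)
  exact (DFunLike.congr_fun h.fderiv 1).trans (by simp)

lemma fderiv_slice_left {X : ℝ × ℝ → E} {s t : ℝ} (hX : DifferentiableAt ℝ X (s, t)) :
    fderiv ℝ (fun σ ↦ X (σ, t)) s 1 = fderiv ℝ X (s, t) (1, 0) := by
  have h := HasFDerivAt.comp (g := X) (f := fun σ : ℝ ↦ (σ, t)) s hX.hasFDerivAt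
    (hasFDerivAt_prodMk_left s t)
  exact (DFunLike.congr_fun h.fderiv 1).trans (by simp)

lemma contDiffAt_slice_right {X : ℝ × ℝ → E} {s t : ℝ} (hX : ContDiffAt ℝ ∞ X (s, t)) :
    ContDiffAt ℝ ∞ (fun τ ↦ X (s, τ)) t :=
  ContDiffAt.comp (g := X) (f := fun τ : ℝ ↦ (s, τ)) t hX (contDiffAt_const.prodMk contDiffAt_id)

end FlatSesqui

section Variation

variable {E : Type*} [NormedAddCommGroup E] [NormedSpace ℝ E]
  {M : Type*} [TopologicalSpace M] [ChartedSpace E M]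

/-- The part `N` of the parameter space of the smooth two-parameter map `Γ` lies in the domain of
the chart centred at `x₀`. -/
structure IsVariationChart (Γ : ℝ → ℝ → M) (x₀ : M) (N : Set (ℝ × ℝ)) : Prop where
  isOpen : IsOpen N
  contMDiffOn : ContMDiffOn 𝓘(ℝ, ℝ × ℝ) 𝓘(ℝ, E) ∞ (fun p : ℝ × ℝ ↦ Γ p.1 p.2) N
  mem_source : ∀ p ∈ N, Γ p.1 p.2 ∈ (extChartAt 𝓘(ℝ, E) x₀).source

/-- A two-parameter map in the chart centred at `x₀`. -/
noncomputable def chartMap (Γ : ℝ → ℝ → M) (x₀ : M) (p : ℝ × ℝ) : E :=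
  extChartAt 𝓘(ℝ, E) x₀ (Γ p.1 p.2)

variable {Γ : ℝ → ℝ → M} {x₀ : M} {N : Set (ℝ × ℝ)} {s t : ℝ}

lemma exists_isVariationChart {D : Set (ℝ × ℝ)} (hD : IsOpen D)
    (hΓ : ContMDiffOn 𝓘(ℝ, ℝ × ℝ) 𝓘(ℝ, E) ∞ (fun p : ℝ × ℝ ↦ Γ p.1 p.2) D)
    {p : ℝ × ℝ} (hp : p ∈ D) :
    ∃ N ⊆ D, p ∈ N ∧ IsVariationChart (E := E) Γ (Γ p.1 p.2) N :=
  ⟨D ∩ (fun p : ℝ × ℝ ↦ Γ p.1 p.2) ⁻¹' (extChartAt 𝓘(ℝ, E) (Γ p.1 p.2)).source,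
    Set.inter_subset_left, ⟨hp, mem_extChartAt_source (I := 𝓘(ℝ, E)) _⟩,
    hΓ.continuousOn.isOpen_inter_preimage hD (isOpen_extChartAt_source _),
    hΓ.mono Set.inter_subset_left, fun _ hq ↦ hq.2⟩

namespace IsVariationChart

variable (h : IsVariationChart (E := E) Γ x₀ N)
include h

lemma contMDiffAt {p : ℝ × ℝ} (hp : p ∈ N) :
    ContMDiffAt 𝓘(ℝ, ℝ × ℝ) 𝓘(ℝ, E) ∞ (fun p : ℝ × ℝ ↦ Γ p.1 p.2) p :=
  h.contMDiffOn.contMDiffAt (h.isOpen.mem_nhds hp)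

lemma contMDiffAt_right (hp : (s, t) ∈ N) : ContMDiffAt 𝓘(ℝ, ℝ) 𝓘(ℝ, E) ∞ (Γ s) t :=
  ContMDiffAt.comp (I' := 𝓘(ℝ, ℝ × ℝ)) t (g := fun p : ℝ × ℝ ↦ Γ p.1 p.2)
    (f := fun τ : ℝ ↦ (s, τ)) (h.contMDiffAt hp)
    (contDiffAt_const.prodMk contDiffAt_id : ContDiffAt ℝ ∞ (fun τ : ℝ ↦ (s, τ)) t).contMDiffAt

lemma contMDiffAt_left (hp : (s, t) ∈ N) : ContMDiffAt 𝓘(ℝ, ℝ) 𝓘(ℝ, E) ∞ (fun σ ↦ Γ σ t) s :=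
  ContMDiffAt.comp (I' := 𝓘(ℝ, ℝ × ℝ)) s (g := fun p : ℝ × ℝ ↦ Γ p.1 p.2)
    (f := fun σ : ℝ ↦ (σ, t)) (h.contMDiffAt hp)
    (contDiffAt_id.prodMk contDiffAt_const : ContDiffAt ℝ ∞ (fun σ : ℝ ↦ (σ, t)) s).contMDiffAt

lemma eventually_mem (hp : (s, t) ∈ N) : ∀ᶠ τ in nhds t, (s, τ) ∈ N :=
  (Continuous.prodMk_right s).continuousAt.eventually_mem (h.isOpen.mem_nhds hp)

variable [IsManifold 𝓘(ℝ, E) ∞ M]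

lemma contDiffAt_chartMap {p : ℝ × ℝ} (hp : p ∈ N) :
    ContDiffAt ℝ ∞ (chartMap (E := E) Γ x₀) p :=
  contDiffAt_extChartAt_comp (γ := fun p : ℝ × ℝ ↦ Γ p.1 p.2) (h.contMDiffAt hp) (h.mem_source p hp)

omit [IsManifold 𝓘(ℝ, E) ∞ M] in
lemma chartMap_mem {p : ℝ × ℝ} (hp : p ∈ N) :
    chartMap (E := E) Γ x₀ p ∈ (extChartAt 𝓘(ℝ, E) x₀).target :=
  (extChartAt 𝓘(ℝ, E) x₀).map_source (h.mem_source p hp)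

variable [FiniteDimensional ℝ E]

lemma chartCoord_velocity_right (hp : (s, t) ∈ N) :
    chartCoord x₀ (Γ s t) (velocity 𝓘(ℝ, E) (Γ s) t)
      = fderiv ℝ (chartMap (E := E) Γ x₀) (s, t) (0, 1) :=
  (chartCoord_velocity (h.contMDiffAt_right hp) (h.mem_source _ hp)).trans
    (fderiv_slice_right ((h.contDiffAt_chartMap hp).differentiableAt (by simp)))

lemma chartCoord_velocity_left (hp : (s, t) ∈ N) :
    chartCoord x₀ (Γ s t) (velocity 𝓘(ℝ, E) (fun σ ↦ Γ σ t) s)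
      = fderiv ℝ (chartMap (E := E) Γ x₀) (s, t) (1, 0) :=
  (chartCoord_velocity (h.contMDiffAt_left hp) (h.mem_source _ hp)).trans
    (fderiv_slice_left ((h.contDiffAt_chartMap hp).differentiableAt (by simp)))

variable [RiemannianBundle (fun x : M ↦ TangentSpace 𝓘(ℝ, E) x)]
  [IsContMDiffRiemannianBundle 𝓘(ℝ, E) ∞ E (fun x : M ↦ TangentSpace 𝓘(ℝ, E) x)]

lemma chartCoord_covDerivAlong {V : Π s t, TangentSpace 𝓘(ℝ, E) (Γ s t)} {X : ℝ × ℝ → E}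
    (hX : ∀ p ∈ N, ContDiffAt ℝ ∞ X p)
    (hV : ∀ s t, (s, t) ∈ N → chartCoord x₀ (Γ s t) (V s t) = X (s, t)) (hp : (s, t) ∈ N) :
    chartCoord x₀ (Γ s t) (covDerivAlong 𝓘(ℝ, E) (Γ s) (V s) t)
      = flatCovDeriv (chartConn (E := E) x₀) (chartMap (E := E) Γ x₀) X (s, t) (0, 1) := by
  have e1 : (fun τ ↦ chartCoord x₀ (Γ s τ) (V s τ)) =ᶠ[nhds t] fun τ ↦ X (s, τ) := by
    filter_upwards [h.eventually_mem hp] with τ hτ using hV s τ hτ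
  rw [_root_.chartCoord_covDerivAlong (h.contMDiffAt_right hp) (h.mem_source _ hp)
    ((contDiffAt_slice_right (hX _ hp)).congr_of_eventuallyEq e1),
    flatCovDeriv_congr e1 (Filter.EventuallyEq.refl _ _), flatCovDeriv, flatCovDeriv,
    fderiv_slice_right ((hX _ hp).differentiableAt (by simp))]
  have e2 := fderiv_slice_right ((h.contDiffAt_chartMap hp).differentiableAt (by simp))
  rw [← e2]
  rfl

end IsVariationChart

end Variation

section FirstVariation

variable {E : Type*} [NormedAddCommGroup E] [NormedSpace ℝ E] [FiniteDimensional ℝ E]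
  {M : Type*} [TopologicalSpace M] [ChartedSpace E M] [IsManifold 𝓘(ℝ, E) ∞ M]
  [RiemannianBundle (fun x : M ↦ TangentSpace 𝓘(ℝ, E) x)]
  [IsContMDiffRiemannianBundle 𝓘(ℝ, E) ∞ E (fun x : M ↦ TangentSpace 𝓘(ℝ, E) x)]

/-- The Euler-Lagrange field `∇_T ∇_T τ + R(τ, T)T - κ τ` along a curve. -/
noncomputable def sesquiField (κ : ℝ) (γ : ℝ → M) (t : ℝ) : TangentSpace 𝓘(ℝ, E) (γ t) :=
  covDerivAlong 𝓘(ℝ, E) γ (covDerivAlong 𝓘(ℝ, E) γ (tensionField 𝓘(ℝ, E) γ)) t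
    + riemannCurvature (γ t) (tensionField 𝓘(ℝ, E) γ t) (velocity 𝓘(ℝ, E) γ t)
      (velocity 𝓘(ℝ, E) γ t)
    - κ • tensionField 𝓘(ℝ, E) γ t

/-- The integrand of the sesqui-energy of the curves `Γ s`. -/
noncomputable def sesquiDensity (δ₁ δ₂ : ℝ) (Γ : ℝ → ℝ → M) (p : ℝ × ℝ) : ℝ :=
  δ₁ * ‖velocity 𝓘(ℝ, E) (Γ p.1) p.2‖ ^ 2 + δ₂ * ‖tensionField 𝓘(ℝ, E) (Γ p.1) p.2‖ ^ 2

/-- The variation field `∂_s Γ`, as a field along the curve `Γ s`. -/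
noncomputable def variationField (Γ : ℝ → ℝ → M) (s t : ℝ) : TangentSpace 𝓘(ℝ, E) (Γ s t) :=
  velocity 𝓘(ℝ, E) (fun σ ↦ Γ σ t) s

/-- The boundary term in the first variation formula. -/
noncomputable def sesquiBoundary (δ₁ δ₂ : ℝ) (Γ : ℝ → ℝ → M) (p : ℝ × ℝ) : ℝ :=
  2 * δ₁ * inner ℝ (variationField (E := E) Γ p.1 p.2) (velocity 𝓘(ℝ, E) (Γ p.1) p.2)
    + 2 * δ₂ * (inner ℝ (covDerivAlong 𝓘(ℝ, E) (Γ p.1) (variationField (E := E) Γ p.1) p.2)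
        (tensionField 𝓘(ℝ, E) (Γ p.1) p.2)
      - inner ℝ (variationField (E := E) Γ p.1 p.2)
        (covDerivAlong 𝓘(ℝ, E) (Γ p.1) (tensionField 𝓘(ℝ, E) (Γ p.1)) p.2))

variable {Γ : ℝ → ℝ → M} {x₀ : M} {N : Set (ℝ × ℝ)} {s t : ℝ}

namespace IsVariationChart

variable (h : IsVariationChart (E := E) Γ x₀ N)
include h

lemma chartCoord_tensionField (hp : (s, t) ∈ N) :
    chartCoord x₀ (Γ s t) (tensionField 𝓘(ℝ, E) (Γ s) t)
      = flatTension (chartConn (E := E) x₀) (chartMap (E := E) Γ x₀) (s, t) (0, 1) :=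
  h.chartCoord_covDerivAlong (V := fun s ↦ velocity 𝓘(ℝ, E) (Γ s))
    (X := fun q ↦ fderiv ℝ (chartMap (E := E) Γ x₀) q (0, 1))
    (fun _ hq ↦ contDiffAt_fderiv_apply (h.contDiffAt_chartMap hq) _)
    (fun _ _ hq ↦ h.chartCoord_velocity_right hq) hp

lemma contDiffAt_flatTension {p : ℝ × ℝ} (hp : p ∈ N) :
    ContDiffAt ℝ ∞ (fun q ↦ flatTension (chartConn (E := E) x₀) (chartMap (E := E) Γ x₀) q (0, 1)) p :=
  _root_.contDiffAt_flatTension (isLeviCivitaOn_chartConn (E := E) x₀) (h.chartMap_mem hp)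
    (h.contDiffAt_chartMap hp) _

lemma chartCoord_covDerivAlong_tensionField (hp : (s, t) ∈ N) :
    chartCoord x₀ (Γ s t) (covDerivAlong 𝓘(ℝ, E) (Γ s) (tensionField 𝓘(ℝ, E) (Γ s)) t)
      = flatCovDeriv (chartConn (E := E) x₀) (chartMap (E := E) Γ x₀)
        (fun q ↦ flatTension (chartConn (E := E) x₀) (chartMap (E := E) Γ x₀) q (0, 1)) (s, t) (0, 1) :=
  h.chartCoord_covDerivAlong (V := fun s ↦ tensionField 𝓘(ℝ, E) (Γ s))
    (fun _ hq ↦ h.contDiffAt_flatTension hq) (fun _ _ hq ↦ h.chartCoord_tensionField hq) hp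

lemma chartCoord_covDerivAlong_variationField (hp : (s, t) ∈ N) :
    chartCoord x₀ (Γ s t) (covDerivAlong 𝓘(ℝ, E) (Γ s) (variationField Γ s) t)
      = flatCovDeriv (chartConn (E := E) x₀) (chartMap (E := E) Γ x₀)
        (fun q ↦ fderiv ℝ (chartMap (E := E) Γ x₀) q (1, 0)) (s, t) (0, 1) :=
  h.chartCoord_covDerivAlong (V := fun s ↦ variationField Γ s)
    (fun _ hq ↦ contDiffAt_fderiv_apply (h.contDiffAt_chartMap hq) _)
    (fun _ _ hq ↦ h.chartCoord_velocity_left hq) hp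

lemma sesquiDensity_eq {δ₁ δ₂ : ℝ} {p : ℝ × ℝ} (hp : p ∈ N) :
    sesquiDensity (E := E) δ₁ δ₂ Γ p
      = δ₁ * chartMetric (E := E) x₀ (chartMap (E := E) Γ x₀ p) (fderiv ℝ (chartMap (E := E) Γ x₀) p (0, 1))
          (fderiv ℝ (chartMap (E := E) Γ x₀) p (0, 1))
        + δ₂ * chartMetric (E := E) x₀ (chartMap (E := E) Γ x₀ p)
          (flatTension (chartConn (E := E) x₀) (chartMap (E := E) Γ x₀) p (0, 1))
          (flatTension (chartConn (E := E) x₀) (chartMap (E := E) Γ x₀) p (0, 1)) := by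
  obtain ⟨s, t⟩ := p
  have hx := h.mem_source _ hp
  simp only [sesquiDensity]
  rw [← real_inner_self_eq_norm_sq, ← real_inner_self_eq_norm_sq, inner_eq_chartMetric hx,
    inner_eq_chartMetric hx, h.chartCoord_velocity_right hp, h.chartCoord_tensionField hp]
  rfl

lemma sesquiBoundary_eq {δ₁ δ₂ : ℝ} {p : ℝ × ℝ} (hp : p ∈ N) :
    sesquiBoundary (E := E) δ₁ δ₂ Γ p
      = 2 * δ₁ * chartMetric (E := E) x₀ (chartMap (E := E) Γ x₀ p) (fderiv ℝ (chartMap (E := E) Γ x₀) p (1, 0))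
          (fderiv ℝ (chartMap (E := E) Γ x₀) p (0, 1))
        + 2 * δ₂ * (chartMetric (E := E) x₀ (chartMap (E := E) Γ x₀ p)
            (flatCovDeriv (chartConn (E := E) x₀) (chartMap (E := E) Γ x₀)
              (fun q ↦ fderiv ℝ (chartMap (E := E) Γ x₀) q (1, 0)) p (0, 1))
            (flatTension (chartConn (E := E) x₀) (chartMap (E := E) Γ x₀) p (0, 1))
          - chartMetric (E := E) x₀ (chartMap (E := E) Γ x₀ p) (fderiv ℝ (chartMap (E := E) Γ x₀) p (1, 0))
            (flatCovDeriv (chartConn (E := E) x₀) (chartMap (E := E) Γ x₀)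
              (fun q ↦ flatTension (chartConn (E := E) x₀) (chartMap (E := E) Γ x₀) q (0, 1)) p (0, 1))) := by
  obtain ⟨s, t⟩ := p
  have hx := h.mem_source _ hp
  simp only [sesquiBoundary]
  rw [inner_eq_chartMetric hx, inner_eq_chartMetric hx, inner_eq_chartMetric hx,
    h.chartCoord_velocity_right hp, h.chartCoord_tensionField hp,
    h.chartCoord_covDerivAlong_tensionField hp, h.chartCoord_covDerivAlong_variationField hp,
    variationField, h.chartCoord_velocity_left hp]
  rfl

lemma chartCoord_sesquiField {κ : ℝ} (hx : Γ s t = x₀) (hp : (s, t) ∈ N) :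
    chartCoord x₀ (Γ s t) (sesquiField κ (Γ s) t)
      = flatSesqui (chartConn (E := E) x₀) κ (chartMap (E := E) Γ x₀) (s, t) (0, 1) := by
  have h3 : chartCoord x₀ (Γ s t) (covDerivAlong 𝓘(ℝ, E) (Γ s)
      (covDerivAlong 𝓘(ℝ, E) (Γ s) (tensionField 𝓘(ℝ, E) (Γ s))) t) = _ :=
    h.chartCoord_covDerivAlong
      (V := fun s ↦ covDerivAlong 𝓘(ℝ, E) (Γ s) (tensionField 𝓘(ℝ, E) (Γ s)))
      (fun _ hq ↦ contDiffAt_flatCovDeriv (isLeviCivitaOn_chartConn (E := E) x₀) (h.chartMap_mem hq)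
        (h.contDiffAt_chartMap hq) (h.contDiffAt_flatTension hq) (0, 1))
      (fun _ _ hq ↦ h.chartCoord_covDerivAlong_tensionField hq) hp
  have h4 := h.chartCoord_tensionField hp
  have h5 := h.chartCoord_velocity_right hp
  subst hx
  rw [sesquiField, map_sub, map_add, map_smul, h3, chartCoord_riemannCurvature, h4, h5]
  rfl

end IsVariationChart

variable {D : Set (ℝ × ℝ)} (hD : IsOpen D)
  (hΓ : ContMDiffOn 𝓘(ℝ, ℝ × ℝ) 𝓘(ℝ, E) ∞ (fun p : ℝ × ℝ ↦ Γ p.1 p.2) D)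
include hD hΓ

lemma contDiffAt_sesquiDensity (δ₁ δ₂ : ℝ) {p : ℝ × ℝ} (hp : p ∈ D) :
    ContDiffAt ℝ ∞ (sesquiDensity (E := E) δ₁ δ₂ Γ) p := by
  obtain ⟨N, -, hpN, h⟩ := exists_isVariationChart hD hΓ hp
  have hLC := isLeviCivitaOn_chartConn (E := E) (Γ p.1 p.2)
  have hu := h.contDiffAt_chartMap hpN
  have hT := contDiffAt_fderiv_apply hu (0, 1)
  have hτ := h.contDiffAt_flatTension hpN
  refine (((contDiffAt_const (c := δ₁)).mul
      (contDiffAt_metric_apply hLC (h.chartMap_mem hpN) hu hT hT)).add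
      ((contDiffAt_const (c := δ₂)).mul
      (contDiffAt_metric_apply hLC (h.chartMap_mem hpN) hu hτ hτ))).congr_of_eventuallyEq ?_
  filter_upwards [h.isOpen.mem_nhds hpN] with q hq using h.sesquiDensity_eq hq

lemma contDiffAt_sesquiBoundary (δ₁ δ₂ : ℝ) {p : ℝ × ℝ} (hp : p ∈ D) :
    ContDiffAt ℝ ∞ (sesquiBoundary (E := E) δ₁ δ₂ Γ) p := by
  obtain ⟨N, -, hpN, h⟩ := exists_isVariationChart hD hΓ hp
  have hLC := isLeviCivitaOn_chartConn (E := E) (Γ p.1 p.2)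
  have hu := h.contDiffAt_chartMap hpN
  have hS := contDiffAt_fderiv_apply hu (1, 0)
  have hT := contDiffAt_fderiv_apply hu (0, 1)
  have hτ := h.contDiffAt_flatTension hpN
  have hy := h.chartMap_mem hpN
  refine (((contDiffAt_const (c := 2 * δ₁)).mul (contDiffAt_metric_apply hLC hy hu hS hT)).add
    ((contDiffAt_const (c := 2 * δ₂)).mul ((contDiffAt_metric_apply hLC hy hu
      (contDiffAt_flatCovDeriv hLC hy hu hS (0, 1)) hτ).sub
      (contDiffAt_metric_apply hLC hy hu hS
        (contDiffAt_flatCovDeriv hLC hy hu hτ (0, 1)))))).congr_of_eventuallyEq ?_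
  filter_upwards [h.isOpen.mem_nhds hpN] with q hq using h.sesquiBoundary_eq hq

/-- The pointwise first variation formula. -/
theorem fderiv_sesquiDensity {δ₁ δ₂ : ℝ} (hδ₂ : δ₂ ≠ 0) (hp : (s, t) ∈ D) :
    fderiv ℝ (sesquiDensity (E := E) δ₁ δ₂ Γ) (s, t) (1, 0)
      = fderiv ℝ (sesquiBoundary (E := E) δ₁ δ₂ Γ) (s, t) (0, 1)
        + 2 * δ₂ * inner ℝ (variationField (E := E) Γ s t) (sesquiField (δ₁ / δ₂) (Γ s) t) := by
  obtain ⟨N, -, hpN, h⟩ := exists_isVariationChart hD hΓ hp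
  simp only at h
  have hLC := isLeviCivitaOn_chartConn (E := E) (Γ s t)
  have hu := h.contDiffAt_chartMap hpN
  have hS := contDiffAt_fderiv_apply hu (1, 0)
  have hT := contDiffAt_fderiv_apply hu (0, 1)
  have hτ := h.contDiffAt_flatTension hpN
  have hy := h.chartMap_mem hpN
  have hn : (∞ : WithTop ℕ∞) ≠ 0 := by simp
  have d1 := (contDiffAt_metric_apply hLC hy hu hT hT).differentiableAt hn
  have d2 := (contDiffAt_metric_apply hLC hy hu hτ hτ).differentiableAt hn
  have d3 := (contDiffAt_metric_apply hLC hy hu hS hT).differentiableAt hn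
  have d4 := (contDiffAt_metric_apply hLC hy hu
      (contDiffAt_flatCovDeriv hLC hy hu hS (0, 1)) hτ).sub
      (contDiffAt_metric_apply hLC hy hu hS
        (contDiffAt_flatCovDeriv hLC hy hu hτ (0, 1))) |>.differentiableAt hn
  have e1 := Filter.eventuallyEq_of_mem (h.isOpen.mem_nhds hpN)
    fun q hq ↦ h.sesquiDensity_eq (δ₁ := δ₁) (δ₂ := δ₂) hq
  have e2 := Filter.eventuallyEq_of_mem (h.isOpen.mem_nhds hpN)
    fun q hq ↦ h.sesquiBoundary_eq (δ₁ := δ₁) (δ₂ := δ₂) hq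
  rw [e1.fderiv_eq, e2.fderiv_eq, ((d1.hasFDerivAt.const_mul δ₁).fun_add
    (d2.hasFDerivAt.const_mul δ₂)).fderiv, ((d3.hasFDerivAt.const_mul (2 * δ₁)).fun_add
    (d4.hasFDerivAt.const_mul (2 * δ₂))).fderiv]
  simp only [_root_.add_apply, _root_.smul_apply, smul_eq_mul]
  rw [flat_first_variation_energy hLC hy hu, flat_first_variation_bienergy hLC hy hu,
    inner_eq_chartMetric (h.mem_source _ hpN), h.chartCoord_sesquiField rfl hpN, variationField,
    h.chartCoord_velocity_left hpN, flatSesqui, map_sub, map_smul, smul_eq_mul]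
  simp only [chartMap]
  field_simp
  ring

end FirstVariation

section ParametricIntegral

open MeasureTheory Set

variable {f : ℝ × ℝ → ℝ} {D : Set (ℝ × ℝ)} {a b : ℝ}

lemma continuousOn_slice_right (hf : ∀ p ∈ D, ContDiffAt ℝ ∞ f p) {s : ℝ}
    (hs : ∀ t ∈ Icc a b, (s, t) ∈ D) : ContinuousOn (fun t ↦ f (s, t)) (Icc a b) := fun t ht ↦
  (contDiffAt_slice_right (hf _ (hs t ht))).continuousAt.continuousWithinAt

lemma contDiffAt_fderiv_of_forall (hf : ∀ p ∈ D, ContDiffAt ℝ ∞ f p) (v : ℝ × ℝ) :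
    ∀ p ∈ D, ContDiffAt ℝ ∞ (fun q ↦ fderiv ℝ f q v) p := fun p hp ↦
  contDiffAt_fderiv_apply (hf p hp) v

lemma hasDerivAt_integral_of_contDiffAt (hab : a ≤ b) {ε : ℝ} (hε : 0 < ε)
    (hf : ∀ p ∈ Ioo (-ε) ε ×ˢ Icc a b, ContDiffAt ℝ ∞ f p) :
    HasDerivAt (fun s ↦ ∫ t in a..b, f (s, t)) (∫ t in a..b, fderiv ℝ f (0, t) (1, 0)) 0 := by
  have hf' := contDiffAt_fderiv_of_forall hf (1, 0)
  have hsub : Icc (-(ε / 2)) (ε / 2) ×ˢ Icc a b ⊆ Ioo (-ε) ε ×ˢ Icc a b :=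
    prod_mono (fun s hs ↦ ⟨by linarith [hs.1], by linarith [hs.2]⟩) le_rfl
  obtain ⟨K, hK⟩ := (isCompact_Icc.prod isCompact_Icc).exists_bound_of_continuousOn
    (fun p hp ↦ (hf' p (hsub hp)).continuousAt.continuousWithinAt)
  have hIoc : uIoc a b ⊆ Icc a b := by rw [uIoc_of_le hab]; exact Ioc_subset_Icc_self
  have h0 : (0 : ℝ) ∈ Ioo (-ε) ε := ⟨by linarith, hε⟩
  have hmeas : ∀ {g : ℝ → ℝ}, ContinuousOn g (Icc a b) →
      AEStronglyMeasurable g (volume.restrict (uIoc a b)) := fun hg ↦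
    (hg.mono hIoc).aestronglyMeasurable measurableSet_uIoc
  refine (intervalIntegral.hasDerivAt_integral_of_dominated_loc_of_deriv_le
    (F := fun s t ↦ f (s, t)) (F' := fun s t ↦ fderiv ℝ f (s, t) (1, 0)) (bound := fun _ ↦ K)
    (s := Icc (-(ε / 2)) (ε / 2)) (Icc_mem_nhds (by linarith) (by linarith)) ?_ ?_ ?_ ?_ ?_ ?_).2
  · filter_upwards [Ioo_mem_nhds h0.1 h0.2] with s hs
    exact hmeas (continuousOn_slice_right hf fun t ht ↦ ⟨hs, ht⟩)
  · refine ContinuousOn.intervalIntegrable ?_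
    rw [uIcc_of_le hab]
    exact continuousOn_slice_right hf fun t ht ↦ ⟨h0, ht⟩
  · exact hmeas (continuousOn_slice_right hf' fun t ht ↦ ⟨h0, ht⟩)
  · exact .of_forall fun t ht s hs ↦ hK (s, t) ⟨hs, hIoc ht⟩
  · exact intervalIntegrable_const
  · refine .of_forall fun t ht s hs ↦ ?_
    have hd : DifferentiableAt ℝ f (s, t) :=
      (hf _ (hsub ⟨hs, hIoc ht⟩)).differentiableAt (by simp)
    rw [← fderiv_slice_left hd, fderiv_apply_one_eq_deriv]
    exact (HasFDerivAt.comp (g := f) (f := fun σ : ℝ ↦ (σ, t)) s hd.hasFDerivAt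
      (hasFDerivAt_prodMk_left s t)).differentiableAt.hasDerivAt

lemma fderiv_eq_zero_of_eventually_eq_zero {E : Type*} [NormedAddCommGroup E] [NormedSpace ℝ E]
    {g : ℝ → E} {t : ℝ} {K : Set ℝ} (hK : UniqueDiffWithinAt ℝ K t) (ht : t ∈ K)
    (hd : DifferentiableAt ℝ g t) (hg : ∀ᶠ τ in nhdsWithin t K, g τ = 0) : fderiv ℝ g t = 0 :=
  hK.eq hd.hasFDerivAt.hasFDerivWithinAt
    ((hasFDerivWithinAt_const (0 : E) t K).congr_of_eventuallyEq hg (hg.self_of_nhdsWithin ht))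

end ParametricIntegral

section EnergyDerivative

open Set

variable {E : Type*} [NormedAddCommGroup E] [NormedSpace ℝ E] [FiniteDimensional ℝ E]
  {M : Type*} [TopologicalSpace M] [ChartedSpace E M] [IsManifold 𝓘(ℝ, E) ∞ M]
  [RiemannianBundle (fun x : M ↦ TangentSpace 𝓘(ℝ, E) x)]
  [IsContMDiffRiemannianBundle 𝓘(ℝ, E) ∞ E (fun x : M ↦ TangentSpace 𝓘(ℝ, E) x)]
  {Γ : ℝ → ℝ → M}

lemma sesquiBoundary_eq_zero {D : Set (ℝ × ℝ)} (hD : IsOpen D)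
    (hΓ : ContMDiffOn 𝓘(ℝ, ℝ × ℝ) 𝓘(ℝ, E) ∞ (fun p : ℝ × ℝ ↦ Γ p.1 p.2) D) (δ₁ δ₂ : ℝ) {t : ℝ}
    (hp : (0, t) ∈ D) {K : Set ℝ} (hK : UniqueDiffWithinAt ℝ K t) (ht : t ∈ K)
    (hfix : ∀ᶠ τ in nhdsWithin t K, ∀ᶠ σ in nhds 0, Γ σ τ = Γ 0 τ) :
    sesquiBoundary (E := E) δ₁ δ₂ Γ (0, t) = 0 := by
  obtain ⟨N, -, hpN, h⟩ := exists_isVariationChart hD hΓ hp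
  simp only at h
  have hX : ∀ᶠ τ in nhdsWithin t K,
      fderiv ℝ (chartMap (E := E) Γ (Γ 0 t)) (0, τ) (1, 0) = 0 := by
    filter_upwards [hfix, nhdsWithin_le_nhds (h.eventually_mem hpN)] with τ hτ hN
    rw [← fderiv_slice_left ((h.contDiffAt_chartMap hN).differentiableAt (by simp))]
    have e : (fun σ ↦ chartMap (E := E) Γ (Γ 0 t) (σ, τ))
        =ᶠ[nhds 0] fun _ ↦ chartMap (E := E) Γ (Γ 0 t) (0, τ) := by
      filter_upwards [hτ] with σ hσ
      simp only [chartMap, hσ]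
    rw [e.fderiv_eq]
    simp
  have hS := contDiffAt_fderiv_apply (h.contDiffAt_chartMap hpN) (1, 0)
  have h1 := hX.self_of_nhdsWithin ht
  have h2 : fderiv ℝ (fun q ↦ fderiv ℝ (chartMap (E := E) Γ (Γ 0 t)) q (1, 0)) (0, t) (0, 1)
      = 0 := by
    rw [← fderiv_slice_right (hS.differentiableAt (by simp)),
      fderiv_eq_zero_of_eventually_eq_zero hK ht
        ((contDiffAt_slice_right hS).differentiableAt (by simp)) hX]
    simp
  rw [h.sesquiBoundary_eq hpN, flatCovDeriv, h1, h2]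
  simp

/-- The first variation formula for the sesqui-energy. -/
theorem hasDerivAt_sesquiEnergy {δ₁ δ₂ a b ε : ℝ} {J : Set ℝ} (hδ₂ : δ₂ ≠ 0) (hJ : IsOpen J)
    (hab : a < b) (hIcc : Icc a b ⊆ J) (hε : 0 < ε)
    (hΓ : ContMDiffOn 𝓘(ℝ, ℝ × ℝ) 𝓘(ℝ, E) ∞ (fun p : ℝ × ℝ ↦ Γ p.1 p.2) (Ioo (-ε) ε ×ˢ J))
    (hfix : ∀ s ∈ Ioo (-ε) ε, ∀ t ∈ J, t ∉ Ioo a b → Γ s t = Γ 0 t) :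
    HasDerivAt (fun s ↦ sesquiEnergy 𝓘(ℝ, E) δ₁ δ₂ a b (Γ s))
      (∫ t in a..b, 2 * δ₂ * inner ℝ (variationField (E := E) Γ 0 t)
        (sesquiField (δ₁ / δ₂) (Γ 0) t)) 0 := by
  have hD : IsOpen (Ioo (-ε) ε ×ˢ J) := isOpen_Ioo.prod hJ
  have h0 : (0 : ℝ) ∈ Ioo (-ε) ε := ⟨by linarith, hε⟩
  have hsub : Ioo (-ε) ε ×ˢ Icc a b ⊆ Ioo (-ε) ε ×ˢ J := prod_mono le_rfl hIcc
  have hf : ∀ δ₁ δ₂ : ℝ, ∀ p ∈ Ioo (-ε) ε ×ˢ Icc a b,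
      ContDiffAt ℝ ∞ (sesquiDensity (E := E) δ₁ δ₂ Γ) p := fun _ _ p hp ↦
    contDiffAt_sesquiDensity hD hΓ _ _ (hsub hp)
  have hB : ∀ p ∈ Ioo (-ε) ε ×ˢ Icc a b,
      ContDiffAt ℝ ∞ (sesquiBoundary (E := E) δ₁ δ₂ Γ) p := fun p hp ↦
    contDiffAt_sesquiBoundary hD hΓ _ _ (hsub hp)
  have hint : ∀ {f : ℝ × ℝ → ℝ} {s : ℝ}, s ∈ Ioo (-ε) ε →
      (∀ p ∈ Ioo (-ε) ε ×ˢ Icc a b, ContDiffAt ℝ ∞ f p) →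
      IntervalIntegrable (fun t ↦ f (s, t)) MeasureTheory.volume a b := by
    intro f s hs hf
    refine ContinuousOn.intervalIntegrable ?_
    rw [uIcc_of_le hab.le]
    exact continuousOn_slice_right hf fun t ht ↦ ⟨hs, ht⟩
  have hE : (fun s ↦ sesquiEnergy 𝓘(ℝ, E) δ₁ δ₂ a b (Γ s))
      =ᶠ[nhds 0] fun s ↦ ∫ t in a..b, sesquiDensity (E := E) δ₁ δ₂ Γ (s, t) := by
    filter_upwards [Ioo_mem_nhds h0.1 h0.2] with s hs
    have i1 := hint hs (hf 1 0)
    have i2 := hint hs (hf 0 1)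
    simp only [sesquiDensity, one_mul, zero_mul, add_zero, zero_add] at i1 i2
    rw [sesquiEnergy, ← intervalIntegral.integral_const_mul, ← intervalIntegral.integral_const_mul,
      ← intervalIntegral.integral_add (i1.const_mul δ₁) (i2.const_mul δ₂)]
    rfl
  refine ((hasDerivAt_integral_of_contDiffAt hab.le hε (hf δ₁ δ₂)).congr_of_eventuallyEq
    hE).congr_deriv ?_
  have hBz : ∀ {t : ℝ} {K : Set ℝ}, t ∈ J → UniqueDiffWithinAt ℝ K t → t ∈ K →
      (∀ τ ∈ K, τ ∉ Ioo a b) → sesquiBoundary (E := E) δ₁ δ₂ Γ (0, t) = 0 := by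
    intro t K htJ hK ht hKab
    refine sesquiBoundary_eq_zero hD hΓ δ₁ δ₂ ⟨h0, htJ⟩ hK ht ?_
    filter_upwards [self_mem_nhdsWithin, nhdsWithin_le_nhds (hJ.mem_nhds htJ)] with τ hτ hτJ
    filter_upwards [Ioo_mem_nhds h0.1 h0.2] with σ hσ
    exact hfix σ hσ τ hτJ (hKab τ hτ)
  have hFTC : ∫ t in a..b, fderiv ℝ (sesquiBoundary (E := E) δ₁ δ₂ Γ) (0, t) (0, 1) = 0 := by
    rw [intervalIntegral.integral_eq_sub_of_hasDerivAt
      (f := fun t ↦ sesquiBoundary (E := E) δ₁ δ₂ Γ (0, t)),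
      hBz (hIcc (right_mem_Icc.2 hab.le)) (uniqueDiffWithinAt_Ici b) self_mem_Ici
        (fun τ hτ h ↦ not_lt.2 hτ h.2),
      hBz (hIcc (left_mem_Icc.2 hab.le)) (uniqueDiffWithinAt_Iic a) self_mem_Iic
        (fun τ hτ h ↦ not_lt.2 hτ h.1), sub_zero]
    · intro t ht
      rw [uIcc_of_le hab.le] at ht
      have hc := hB (0, t) ⟨h0, ht⟩
      rw [← fderiv_slice_right (hc.differentiableAt (by simp)), fderiv_apply_one_eq_deriv]
      exact ((contDiffAt_slice_right hc).differentiableAt (by simp)).hasDerivAt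
    · exact hint h0 (contDiffAt_fderiv_of_forall hB (0, 1))
  have hsplit := intervalIntegral.integral_sub
    (hint h0 (contDiffAt_fderiv_of_forall (hf δ₁ δ₂) (1, 0)))
    (hint h0 (contDiffAt_fderiv_of_forall hB (0, 1)))
  rw [hFTC, sub_zero] at hsplit
  rw [← hsplit]
  refine intervalIntegral.integral_congr fun t ht ↦ ?_
  rw [uIcc_of_le hab.le] at ht
  rw [fderiv_sesquiDensity hD hΓ hδ₂ ⟨h0, hIcc ht⟩]
  ring

end EnergyDerivative

section ChartVariation

open Set

variable {E : Type*} [NormedAddCommGroup E] [NormedSpace ℝ E]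
  {M : Type*} [TopologicalSpace M] [ChartedSpace E M]
  {γ : ℝ → M} {x₀ : M} {f : ℝ → ℝ} {w : E} {s t : ℝ}

open Classical in
/-- The variation of `γ` that, in the chart centred at `x₀`, moves `γ t` along the segment in the
direction `f t • w`. -/
noncomputable def chartVariation (γ : ℝ → M) (x₀ : M) (f : ℝ → ℝ) (w : E) (s t : ℝ) : M :=
  if γ t ∈ (extChartAt 𝓘(ℝ, E) x₀).source then
    (extChartAt 𝓘(ℝ, E) x₀).symm (extChartAt 𝓘(ℝ, E) x₀ (γ t) + (s * f t) • w)
  else γ t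

lemma chartVariation_of_mem (ht : γ t ∈ (extChartAt 𝓘(ℝ, E) x₀).source) :
    chartVariation γ x₀ f w s t =
      (extChartAt 𝓘(ℝ, E) x₀).symm (extChartAt 𝓘(ℝ, E) x₀ (γ t) + (s * f t) • w) :=
  if_pos ht

lemma chartVariation_of_mul_eq_zero (h : s * f t = 0) : chartVariation γ x₀ f w s t = γ t := by
  by_cases ht : γ t ∈ (extChartAt 𝓘(ℝ, E) x₀).source
  · rw [chartVariation_of_mem ht, h, zero_smul, add_zero, (extChartAt 𝓘(ℝ, E) x₀).left_inv ht]
  · exact if_neg ht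

lemma chartVariation_zero : chartVariation γ x₀ f w 0 = γ :=
  funext fun _ ↦ chartVariation_of_mul_eq_zero (zero_mul _)

variable [IsManifold 𝓘(ℝ, E) ∞ M]

lemma contMDiffAt_chartVariation (hf : ContDiff ℝ ∞ f) (hγ : ContMDiffAt 𝓘(ℝ, ℝ) 𝓘(ℝ, E) ∞ γ t)
    (ht : γ t ∈ (extChartAt 𝓘(ℝ, E) x₀).source)
    (hs : extChartAt 𝓘(ℝ, E) x₀ (γ t) + (s * f t) • w ∈ (extChartAt 𝓘(ℝ, E) x₀).target) :
    ContMDiffAt 𝓘(ℝ, ℝ × ℝ) 𝓘(ℝ, E) ∞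
      (fun p : ℝ × ℝ ↦ chartVariation γ x₀ f w p.1 p.2) (s, t) := by
  have h1 : ContDiffAt ℝ ∞ (fun p : ℝ × ℝ ↦ extChartAt 𝓘(ℝ, E) x₀ (γ p.2) + (p.1 * f p.2) • w)
      (s, t) :=
    (ContDiffAt.comp (g := fun τ ↦ extChartAt 𝓘(ℝ, E) x₀ (γ τ)) (f := Prod.snd) (s, t)
      (contDiffAt_extChartAt_comp hγ ht) contDiffAt_snd).add
      ((contDiffAt_fst.mul (hf.contDiffAt.comp (s, t) contDiffAt_snd)).smul contDiffAt_const)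
  have h2 : ContMDiffAt 𝓘(ℝ, E) 𝓘(ℝ, E) ∞ (extChartAt 𝓘(ℝ, E) x₀).symm
      (extChartAt 𝓘(ℝ, E) x₀ (γ t) + (s * f t) • w) :=
    (contMDiffOn_extChartAt_symm x₀).contMDiffAt ((isOpen_extChartAt_target x₀).mem_nhds hs)
  refine (ContMDiffAt.comp (s, t) (g := (extChartAt 𝓘(ℝ, E) x₀).symm) h2
    h1.contMDiffAt).congr_of_eventuallyEq ?_
  have h3 : ∀ᶠ p : ℝ × ℝ in nhds (s, t), γ p.2 ∈ (extChartAt 𝓘(ℝ, E) x₀).source :=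
    continuousAt_snd.eventually (eventually_mem_source hγ.continuousAt ht)
  filter_upwards [h3] with p hp using chartVariation_of_mem hp

omit [IsManifold 𝓘(ℝ, E) ∞ M] in
lemma contMDiffAt_chartVariation_of_eventually_eq_zero
    (hγ : ContMDiffAt 𝓘(ℝ, ℝ) 𝓘(ℝ, E) ∞ γ t) (hf : ∀ᶠ τ in nhds t, f τ = 0) :
    ContMDiffAt 𝓘(ℝ, ℝ × ℝ) 𝓘(ℝ, E) ∞
      (fun p : ℝ × ℝ ↦ chartVariation γ x₀ f w p.1 p.2) (s, t) := by
  have h1 : ContMDiffAt 𝓘(ℝ, ℝ × ℝ) 𝓘(ℝ, E) ∞ (fun p : ℝ × ℝ ↦ γ p.2) (s, t) :=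
    ContMDiffAt.comp (I' := 𝓘(ℝ, ℝ)) (s, t) (g := γ) (f := Prod.snd) hγ
      (contDiffAt_snd : ContDiffAt ℝ ∞ Prod.snd (s, t)).contMDiffAt
  refine h1.congr_of_eventuallyEq ?_
  filter_upwards [continuousAt_snd.eventually hf] with p hp
  exact chartVariation_of_mul_eq_zero (by rw [hp, mul_zero])

variable [FiniteDimensional ℝ E]

lemma chartCoord_variationField_chartVariation {N : Set (ℝ × ℝ)}
    (h : IsVariationChart (E := E) (chartVariation γ x₀ f w) x₀ N) (hN : (0, t) ∈ N)
    (ht : γ t ∈ (extChartAt 𝓘(ℝ, E) x₀).source) :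
    chartCoord x₀ (chartVariation γ x₀ f w 0 t) (variationField (chartVariation γ x₀ f w) 0 t)
      = f t • w := by
  have h1 := h.chartCoord_velocity_left hN
  refine h1.trans ?_
  rw [← fderiv_slice_left ((h.contDiffAt_chartMap hN).differentiableAt (by simp))]
  have hc : ContinuousAt (fun σ : ℝ ↦ extChartAt 𝓘(ℝ, E) x₀ (γ t) + (σ * f t) • w) 0 := by
    fun_prop
  have h2 : ∀ᶠ σ in nhds (0 : ℝ),
      extChartAt 𝓘(ℝ, E) x₀ (γ t) + (σ * f t) • w ∈ (extChartAt 𝓘(ℝ, E) x₀).target := by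
    refine hc.eventually_mem ((isOpen_extChartAt_target x₀).mem_nhds ?_)
    simpa using (extChartAt 𝓘(ℝ, E) x₀).map_source ht
  have e : (fun σ ↦ chartMap (E := E) (chartVariation γ x₀ f w) x₀ (σ, t))
      =ᶠ[nhds 0] fun σ ↦ extChartAt 𝓘(ℝ, E) x₀ (γ t) + (σ * f t) • w := by
    filter_upwards [h2] with σ hσ
    simp only [chartMap]
    rw [chartVariation_of_mem ht, (extChartAt 𝓘(ℝ, E) x₀).right_inv hσ]
  rw [e.fderiv_eq, fderiv_apply_one_eq_deriv]
  have hd : HasDerivAt (fun σ : ℝ ↦ extChartAt 𝓘(ℝ, E) x₀ (γ t) + (σ * f t) • w)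
      ((1 * f t) • w) 0 :=
    (((hasDerivAt_id (0 : ℝ)).mul_const (f t)).smul_const w).const_add _
  rw [hd.deriv, one_mul]

end ChartVariation

section EulerLagrange

open Set

variable {E : Type*} [NormedAddCommGroup E] [NormedSpace ℝ E] [FiniteDimensional ℝ E]
  {M : Type*} [TopologicalSpace M] [ChartedSpace E M] [IsManifold 𝓘(ℝ, E) ∞ M]
  [RiemannianBundle (fun x : M ↦ TangentSpace 𝓘(ℝ, E) x)]
  [IsContMDiffRiemannianBundle 𝓘(ℝ, E) ∞ E (fun x : M ↦ TangentSpace 𝓘(ℝ, E) x)]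
  {Γ : ℝ → ℝ → M} {γ γ' : ℝ → M} {s t κ : ℝ} {J : Set ℝ}

lemma continuousAt_inner_sesquiField {D : Set (ℝ × ℝ)} (hD : IsOpen D)
    (hΓ : ContMDiffOn 𝓘(ℝ, ℝ × ℝ) 𝓘(ℝ, E) ∞ (fun p : ℝ × ℝ ↦ Γ p.1 p.2) D) (κ : ℝ)
    (hp : (s, t) ∈ D) :
    ContinuousAt (fun τ ↦ inner ℝ (variationField (E := E) Γ s τ) (sesquiField κ (Γ s) τ)) t := by
  have h1 := contDiffAt_slice_right (contDiffAt_fderiv_of_forall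
    (fun p hp ↦ contDiffAt_sesquiDensity (E := E) hD hΓ κ 1 hp) (1, 0) _ hp)
  have h2 := contDiffAt_slice_right (contDiffAt_fderiv_of_forall
    (fun p hp ↦ contDiffAt_sesquiBoundary (E := E) hD hΓ κ 1 hp) (0, 1) _ hp)
  refine ((h1.continuousAt.sub h2.continuousAt).div_const 2).congr ?_
  filter_upwards [(Continuous.prodMk_right s).continuousAt.eventually_mem (hD.mem_nhds hp)]
    with τ hτ
  have h3 := fderiv_sesquiDensity (E := E) (δ₁ := κ) hD hΓ one_ne_zero hτ
  rw [div_one] at h3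
  simp only [Pi.sub_apply, h3]
  ring

omit [FiniteDimensional ℝ E] [IsManifold 𝓘(ℝ, E) ∞ M]
  [RiemannianBundle (fun x : M ↦ TangentSpace 𝓘(ℝ, E) x)]
  [IsContMDiffRiemannianBundle 𝓘(ℝ, E) ∞ E (fun x : M ↦ TangentSpace 𝓘(ℝ, E) x)] in
lemma contMDiffOn_const_variation (hγ : ContMDiffOn 𝓘(ℝ, ℝ) 𝓘(ℝ, E) ∞ γ J) :
    ContMDiffOn 𝓘(ℝ, ℝ × ℝ) 𝓘(ℝ, E) ∞ (fun p : ℝ × ℝ ↦ (fun _ ↦ γ : ℝ → ℝ → M) p.1 p.2)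
      (univ ×ˢ J) :=
  ContMDiffOn.comp (I' := 𝓘(ℝ, ℝ)) (g := γ) (f := Prod.snd) hγ
    (contDiff_snd : ContDiff ℝ ∞ (Prod.snd : ℝ × ℝ → ℝ)).contMDiff.contMDiffOn fun _ hp ↦ hp.2

lemma sesquiField_eq_zero_congr (hJ : IsOpen J) (hγ : ContMDiffOn 𝓘(ℝ, ℝ) 𝓘(ℝ, E) ∞ γ J)
    (hγ' : ContMDiffOn 𝓘(ℝ, ℝ) 𝓘(ℝ, E) ∞ γ' J) (heq : ∀ t ∈ J, γ t = γ' t) (ht : t ∈ J)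
    (h0 : sesquiField (E := E) κ γ t = 0) : sesquiField (E := E) κ γ' t = 0 := by
  have hD : IsOpen ((univ : Set ℝ) ×ˢ J) := isOpen_univ.prod hJ
  have hp : ((0 : ℝ), t) ∈ (univ : Set ℝ) ×ˢ J := ⟨trivial, ht⟩
  obtain ⟨N, -, hpN, h⟩ := exists_isVariationChart (E := E) (Γ := fun _ ↦ γ) hD
    (contMDiffOn_const_variation hγ) hp
  obtain ⟨N', -, hpN', h'⟩ := exists_isVariationChart (E := E) (Γ := fun _ ↦ γ') hD
    (contMDiffOn_const_variation hγ') hp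
  simp only at h h'
  rw [← heq t ht] at h'
  have e1 := h.chartCoord_sesquiField (κ := κ) rfl hpN
  have e2 := h'.chartCoord_sesquiField (κ := κ) (heq t ht).symm hpN'
  have e3 : chartMap (E := E) (fun _ ↦ γ') (γ t) =ᶠ[nhds ((0 : ℝ), t)]
      chartMap (E := E) (fun _ ↦ γ) (γ t) := by
    filter_upwards [hD.mem_nhds hp] with q hq
    simp only [chartMap, heq q.2 hq.2]
  rw [flatSesqui_congr e3, ← e1, h0] at e2
  refine chartCoord_injective (h'.mem_source _ hpN') (e2.trans ?_)
  rw [map_zero, map_zero]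

/-- The Euler-Lagrange equation of the sesqui-energy. -/
theorem isInterpolatingSesquiHarmonic_iff {δ₁ δ₂ : ℝ} (hδ₂ : δ₂ ≠ 0) (hJ : IsOpen J)
    (hγ : ContMDiffOn 𝓘(ℝ, ℝ) 𝓘(ℝ, E) ∞ γ J) :
    IsInterpolatingSesquiHarmonic 𝓘(ℝ, E) δ₁ δ₂ J γ ↔
      ∀ t ∈ J, sesquiField (E := E) (δ₁ / δ₂) γ t = 0 := by
  constructor
  · intro hcrit t₀ ht₀
    by_contra hne
    set x₀ := γ t₀ with hx₀
    have hsrc₀ := mem_extChartAt_source (I := 𝓘(ℝ, E)) x₀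
    set w : E := chartCoord x₀ x₀ (sesquiField (E := E) (δ₁ / δ₂) γ t₀) with hw
    have hγat : ∀ t ∈ J, ContMDiffAt 𝓘(ℝ, ℝ) 𝓘(ℝ, E) ∞ γ t := fun t ht ↦
      hγ.contMDiffAt (hJ.mem_nhds ht)
    set q : ℝ → ℝ := fun t ↦ chartMetric x₀ (extChartAt 𝓘(ℝ, E) x₀ (γ t)) w
      (chartCoord x₀ (γ t) (sesquiField (E := E) (δ₁ / δ₂) γ t)) with hq
    -- the domain on which `γ` can be moved in the chart
    have hJ' : IsOpen (J ∩ γ ⁻¹' (extChartAt 𝓘(ℝ, E) x₀).source) :=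
      hγ.continuousOn.isOpen_inter_preimage hJ (isOpen_extChartAt_source x₀)
    set D : Set (ℝ × ℝ) := ((univ : Set ℝ) ×ˢ (J ∩ γ ⁻¹' (extChartAt 𝓘(ℝ, E) x₀).source)) ∩
      (fun p : ℝ × ℝ ↦ extChartAt 𝓘(ℝ, E) x₀ (γ p.2) + p.1 • w) ⁻¹'
        (extChartAt 𝓘(ℝ, E) x₀).target with hD_def
    have hD : IsOpen D := by
      refine ContinuousOn.isOpen_inter_preimage ?_ (isOpen_univ.prod hJ')
        (isOpen_extChartAt_target x₀)
      have h1 : ContinuousOn (fun t ↦ extChartAt 𝓘(ℝ, E) x₀ (γ t))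
          (J ∩ γ ⁻¹' (extChartAt 𝓘(ℝ, E) x₀).source) := fun t ht ↦
        (contDiffAt_extChartAt_comp (hγat t ht.1) ht.2).continuousAt.continuousWithinAt
      exact (h1.comp continuousOn_snd fun p hp ↦ hp.2).add
        (continuousOn_fst.smul continuousOn_const)
    have h0D : ∀ t ∈ J, γ t ∈ (extChartAt 𝓘(ℝ, E) x₀).source → ((0 : ℝ), t) ∈ D := by
      intro t ht hs
      refine ⟨⟨trivial, ht, hs⟩, ?_⟩
      simpa using (extChartAt 𝓘(ℝ, E) x₀).map_source hs
    have inner_eq : ∀ (f : ℝ → ℝ) (D' : Set (ℝ × ℝ)) (hD' : IsOpen D')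
        (hΓ : ContMDiffOn 𝓘(ℝ, ℝ × ℝ) 𝓘(ℝ, E) ∞
          (fun p : ℝ × ℝ ↦ chartVariation γ x₀ f w p.1 p.2) D') (t : ℝ) (ht : (0, t) ∈ D')
        (hs : γ t ∈ (extChartAt 𝓘(ℝ, E) x₀).source),
        inner ℝ (variationField (E := E) (chartVariation γ x₀ f w) 0 t)
          (sesquiField (δ₁ / δ₂) (chartVariation γ x₀ f w 0) t) = f t * q t := by
      intro f D' hD' hΓ t ht hs
      have hs' : chartVariation γ x₀ f w 0 t ∈ (extChartAt 𝓘(ℝ, E) x₀).source := by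
        rw [chartVariation_zero]; exact hs
      have hN : IsVariationChart (E := E) (chartVariation γ x₀ f w) x₀
          (D' ∩ (fun p : ℝ × ℝ ↦ chartVariation γ x₀ f w p.1 p.2) ⁻¹'
            (extChartAt 𝓘(ℝ, E) x₀).source) :=
        ⟨hΓ.continuousOn.isOpen_inter_preimage hD' (isOpen_extChartAt_source _),
          hΓ.mono inter_subset_left, fun _ hq ↦ hq.2⟩
      rw [inner_eq_chartMetric hs', chartCoord_variationField_chartVariation hN ⟨ht, hs'⟩ hs,
        chartVariation_zero, map_smul, _root_.smul_apply, smul_eq_mul]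
    have hq0 : 0 < q t₀ := by
      refine chartMetric_pos ((extChartAt 𝓘(ℝ, E) x₀).map_source hsrc₀) w fun h ↦ hne ?_
      exact chartCoord_injective hsrc₀ (h.trans (map_zero _).symm)
    have hΓ₁ : ContMDiffOn 𝓘(ℝ, ℝ × ℝ) 𝓘(ℝ, E) ∞
        (fun p : ℝ × ℝ ↦ chartVariation γ x₀ (fun _ ↦ 1) w p.1 p.2) D := fun p hp ↦
      (contMDiffAt_chartVariation contDiff_const (hγat _ hp.1.2.1) hp.1.2.2
        (by simpa using hp.2)).contMDiffWithinAt
    have hqpos : ∀ᶠ t in nhds t₀, 0 < q t := by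
      have hc := continuousAt_inner_sesquiField hD hΓ₁ (δ₁ / δ₂) (h0D t₀ ht₀ hsrc₀)
      have he : (fun τ ↦ inner ℝ (variationField (E := E) (chartVariation γ x₀ (fun _ ↦ 1) w) 0 τ)
          (sesquiField (δ₁ / δ₂) (chartVariation γ x₀ (fun _ ↦ 1) w 0) τ)) =ᶠ[nhds t₀] q := by
        filter_upwards [hJ'.mem_nhds ⟨ht₀, hsrc₀⟩] with t ht
        rw [inner_eq _ D hD hΓ₁ t (h0D t ht.1 ht.2) ht.2, one_mul]
      exact (hc.congr he).eventually (lt_mem_nhds hq0)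
    obtain ⟨δ, hδ, hball⟩ := Metric.mem_nhds_iff.1 (hD.mem_nhds (h0D t₀ ht₀ hsrc₀))
    obtain ⟨ρ, hρ, hqball⟩ := Metric.mem_nhds_iff.1 hqpos
    set r : ℝ := min δ ρ / 2 with hr
    have hr0 : 0 < r := half_pos (lt_min hδ hρ)
    have hrδ : r < δ := by have := min_le_left δ ρ; have := lt_min hδ hρ; linarith
    have hrρ : r < ρ := by have := min_le_right δ ρ; have := lt_min hδ hρ; linarith
    set f : ContDiffBump t₀ := ⟨r / 2, r, half_pos hr0, half_lt_self hr0⟩ with hf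
    have hmem : ∀ t ∈ Icc (t₀ - r) (t₀ + r), ∀ σ : ℝ, |σ| < δ → (σ, t) ∈ D := by
      intro t ht σ hσ
      refine hball ?_
      rw [Metric.mem_ball, Prod.dist_eq, max_lt_iff]
      refine ⟨by simpa [Real.dist_eq] using hσ, ?_⟩
      rw [Real.dist_eq, abs_lt]
      constructor <;> linarith [ht.1, ht.2]
    have hmem0 : ∀ t ∈ Icc (t₀ - r) (t₀ + r), ((0 : ℝ), t) ∈ D := fun t ht ↦
      hmem t ht 0 (by simpa using hδ)
    have hfz : ∀ t, t ∉ Ioo (t₀ - r) (t₀ + r) → f t = 0 := by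
      intro t ht
      refine f.zero_of_le_dist ?_
      by_contra hlt
      rw [not_le, Real.dist_eq, abs_lt] at hlt
      exact ht ⟨by linarith [hlt.1], by linarith [hlt.2]⟩
    have hΓ : ContMDiffOn 𝓘(ℝ, ℝ × ℝ) 𝓘(ℝ, E) ∞
        (fun p : ℝ × ℝ ↦ chartVariation γ x₀ f w p.1 p.2) (Ioo (-δ) δ ×ˢ J) := by
      rintro ⟨σ, t⟩ ⟨hσ, ht⟩
      refine ContMDiffAt.contMDiffWithinAt ?_
      by_cases htr : t ∈ Icc (t₀ - r) (t₀ + r)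
      · have h1 : |σ * f t| < δ := by
          rw [abs_mul, abs_of_nonneg f.nonneg]
          have := abs_lt.2 hσ
          have := f.le_one (x := t)
          nlinarith [abs_nonneg σ]
        have h2 := hmem t htr _ h1
        exact contMDiffAt_chartVariation f.contDiff (hγat t ht) h2.1.2.2 h2.2
      · refine contMDiffAt_chartVariation_of_eventually_eq_zero (hγat t ht) ?_
        filter_upwards [isClosed_Icc.isOpen_compl.mem_nhds htr] with τ hτ
        exact hfz τ fun h ↦ hτ (Ioo_subset_Icc_self h)
    have hab : t₀ - r < t₀ + r := by linarith
    have hIcc : Icc (t₀ - r) (t₀ + r) ⊆ J := fun t ht ↦ (hmem0 t ht).1.2.1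
    have hfix : ∀ s ∈ Ioo (-δ) δ, ∀ t ∈ J, t ∉ Ioo (t₀ - r) (t₀ + r) →
        chartVariation γ x₀ f w s t = γ t := fun s _ t _ ht ↦
      chartVariation_of_mul_eq_zero (by rw [hfz t ht, mul_zero])
    have hder := hasDerivAt_sesquiEnergy (δ₁ := δ₁) hδ₂ hJ hab hIcc hδ hΓ
      (fun s hs t ht hts ↦ by rw [hfix s hs t ht hts, chartVariation_zero])
    have hzero := hder.unique (hcrit _ _ hab hIcc δ hδ _ hΓ
      (fun t _ ↦ by rw [chartVariation_zero]) hfix)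
    rw [intervalIntegral.integral_const_mul] at hzero
    have hpos : 0 < ∫ t in (t₀ - r)..(t₀ + r),
        inner ℝ (variationField (E := E) (chartVariation γ x₀ f w) 0 t)
          (sesquiField (δ₁ / δ₂) (chartVariation γ x₀ f w 0) t) := by
      have h0δ : (0 : ℝ) ∈ Ioo (-δ) δ := ⟨by linarith, hδ⟩
      refine intervalIntegral.intervalIntegral_pos_of_pos_on ?_ ?_ hab
      · refine ContinuousOn.intervalIntegrable fun t ht ↦ ?_
        rw [uIcc_of_le hab.le] at ht
        exact (continuousAt_inner_sesquiField (isOpen_Ioo.prod hJ) hΓ (δ₁ / δ₂)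
          ⟨h0δ, hIcc ht⟩).continuousWithinAt
      · intro t ht
        have ht' := Ioo_subset_Icc_self ht
        rw [inner_eq f _ (isOpen_Ioo.prod hJ) hΓ t ⟨h0δ, hIcc ht'⟩ (hmem0 t ht').1.2.2]
        refine mul_pos (f.pos_of_mem_ball ?_) (hqball ?_)
        · rw [Metric.mem_ball, Real.dist_eq, abs_lt]
          exact ⟨by linarith [ht.1], by linarith [ht.2]⟩
        · rw [Metric.mem_ball, Real.dist_eq, abs_lt]
          exact ⟨by linarith [ht.1], by linarith [ht.2]⟩
    rcases mul_eq_zero.1 hzero with h | h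
    · exact hδ₂ (by linarith)
    · exact hpos.ne' h
  · intro hzero a b hab hIcc ε hε Γ hΓ hΓ0 hfix
    have h0 : (0 : ℝ) ∈ Ioo (-ε) ε := ⟨by linarith, hε⟩
    have hder := hasDerivAt_sesquiEnergy (δ₁ := δ₁) hδ₂ hJ hab hIcc hε hΓ
      (fun s hs t ht hts ↦ by rw [hfix s hs t ht hts, hΓ0 t ht])
    refine hder.congr_deriv (intervalIntegral.integral_zero_ae (.of_forall fun t ht ↦ ?_))
    have htJ : t ∈ J := by
      rw [uIoc_of_le hab.le] at ht
      exact hIcc (Ioc_subset_Icc_self ht)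
    have hΓ0' : ContMDiffOn 𝓘(ℝ, ℝ) 𝓘(ℝ, E) ∞ (Γ 0) J :=
      hγ.congr hΓ0
    rw [sesquiField_eq_zero_congr hJ hγ hΓ0' (fun t ht ↦ (hΓ0 t ht).symm) htJ (hzero t htJ),
      inner_zero_right, mul_zero]

end EulerLagrange

section AlongCurve

variable {E : Type*} [NormedAddCommGroup E] [NormedSpace ℝ E]
  {M : Type*} [TopologicalSpace M] [ChartedSpace E M] [IsManifold 𝓘(ℝ, E) ∞ M]
  {γ : ℝ → M} {V W : Π s, TangentSpace 𝓘(ℝ, E) (γ s)} {f : ℝ → ℝ} {t : ℝ}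

/-- The vector field `V` along `γ` is smooth at `t`. -/
def IsSmoothAlong (γ : ℝ → M) (V : Π s, TangentSpace 𝓘(ℝ, E) (γ s)) (t : ℝ) : Prop :=
  ContDiffAt ℝ ∞ (fun s ↦ chartCoord (γ t) (γ s) (V s)) t

namespace IsSmoothAlong

lemma add (hV : IsSmoothAlong γ V t) (hW : IsSmoothAlong γ W t) :
    IsSmoothAlong γ (fun s ↦ V s + W s) t := by
  refine (ContDiffAt.add hV hW).congr_of_eventuallyEq (.of_forall fun s ↦ ?_)
  exact map_add (chartCoord (γ t) (γ s)) (V s) (W s)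

lemma smul (hf : ContDiffAt ℝ ∞ f t) (hV : IsSmoothAlong γ V t) :
    IsSmoothAlong γ (fun s ↦ f s • V s) t := by
  refine (ContDiffAt.smul hf hV).congr_of_eventuallyEq (.of_forall fun s ↦ ?_)
  exact map_smul (chartCoord (γ t) (γ s)) (f s) (V s)

lemma of_eventually_eq_zero (h : ∀ᶠ s in nhds t, V s = 0) : IsSmoothAlong γ V t := by
  refine (contDiffAt_const (c := (0 : E))).congr_of_eventuallyEq ?_
  filter_upwards [h] with s hs
  rw [hs]
  exact map_zero _

end IsSmoothAlong

variable [FiniteDimensional ℝ E] [RiemannianBundle (fun x : M ↦ TangentSpace 𝓘(ℝ, E) x)]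
  [IsContMDiffRiemannianBundle 𝓘(ℝ, E) ∞ E (fun x : M ↦ TangentSpace 𝓘(ℝ, E) x)]

lemma covDerivAlong_congr (h : ∀ᶠ s in nhds t, V s = W s) :
    covDerivAlong 𝓘(ℝ, E) γ V t = covDerivAlong 𝓘(ℝ, E) γ W t := by
  have e : (fun s ↦ ((trivializationAt E (TangentSpace 𝓘(ℝ, E) : M → Type _) (γ t))
        (TotalSpace.mk' E (γ s) (V s))).2) =ᶠ[nhds t]
      fun s ↦ ((trivializationAt E (TangentSpace 𝓘(ℝ, E) : M → Type _) (γ t))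
        (TotalSpace.mk' E (γ s) (W s))).2 := by
    filter_upwards [h] with s hs
    rw [hs]
  rw [covDerivAlong, covDerivAlong, e.deriv_eq, h.self_of_nhds]

lemma covDerivAlong_add (hγ : ContMDiffAt 𝓘(ℝ, ℝ) 𝓘(ℝ, E) ∞ γ t) (hV : IsSmoothAlong γ V t)
    (hW : IsSmoothAlong γ W t) : covDerivAlong 𝓘(ℝ, E) γ (fun s ↦ V s + W s) t
      = covDerivAlong 𝓘(ℝ, E) γ V t + covDerivAlong 𝓘(ℝ, E) γ W t := by
  have hx := mem_extChartAt_source (I := 𝓘(ℝ, E)) (γ t)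
  refine chartCoord_injective hx ?_
  rw [map_add, chartCoord_covDerivAlong hγ hx hV, chartCoord_covDerivAlong hγ hx hW,
    chartCoord_covDerivAlong hγ hx (hV.add hW),
    ← flatCovDeriv_add (ContDiffAt.differentiableAt hV (by simp))
      (ContDiffAt.differentiableAt hW (by simp))]
  exact flatCovDeriv_congr (.of_forall fun s ↦ map_add (chartCoord (γ t) (γ s)) (V s) (W s))
    (Filter.EventuallyEq.refl _ _) 1

lemma covDerivAlong_smul (hγ : ContMDiffAt 𝓘(ℝ, ℝ) 𝓘(ℝ, E) ∞ γ t) (hf : ContDiffAt ℝ ∞ f t)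
    (hV : IsSmoothAlong γ V t) : covDerivAlong 𝓘(ℝ, E) γ (fun s ↦ f s • V s) t
      = f t • covDerivAlong 𝓘(ℝ, E) γ V t + deriv f t • V t := by
  have hx := mem_extChartAt_source (I := 𝓘(ℝ, E)) (γ t)
  refine chartCoord_injective hx ?_
  rw [map_add, map_smul, map_smul, chartCoord_covDerivAlong hγ hx hV,
    chartCoord_covDerivAlong hγ hx (hV.smul hf), ← fderiv_apply_one_eq_deriv,
    ← flatCovDeriv_smul (hf.differentiableAt (by simp)) (ContDiffAt.differentiableAt hV (by simp))]
  exact flatCovDeriv_congr (.of_forall fun s ↦ map_smul (chartCoord (γ t) (γ s)) (f s) (V s))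
    (Filter.EventuallyEq.refl _ _) 1

end AlongCurve

section Frenet

variable {E : Type*} [NormedAddCommGroup E] [NormedSpace ℝ E] [FiniteDimensional ℝ E]
  {M : Type*} [TopologicalSpace M] [ChartedSpace E M] [IsManifold 𝓘(ℝ, E) ∞ M]
  [RiemannianBundle (fun x : M ↦ TangentSpace 𝓘(ℝ, E) x)]
  [IsContMDiffRiemannianBundle 𝓘(ℝ, E) ∞ E (fun x : M ↦ TangentSpace 𝓘(ℝ, E) x)]
  {J : Set ℝ} {γ : ℝ → M} {r : ℕ} {F : ℕ → Π t : ℝ, TangentSpace 𝓘(ℝ, E) (γ t)} {k : ℕ → ℝ → ℝ}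
  {t : ℝ}

namespace IsFrenetCurve

variable (h : IsFrenetCurve 𝓘(ℝ, E) J γ r F k) (hJ : IsOpen J)
include h hJ

lemma contMDiffAt_curve (ht : t ∈ J) : ContMDiffAt 𝓘(ℝ, ℝ) 𝓘(ℝ, E) ∞ γ t :=
  h.contMDiffOn_curve.contMDiffAt (hJ.mem_nhds ht)

lemma contDiffAt_curvature {i : ℕ} (hi : 1 ≤ i) (ht : t ∈ J) : ContDiffAt ℝ ∞ (k i) t := by
  rcases lt_or_ge i r with hir | hir
  · exact (h.contDiffOn_curvature i hi hir).contDiffAt (hJ.mem_nhds ht)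
  · refine (contDiffAt_const (c := (0 : ℝ))).congr_of_eventuallyEq ?_
    filter_upwards [hJ.mem_nhds ht] with s hs using h.curvature_eq_zero i hir s hs

lemma deriv_curvature_eq_zero {i : ℕ} (hi : r ≤ i) (ht : t ∈ J) : deriv (k i) t = 0 := by
  have e : k i =ᶠ[nhds t] fun _ ↦ 0 := by
    filter_upwards [hJ.mem_nhds ht] with s hs using h.curvature_eq_zero i hi s hs
  rw [e.deriv_eq, deriv_const]

lemma isSmoothAlong_frame {i : ℕ} (hi : 1 ≤ i) (hir : i ≤ r) (ht : t ∈ J) :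
    IsSmoothAlong γ (F i) t :=
  contDiffAt_chartCoord_of_contMDiffAt
    ((h.contMDiffOn_frame i hi hir).contMDiffAt (hJ.mem_nhds ht)) (mem_extChartAt_source (γ t))

lemma tensionField_eq (ht : t ∈ J) : tensionField 𝓘(ℝ, E) γ t = k 1 t • F 2 t := by
  rw [← h.deriv_frame_one t ht, tensionField]
  refine covDerivAlong_congr ?_
  filter_upwards [hJ.mem_nhds ht] with s hs using (h.frame_one s hs).symm

lemma isSmoothAlong_curvature_smul_frame {i : ℕ} (hi : 1 ≤ i) (ht : t ∈ J) :
    IsSmoothAlong γ (fun s ↦ k i s • F (i + 1) s) t := by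
  rcases lt_or_ge i r with hir | hir
  · exact (h.isSmoothAlong_frame hJ (by omega) (by omega) ht).smul (h.contDiffAt_curvature hJ hi ht)
  · refine .of_eventually_eq_zero ?_
    filter_upwards [hJ.mem_nhds ht] with s hs
    rw [h.curvature_eq_zero i hir s hs, zero_smul]

lemma covDerivAlong_curvature_smul_frame {i : ℕ} (hi : 1 ≤ i) (ht : t ∈ J) :
    covDerivAlong 𝓘(ℝ, E) γ (fun s ↦ k i s • F (i + 1) s) t
      = deriv (k i) t • F (i + 1) t - k i t ^ 2 • F i t + (k i t * k (i + 1) t) • F (i + 2) t := by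
  rcases lt_or_ge i r with hir | hir
  · rw [covDerivAlong_smul (h.contMDiffAt_curve hJ ht) (h.contDiffAt_curvature hJ hi ht)
      (h.isSmoothAlong_frame hJ (by omega) (by omega) ht), h.deriv_frame i hi hir t ht]
    module
  · have e : ∀ᶠ s in nhds t, k i s • F (i + 1) s = (0 : ℝ) • k i s • F (i + 1) s := by
      filter_upwards [hJ.mem_nhds ht] with s hs
      rw [h.curvature_eq_zero i hir s hs, zero_smul, smul_zero]
    rw [covDerivAlong_congr e, covDerivAlong_smul (f := fun _ ↦ 0) (h.contMDiffAt_curve hJ ht)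
      contDiffAt_const (h.isSmoothAlong_curvature_smul_frame hJ hi ht),
      h.deriv_curvature_eq_zero hJ hir ht, h.curvature_eq_zero i hir t ht, deriv_const]
    module

lemma covDerivAlong_tensionField (ht : t ∈ J) :
    covDerivAlong 𝓘(ℝ, E) γ (tensionField 𝓘(ℝ, E) γ) t
      = deriv (k 1) t • F 2 t - k 1 t ^ 2 • F 1 t + k 1 t • k 2 t • F 3 t := by
  rw [← mul_smul, ← h.covDerivAlong_curvature_smul_frame hJ le_rfl ht]
  refine covDerivAlong_congr ?_
  filter_upwards [hJ.mem_nhds ht] with s hs using h.tensionField_eq hJ hs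

lemma covDerivAlong_covDerivAlong_tensionField (hr : 2 ≤ r) (ht : t ∈ J) :
    covDerivAlong 𝓘(ℝ, E) γ (covDerivAlong 𝓘(ℝ, E) γ (tensionField 𝓘(ℝ, E) γ)) t
      = (-3 * k 1 t * deriv (k 1) t) • F 1 t
        + (deriv (deriv (k 1)) t - k 1 t ^ 3 - k 1 t * k 2 t ^ 2) • F 2 t
        + (2 * deriv (k 1) t * k 2 t + k 1 t * deriv (k 2) t) • F 3 t
        + (k 1 t * k 2 t * k 3 t) • F 4 t := by
  have hγ := h.contMDiffAt_curve hJ ht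
  have hk := h.contDiffAt_curvature hJ le_rfl ht
  have hdk : ContDiffAt ℝ ∞ (deriv (k 1)) t := by
    have := contDiffAt_fderiv_apply hk 1
    exact this
  have hk2 : ContDiffAt ℝ ∞ (fun s ↦ -(k 1 s ^ 2)) t := (hk.pow 2).neg
  have hF1 := h.isSmoothAlong_frame hJ le_rfl (by omega : 1 ≤ r) ht
  have hF2 := h.isSmoothAlong_frame hJ (by omega : 1 ≤ 2) hr ht
  have hG := h.isSmoothAlong_curvature_smul_frame hJ (by omega : 1 ≤ 2) ht
  have e : ∀ᶠ s in nhds t, covDerivAlong 𝓘(ℝ, E) γ (tensionField 𝓘(ℝ, E) γ) s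
      = (deriv (k 1) s • F 2 s + (-(k 1 s ^ 2)) • F 1 s) + k 1 s • k 2 s • F (2 + 1) s := by
    filter_upwards [hJ.mem_nhds ht] with s hs
    rw [h.covDerivAlong_tensionField hJ hs]
    module
  have hd2 : deriv (fun s ↦ -(k 1 s ^ 2)) t = -(2 * k 1 t * deriv (k 1) t) := by
    have := ((hk.differentiableAt (by simp)).hasDerivAt.fun_pow 2).fun_neg.deriv
    simpa using this
  have c1 := h.deriv_frame_one t ht
  have c2 : covDerivAlong 𝓘(ℝ, E) γ (F 2) t = -(k 1 t) • F 1 t + k 2 t • F 3 t :=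
    h.deriv_frame 1 le_rfl hr t ht
  have c3 : covDerivAlong 𝓘(ℝ, E) γ (fun s ↦ k 2 s • F (2 + 1) s) t
      = deriv (k 2) t • F 3 t - k 2 t ^ 2 • F 2 t + (k 2 t * k 3 t) • F 4 t :=
    h.covDerivAlong_curvature_smul_frame hJ (by omega : 1 ≤ 2) ht
  rw [covDerivAlong_congr e, covDerivAlong_add hγ ((hF2.smul hdk).add (hF1.smul hk2)) (hG.smul hk),
    covDerivAlong_add hγ (hF2.smul hdk) (hF1.smul hk2), covDerivAlong_smul hγ hdk hF2,
    covDerivAlong_smul hγ hk2 hF1, covDerivAlong_smul hγ hk hG, c1, c2, c3, hd2]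
  module

end IsFrenetCurve

variable {φ : Π x : M, TangentSpace 𝓘(ℝ, E) x →L[ℝ] TangentSpace 𝓘(ℝ, E) x}
  {ξ : Π x : M, TangentSpace 𝓘(ℝ, E) x} {η : Π x : M, TangentSpace 𝓘(ℝ, E) x →L[ℝ] ℝ} {c : ℝ}

namespace IsFrenetCurve

/-- The Euler-Lagrange field of a Legendre Frenet curve with `φT ⊥ E₂`. -/
theorem sesquiField_eq (h : IsFrenetCurve 𝓘(ℝ, E) J γ r F k) (hJ : IsOpen J) (hr : 2 ≤ r)
    (hM : IsSasakianSpaceForm 𝓘(ℝ, E) φ ξ η c)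
    (hL : ∀ t ∈ J, η (γ t) (velocity 𝓘(ℝ, E) γ t) = 0)
    (hperp : ∀ t ∈ J, inner ℝ (φ (γ t) (velocity 𝓘(ℝ, E) γ t)) (F 2 t) = 0) (κ : ℝ) (ht : t ∈ J) :
    sesquiField κ γ t = (-3 * k 1 t * deriv (k 1) t) • F 1 t
        + (deriv (deriv (k 1)) t + k 1 t * ((c + 3) / 4 - κ - k 1 t ^ 2 - k 2 t ^ 2)) • F 2 t
        + (2 * deriv (k 1) t * k 2 t + k 1 t * deriv (k 2) t) • F 3 t
        + (k 1 t * k 2 t * k 3 t) • F 4 t := by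
  have hv := h.frame_one t ht
  have hτ := h.tensionField_eq hJ ht
  have h11 := h.orthonormal t ht 1 1 le_rfl (by omega) le_rfl (by omega)
  have h12 := h.orthonormal t ht 1 2 le_rfl (by omega) (by omega) hr
  have hev : ∀ᶠ s in nhds t, s ∈ J := hJ.mem_nhds ht
  have hη : η (γ t) (k 1 t • F 2 t) = 0 := by
    rw [← hτ]
    exact hM.toIsSasakian.eta_tensionField_eq_zero (h.contMDiffAt_curve hJ ht)
      (hev.mono fun s hs ↦ h.contMDiffAt_curve hJ hs) (hev.mono hL)
  have hp := hperp t ht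
  have hLt := hL t ht
  rw [← hv] at hp hLt
  have hR : riemannCurvature (γ t) (k 1 t • F 2 t) (F 1 t) (F 1 t)
      = ((c + 3) / 4) • k 1 t • F 2 t := by
    refine hM.riemannCurvature_legendre (by simpa using h11) hLt hη ?_ ?_
    · rw [inner_smul_right, h12]; simp
    · rw [inner_smul_right, hp, mul_zero]
  rw [sesquiField, h.covDerivAlong_covDerivAlong_tensionField hJ hr ht, hτ, ← hv, hR]
  module

/-- The Frenet components of a combination of `F 1, …, F 4` whose coefficients vanish beyond the
osculating order. -/
lemma linearCombination_eq_zero_iff (h : IsFrenetCurve 𝓘(ℝ, E) J γ r F k) (hr : 2 ≤ r) (ht : t ∈ J)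
    {a₁ a₂ a₃ a₄ : ℝ} (h₃ : r < 3 → a₃ = 0) (h₄ : r < 4 → a₄ = 0) :
    a₁ • F 1 t + a₂ • F 2 t + a₃ • F 3 t + a₄ • F 4 t = 0 ↔
      a₁ = 0 ∧ a₂ = 0 ∧ a₃ = 0 ∧ a₄ = 0 := by
  constructor
  · intro h0
    have hin : ∀ (i j : ℕ) (a : ℝ), 1 ≤ i → i ≤ r → 1 ≤ j → (r < j → a = 0) →
        inner ℝ (F i t) (a • F j t) = if i = j then a else 0 := by
      intro i j a hi hir hj ha
      rw [inner_smul_right]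
      rcases lt_or_ge r j with hjr | hjr
      · rw [ha hjr]; simp
      · rw [h.orthonormal t ht i j hi hir hj hjr]; simp
    have key : ∀ i, 1 ≤ i → i ≤ r → (if i = 1 then a₁ else 0) + (if i = 2 then a₂ else 0)
        + (if i = 3 then a₃ else 0) + (if i = 4 then a₄ else 0) = 0 := by
      intro i hi hir
      have h1 : inner ℝ (F i t) (a₁ • F 1 t + a₂ • F 2 t + a₃ • F 3 t + a₄ • F 4 t) = (0 : ℝ) := by
        rw [h0, inner_zero_right]
      rwa [inner_add_right, inner_add_right, inner_add_right,
        hin i 1 a₁ hi hir le_rfl (by omega), hin i 2 a₂ hi hir (by omega) (by omega),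
        hin i 3 a₃ hi hir (by omega) h₃, hin i 4 a₄ hi hir (by omega) h₄] at h1
    refine ⟨by simpa using key 1 le_rfl (by omega), by simpa using key 2 (by omega) hr, ?_, ?_⟩
    · rcases lt_or_ge r 3 with hr3 | hr3
      · exact h₃ hr3
      · simpa using key 3 (by omega) hr3
    · rcases lt_or_ge r 4 with hr4 | hr4
      · exact h₄ hr4
      · simpa using key 4 (by omega) hr4
  · rintro ⟨rfl, rfl, rfl, rfl⟩
    simp

end IsFrenetCurve

end Frenet

theorem proposition3p4 {n : ℕ} {M : Type*} [TopologicalSpace M] [T2Space M]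
    [SecondCountableTopology M]
    [ChartedSpace (EuclideanSpace ℝ (Fin (2 * n + 1))) M] [IsManifold (𝓡 (2 * n + 1)) ∞ M]
    [RiemannianBundle (fun x : M ↦ TangentSpace (𝓡 (2 * n + 1)) x)]
    [IsContMDiffRiemannianBundle (𝓡 (2 * n + 1)) ∞ (EuclideanSpace ℝ (Fin (2 * n + 1)))
      (fun x : M ↦ TangentSpace (𝓡 (2 * n + 1)) x)]
    -- the Sasakian space form `M(c)`
    (φ : Π x : M, TangentSpace (𝓡 (2 * n + 1)) x →L[ℝ] TangentSpace (𝓡 (2 * n + 1)) x)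
    (ξ : Π x : M, TangentSpace (𝓡 (2 * n + 1)) x)
    (η : Π x : M, TangentSpace (𝓡 (2 * n + 1)) x →L[ℝ] ℝ)
    (c : ℝ) (hM : IsSasakianSpaceForm (𝓡 (2 * n + 1)) φ ξ η c) (hc : c ≠ 1)
    -- the Frenet curve `γ : J → M(c)` of osculating order `r`, for which `E₂` makes sense
    (J : Set ℝ) (hJ_open : IsOpen J) (hJ_conn : J.OrdConnected) (hJ_ne : J.Nonempty)
    (γ : ℝ → M) (r : ℕ) (hr : 2 ≤ r)
    (F : ℕ → Π t : ℝ, TangentSpace (𝓡 (2 * n + 1)) (γ t)) (k : ℕ → ℝ → ℝ)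
    (hγ : IsFrenetCurve (𝓡 (2 * n + 1)) J γ r F k)
    -- `γ` is a Legendre curve and `φT ⊥ E₂`
    (hLegendre : ∀ t ∈ J, η (γ t) (velocity (𝓡 (2 * n + 1)) γ t) = 0)
    (hperp : ∀ t ∈ J, inner ℝ (φ (γ t) (velocity (𝓡 (2 * n + 1)) γ t)) (F 2 t) = 0)
    (δ₁ δ₂ : ℝ) (hδ₂ : δ₂ ≠ 0) (hδ : δ₁ / δ₂ ≠ 0) :
    IsInterpolatingSesquiHarmonic (𝓡 (2 * n + 1)) δ₁ δ₂ J γ ↔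
      ∃ κ₁ κ₂ : ℝ, 0 < κ₁ ∧ (∀ t ∈ J, k 1 t = κ₁) ∧ (∀ t ∈ J, k 2 t = κ₂) ∧
        κ₁ ^ 2 + κ₂ ^ 2 = (c + 3) / 4 - δ₁ / δ₂ ∧ (∀ t ∈ J, k 2 t * k 3 t = 0) := by
  rw [isInterpolatingSesquiHarmonic_iff hδ₂ hJ_open hγ.contMDiffOn_curve]
  have hk1 : ∀ t ∈ J, 0 < k 1 t := hγ.curvature_pos 1 le_rfl (by omega)
  have hcomp : ∀ t ∈ J, (sesquiField (E := EuclideanSpace ℝ (Fin (2 * n + 1))) (δ₁ / δ₂) γ t = 0 ↔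
      -3 * k 1 t * deriv (k 1) t = 0 ∧
      deriv (deriv (k 1)) t + k 1 t * ((c + 3) / 4 - δ₁ / δ₂ - k 1 t ^ 2 - k 2 t ^ 2) = 0 ∧
      2 * deriv (k 1) t * k 2 t + k 1 t * deriv (k 2) t = 0 ∧ k 1 t * k 2 t * k 3 t = 0) := by
    intro t ht
    rw [hγ.sesquiField_eq hJ_open hr hM hLegendre hperp (δ₁ / δ₂) ht,
      hγ.linearCombination_eq_zero_iff hr ht]
    · intro h3
      rw [hγ.deriv_curvature_eq_zero hJ_open (i := 2) (by omega) ht,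
        hγ.curvature_eq_zero 2 (by omega) t ht]
      ring
    · intro h4
      rw [hγ.curvature_eq_zero 3 (by omega) t ht, mul_zero]
  have deriv_eq_zero : ∀ {f : ℝ → ℝ} {a : ℝ}, (∀ t ∈ J, f t = a) → ∀ t ∈ J, deriv f t = 0 := by
    intro f a hf t ht
    have e : f =ᶠ[nhds t] fun _ ↦ a := by
      filter_upwards [hJ_open.mem_nhds ht] with s hs using hf s hs
    rw [e.deriv_eq, deriv_const]
  constructor
  · intro h
    have h' := fun t ht ↦ (hcomp t ht).1 (h t ht)
    have hd1 : ∀ t ∈ J, deriv (k 1) t = 0 := fun t ht ↦ by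
      have := (h' t ht).1
      have := (hk1 t ht).ne'
      simp_all
    have hd2 : ∀ t ∈ J, deriv (k 2) t = 0 := fun t ht ↦ by
      have := (h' t ht).2.2.1
      have := (hk1 t ht).ne'
      simp_all
    have hconst : ∀ i, 1 ≤ i → (∀ t ∈ J, deriv (k i) t = 0) → ∀ s ∈ J, ∀ t ∈ J, k i s = k i t :=
      fun i hi hd s hs t ht ↦ hJ_open.is_const_of_deriv_eq_zero hJ_conn.isPreconnected
        (fun u hu ↦ ((hγ.contDiffAt_curvature hJ_open hi hu).differentiableAt
          (by simp)).differentiableWithinAt) hd hs ht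
    obtain ⟨t₀, ht₀⟩ := hJ_ne
    refine ⟨k 1 t₀, k 2 t₀, hk1 t₀ ht₀, fun t ht ↦ hconst 1 le_rfl hd1 t ht t₀ ht₀,
      fun t ht ↦ hconst 2 (by omega) hd2 t ht t₀ ht₀, ?_, fun t ht ↦ ?_⟩
    · have h2 := (h' t₀ ht₀).2.1
      rw [deriv_eq_zero hd1 t₀ ht₀, zero_add] at h2
      have := (mul_eq_zero.1 h2).resolve_left (hk1 t₀ ht₀).ne'
      linarith
    · have h4 := (h' t ht).2.2.2
      rw [mul_assoc] at h4
      exact (mul_eq_zero.1 h4).resolve_left (hk1 t ht).ne'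
  · rintro ⟨κ₁, κ₂, -, h1, h2, h12, h23⟩ t ht
    rw [hcomp t ht]
    have hd1 := deriv_eq_zero h1
    have hd2 := deriv_eq_zero h2
    refine ⟨by rw [hd1 t ht, mul_zero], ?_, by rw [hd1 t ht, hd2 t ht]; ring, ?_⟩
    · rw [deriv_eq_zero hd1 t ht, h1 t ht, h2 t ht, ← h12]
      ring
    · rw [mul_assoc, h23 t ht, mul_zero]
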